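/- **Setting.** Let $\mathcal G$ be a directed acyclic graph on $\{1,\dots,p\}$, let $P_i$ be the set of parents of $i$, and fix $m\ge 0$, hyperparameters $\delta,\tau>0$ and a positive definite $m\times m$ matrix $V$. For an $n\times p$ data matrix $\boldsymbol X=(\boldsymbol x_1,\dots,\boldsymbol x_p)$, let $\boldsymbol x_{P_i}$ be the matrix of the columns $\boldsymbol x_j$, $j\in P_i$, and let $Q$ be an $n\times m$ matrix of exogenous variables of full column rank. Let $P$ be an $n\times(n-m)$ matrix with $P^TQ=0$, $P^TP=I$, $PP^T=I-Q(Q^TQ)^{-1}Q^T$. Independently over $i$, the parameters $(\boldsymbol\gamma_i,\psi_i)\in\mathbb R^{P_i}\times(0,\infty)$ have the prior $$\boldsymbol\gamma_i\mid\psi_i\sim N(0,\tau^{-1}\psi_i I),\qquad \psi_i\sim \text{Inverse Gamma}\Big(\frac{\delta+|P_i|}2,\frac\tau2\Big).$$ They determine the covariance matrix $\Sigma=(I-\Gamma)^{-1}\operatorname{diag}(\psi_1,\dots,\psi_p)(I-\Gamma)^{-T}$, where $\Gamma_{ij}=\gamma_{ij}$ for $j\in P_i$ and $\Gamma_{ij}=0$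 otherwise. * *Bayesian approach.* In addition $\boldsymbol b_i\mid\psi_i\sim N_m(0,\psi_iV)$, conditionally independent of $\boldsymbol\gamma_i$ given $\psi_i$, and the likelihood is $\prod_i f(\boldsymbol x_i\mid \boldsymbol x_{P_i})$ with $\boldsymbol x_i\mid\boldsymbol x_{P_i},\boldsymbol\gamma_i,\psi_i,\boldsymbol b_i\sim N(\boldsymbol x_{P_i}\boldsymbol\gamma_i+Q\boldsymbol b_i,\psi_iI)$. Let $f_B(\Sigma\mid\boldsymbol X)$ be the resulting posterior distribution of $\Sigma$. * *Residual approach.* The likelihood is that of $P^T\boldsymbol X$, with $P^T\boldsymbol x_i\sim N_{n-m}(P^T\boldsymbol x_{P_i}\boldsymbol\gamma_i,\psi_iI)$. Let $f_R(\Sigma\mid\boldsymbol X)$ be the resulting posterior distribution of $\Sigma$. Let $D_\Sigma\{f_B(\Sigma\mid\boldsymbol X),f_R(\Sigma\mid\boldsymbol X)\}$ be the Kullback–Leibler divergence of these two distributions. **Theorem.** As $n\to\infty$, $D_\Sigma\{f_B(\Sigma\mid\boldsymbol X),f_R(\Sigma\mid\boldsymbol X)\}\to0$, in each of the following two situations.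 1. *(Data from the model.)* The data are the first $n$ samples from the Gaussian linear model over $\mathcal G$: there are fixed $\boldsymbol\gamma_i\in\mathbb R^{P_i}$, $\psi_i>0$, $\boldsymbol b_i\in\mathbb R^m$ and rows $\boldsymbol q_t\in\mathbb R^m$, $t\ge1$, with $$x_{ti}=\sum_{j\in P_i}\gamma_{ij}x_{tj}+\boldsymbol q_t^T\boldsymbol b_i+\varepsilon_{ti},\qquad \varepsilon_{ti}\sim N(0,\psi_i)\text{ independent},$$ and $Q=Q_n$, with rows $\boldsymbol q_1,\dots,\boldsymbol q_n$, has rank $m$ for some $n$ (hence for all larger $n$). Then the convergence holds almost surely. 2. *(Given data.)* $\boldsymbol X=\boldsymbol X_n$ and $Q=Q_n$ are arbitrary sequences of matrices such that, for some constants $c>0$ and $C$ and all large $n$, $\boldsymbol x_i^T\boldsymbol x_i\le Cn$ for every $i$ (for instance, data centred and scaled so that $\boldsymbol x_i^T\boldsymbol x_i=n-1$) and $$\|\boldsymbol X_nu+Q_nv\|^2\ge c\,n\,(\|u\|^2+\|v\|^2)\qquad\text{for all }u\in\mathbb R^p,\ v\in\mathbb R^m .$$ -/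

import Mathlib

open MeasureTheory ProbabilityTheory Filter Topology
open scoped Matrix ENNReal NNReal

noncomputable section

namespace ExoNetwork

/-- The density of the inverse gamma distribution with shape `a` and scale `β`. -/
def invGammaDensity (a β x : ℝ) : ℝ :=
  if 0 < x then β ^ a / Real.Gamma a * x ^ (-a - 1) * Real.exp (-β / x) else 0

/-- The density of the multivariate normal distribution `N(μ, S)`, for positive definite `S`. -/
def normalDensity {ι : Type*} [Fintype ι] [DecidableEq ι]
    (μ : ι → ℝ) (S : Matrix ι ι ℝ) (x : ι → ℝ) : ℝ :=
  (√((2 * Real.pi) ^ Fintype.card ι * S.det))⁻¹ *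
    Real.exp (-(1 / 2) * ((x - μ) ⬝ᵥ (S⁻¹ *ᵥ (x - μ))))

/-- Bayes' theorem: the posterior distribution on `Θ` for a prior density and a likelihood,
that is, the probability measure with Lebesgue density proportional to their product. -/
def posterior {Θ : Type*} [MeasureSpace Θ] (prior likelihood : Θ → ℝ) : Measure Θ :=
  (∫⁻ θ, ENNReal.ofReal (prior θ * likelihood θ))⁻¹ •
    (volume : Measure Θ).withDensity (fun θ => ENNReal.ofReal (prior θ * likelihood θ))

/-- The entrywise (Borel) sigma-algebra on real square matrices. -/
instance matrixMeasurableSpace {p : ℕ} : MeasurableSpace (Matrix (Fin p) (Fin p) ℝ) :=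
  inferInstanceAs (MeasurableSpace (Fin p → Fin p → ℝ))

/-- A directed graph is acyclic if no vertex lies on a directed cycle (or loop). -/
def IsAcyclic {W : Type*} (G : Digraph W) : Prop :=
  ∀ v, ¬ Relation.TransGen G.Adj v v

/-- The index set of the parents of the vertex `i`. -/
abbrev Parents {p : ℕ} (G : Digraph (Fin p)) (i : Fin p) : Type :=
  {j : Fin p // G.Adj j i}

/-- The network parameters `(γ_i, ψ_i)`, `i = 1, …, p`. -/
abbrev Params {p : ℕ} (G : Digraph (Fin p)) : Type :=
  (i : Fin p) → (Parents G i → ℝ) × ℝ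

/-- The network parameters with the effects of `m` exogenous variables:
`((γ_i, ψ_i), b_i)`, `i = 1, …, p`. -/
abbrev FullParams {p : ℕ} (G : Digraph (Fin p)) (m : ℕ) : Type :=
  (i : Fin p) → ((Parents G i → ℝ) × ℝ) × (Fin m → ℝ)

section

variable {p m n k : ℕ} (G : Digraph (Fin p)) [DecidableRel G.Adj]

/-- The prior density of `(γ_i, ψ_i)`:
`γ_i | ψ_i ~ N(0, τ⁻¹ ψ_i I)` and `ψ_i ~ InverseGamma((δ + |P_i|) / 2, τ / 2)`. -/
def nodePrior (δ τ : ℝ) (i : Fin p) (θ : (Parents G i → ℝ) × ℝ) : ℝ :=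
  normalDensity 0 ((τ⁻¹ * θ.2) • (1 : Matrix (Parents G i) (Parents G i) ℝ)) θ.1 *
    invGammaDensity ((δ + Fintype.card (Parents G i)) / 2) (τ / 2) θ.2

/-- The columns of the data matrix that belong to the parents of `i`. -/
def parentData (X : Matrix (Fin n) (Fin p) ℝ) (i : Fin p) : Matrix (Fin n) (Parents G i) ℝ :=
  X.submatrix id Subtype.val

/-- The prior density of the Bayesian approach:
independently over `i`, the density `nodePrior` for `(γ_i, ψ_i)` times that of
`b_i | ψ_i ~ N(0, ψ_i V)`. -/
def bayesPrior (δ τ : ℝ) (V : Matrix (Fin m) (Fin m) ℝ) (θ : FullParams G m) : ℝ :=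
  ∏ i, nodePrior G δ τ i (θ i).1 * normalDensity 0 ((θ i).1.2 • V) (θ i).2

/-- The likelihood of the data `X` in the Gaussian linear model with exogenous variables:
`x_i | x_{P_i} ~ N(x_{P_i} γ_i + Q b_i, ψ_i I)`. -/
def bayesLikelihood (Q : Matrix (Fin n) (Fin m) ℝ) (X : Matrix (Fin n) (Fin p) ℝ)
    (θ : FullParams G m) : ℝ :=
  ∏ i, normalDensity (parentData G X i *ᵥ (θ i).1.1 + Q *ᵥ (θ i).2)
    ((θ i).1.2 • (1 : Matrix (Fin n) (Fin n) ℝ)) (X.col i)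

/-- The prior density of the residual approach. -/
def residualPrior (δ τ : ℝ) (θ : Params G) : ℝ :=
  ∏ i, nodePrior G δ τ i (θ i)

/-- The likelihood of the transformed data `Pᵀ X`:
`Pᵀ x_i | Pᵀ x_{P_i} ~ N(Pᵀ x_{P_i} γ_i, ψ_i I)`. -/
def residualLikelihood (P : Matrix (Fin n) (Fin k) ℝ) (X : Matrix (Fin n) (Fin p) ℝ)
    (θ : Params G) : ℝ :=
  ∏ i, normalDensity ((Pᵀ * parentData G X i) *ᵥ (θ i).1)
    ((θ i).2 • (1 : Matrix (Fin k) (Fin k) ℝ)) (Pᵀ *ᵥ X.col i)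

/-- The `p × p` matrix of regression coefficients: its entry at `(i, j)` is the coefficient of
`X_j` in the regression of `X_i` on its parents. -/
def coefMatrix (θ : Params G) : Matrix (Fin p) (Fin p) ℝ :=
  Matrix.of fun i j => if h : G.Adj j i then (θ i).1 ⟨j, h⟩ else 0

/-- The covariance matrix `Σ = (I - Γ)⁻¹ diag(ψ) (I - Γ)⁻ᵀ` of the network with
parameters `θ`, where `Γ` is the matrix of regression coefficients. -/
def covMatrix (θ : Params G) : Matrix (Fin p) (Fin p) ℝ :=
  (1 - coefMatrix G θ)⁻¹ * Matrix.diagonal (fun i => (θ i).2) * ((1 - coefMatrix G θ)⁻¹)ᵀ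

/-- The posterior distribution of `Σ` under the Bayesian approach. -/
def bayesPosteriorCov (δ τ : ℝ) (V : Matrix (Fin m) (Fin m) ℝ)
    (Q : Matrix (Fin n) (Fin m) ℝ) (X : Matrix (Fin n) (Fin p) ℝ) :
    Measure (Matrix (Fin p) (Fin p) ℝ) :=
  (posterior (bayesPrior G δ τ V) (bayesLikelihood G Q X)).map
    (fun θ => covMatrix G (fun i => (θ i).1))

/-- The posterior distribution of `Σ` under the residual approach. -/
def residualPosteriorCov (δ τ : ℝ) (P : Matrix (Fin n) (Fin k) ℝ)
    (X : Matrix (Fin n) (Fin p) ℝ) : Measure (Matrix (Fin p) (Fin p) ℝ) :=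
  (posterior (residualPrior G δ τ) (residualLikelihood G P X)).map (covMatrix G)

/-- The Kullback–Leibler divergence between the posterior distributions of `Σ` under the
Bayesian approach and under the residual approach. -/
def covDivergence (δ τ : ℝ) (V : Matrix (Fin m) (Fin m) ℝ) (Q : Matrix (Fin n) (Fin m) ℝ)
    (P : Matrix (Fin n) (Fin k) ℝ) (X : Matrix (Fin n) (Fin p) ℝ) : ℝ≥0∞ :=
  InformationTheory.klDiv (bayesPosteriorCov G δ τ V Q X) (residualPosteriorCov G δ τ P X)

end

/-- `P` is a matrix of residual contrasts for `Q`: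
`Pᵀ Q = 0`, `Pᵀ P = I` and `P Pᵀ = I - Q (Qᵀ Q)⁻¹ Qᵀ`. -/
def IsResidualContrast {n m k : ℕ} (Q : Matrix (Fin n) (Fin m) ℝ)
    (P : Matrix (Fin n) (Fin k) ℝ) : Prop :=
  Pᵀ * Q = 0 ∧ Pᵀ * P = 1 ∧ P * Pᵀ = 1 - Q * (Qᵀ * Q)⁻¹ * Qᵀ

/-- The `n × m` matrix of the first `n` rows of an infinite array. -/
def firstRows {m : ℕ} (A : ℕ → Fin m → ℝ) (n : ℕ) : Matrix (Fin n) (Fin m) ℝ :=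
  Matrix.of fun t j => A t j

/-- The samples `x t = (x t 1, …, x t p)`, `t = 0, 1, 2, …`, follow the Gaussian linear model
over `G` with parameters `γ_i, ψ_i`, exogenous variables `q` and effects `b_i`:
given its parents, `x t i ~ N(∑_{j ∈ P_i} γ_{ij} x_{t j} + (q b_i)_t, ψ_i)`, all errors being
independent. -/
def FollowsModel {p m : ℕ} (G : Digraph (Fin p)) [DecidableRel G.Adj]
    {Ω : Type*} [MeasurableSpace Ω] (μ : Measure Ω)
    (γ : (i : Fin p) → Parents G i → ℝ) (ψ : Fin p → ℝ≥0) (b : Fin p → Fin m → ℝ)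
    (q : ℕ → Fin m → ℝ) (x : ℕ → Fin p → Ω → ℝ) : Prop :=
  ∃ ε : ℕ × Fin p → Ω → ℝ,
    iIndepFun ε μ ∧
    (∀ t i, HasLaw (ε (t, i)) (gaussianReal 0 (ψ i)) μ) ∧
    ∀ t i ω, x t i ω = ∑ j : Parents G i, γ i j * x t j ω + q t ⬝ᵥ b i + ε (t, i) ω

end ExoNetwork

end

namespace ExoNetwork

/-! ### Products of densities, normalisation, and a chi-squared bound for the divergence -/

/-! Both posteriors are products over the nodes. In the Bayesian approach `b_i` enters the exponent
quadratically and integrates out exactly (`bayesPosteriorCov_eq`). What remains for a node has in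
both approaches the normal-inverse-gamma form `ψ ^ (-α - 1) * exp (-H γ / ψ)`, where `H` is a
penalised residual sum of squares (`energy`) that sees the data only through a `p × p` Gram matrix.
The residual approach has the Gram matrix `G` of `Pᵀ X`. The Bayesian approach has `G + E` with `E =
gramDiff`, and its `α` is larger by `m / 2`.

As `Σ` is a function of the parameters, data processing reduces the claim to the parameter
distributions. Their divergence plus one is at most their chi-squared integral, which multiplies
over the nodes (`klDiv_pi_add_one_le`). `H` is affine in the Gram matrix, so the squared Bayesian
density over the residual density has the same form again, with Gram matrix `G + 2E`. The
chi-squared integral is thus a ratio of three explicit integrals, each a Gaussian mass times `Γ(a) β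
^ (-a)` with `β = min H`. `chiSq_node_le` bounds this ratio: the Gaussian masses are comparable,
`log Γ` is almost linear on a bounded window far out, and `β` is almost affine along `G`, `G + E`,
`G + 2E`. With `G` of order `n` and `E` at most of order `lam`, the error in the exponent is of
order `lam² / n`. Hence the criterion `tendsto_covDivergence` asks for `lam = o(√n)`.

The size of `E` comes from a variational squeeze. The marginal quadratic form of `r` is the minimum
over `b` of `bᵀ V⁻¹ b + |r - Q b|²`. It lies between `|Pᵀ r|²` and `|Pᵀ r|²` plus the `V⁻¹`-form at
the least squares coefficients of `r` on `Q`. So `lam` need only bound the squared least squares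
coefficients of the data columns. For given data they are bounded. For model data they are fixed
vectors plus the coefficients of the errors. The errors project onto the `m`-dimensional column
space of `Q` with squared length `O(log n)` almost surely (`ae_eventually_contrast_le`), and `Qᵀ Q`
is bounded below because it increases with `n`. The law of large numbers supplies `G` of order `n`.
-/

lemma lintegral_fin_prod_eq_prod : ∀ {n : ℕ} {E : Fin n → Type*} [∀ i, MeasurableSpace (E i)]
    (μ : (i : Fin n) → Measure (E i)) [∀ i, SigmaFinite (μ i)]
    {f : (i : Fin n) → E i → ℝ≥0∞}, (∀ i, Measurable (f i)) →
    ∫⁻ x, ∏ i, f i (x i) ∂(Measure.pi μ) = ∏ i, ∫⁻ x, f i x ∂(μ i)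
  | 0, E, _, μ, _, f, hf => by
    simp [Measure.pi_empty_univ]
  | n + 1, E, _, μ, _, f, hf => by
    have ih := lintegral_fin_prod_eq_prod (fun i => μ ((0 : Fin (n + 1)).succAbove i))
      (f := fun i => f ((0 : Fin (n + 1)).succAbove i)) (fun i => hf _)
    have hmp := (measurePreserving_piFinSuccAbove μ 0).symm
    rw [← hmp.lintegral_comp_emb (MeasurableEquiv.measurableEmbedding _)]
    have hg : Measurable fun y : (i : Fin n) → E ((0 : Fin (n + 1)).succAbove i) =>
        ∏ i, f ((0 : Fin (n + 1)).succAbove i) (y i) :=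
      Finset.measurable_prod _ fun i _ => (hf _).comp (measurable_pi_apply i)
    rw [Fin.prod_univ_succAbove _ 0, ← ih,
      ← lintegral_prod_mul (hf 0).aemeasurable hg.aemeasurable]
    refine lintegral_congr fun z => ?_
    exact Fin.prod_univ_succAbove _ 0

lemma pi_withDensity {n : ℕ} {E : Fin n → Type*} [∀ i, MeasurableSpace (E i)]
    (μ : (i : Fin n) → Measure (E i)) [∀ i, SigmaFinite (μ i)]
    {f : (i : Fin n) → E i → ℝ≥0∞} (hf : ∀ i, Measurable (f i))
    [∀ i, SigmaFinite ((μ i).withDensity (f i))] :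
    Measure.pi (fun i => (μ i).withDensity (f i)) =
      (Measure.pi μ).withDensity (fun x => ∏ i, f i (x i)) := by
  refine Measure.pi_eq fun s hs => ?_
  have hm : MeasurableSet (Set.univ.pi s) := MeasurableSet.univ_pi hs
  rw [withDensity_apply _ hm, ← lintegral_indicator hm]
  have : ∀ x : (i : Fin n) → E i, (Set.univ.pi s).indicator (fun x => ∏ i, f i (x i)) x =
      ∏ i, (s i).indicator (f i) (x i) := by
    intro x
    by_cases hx : x ∈ Set.univ.pi s
    · rw [Set.indicator_of_mem hx]
      exact Finset.prod_congr rfl fun i _ => (Set.indicator_of_mem (hx i trivial) _).symm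
    · rw [Set.indicator_of_notMem hx]
      obtain ⟨i, hi⟩ : ∃ i, x i ∉ s i := by simpa [Set.mem_pi] using hx
      exact (Finset.prod_eq_zero (Finset.mem_univ i) (Set.indicator_of_notMem hi _)).symm
  simp_rw [this]
  rw [lintegral_fin_prod_eq_prod μ fun i => (hf i).indicator (hs i)]
  refine Finset.prod_congr rfl fun i _ => ?_
  rw [lintegral_indicator (hs i), withDensity_apply _ (hs i)]

lemma klFun_add_two_mul_le {x : ℝ} (hx : 0 ≤ x) :
    InformationTheory.klFun x + 2 * x ≤ x ^ 2 + 1 := by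
  rw [InformationTheory.klFun_apply]
  rcases hx.eq_or_lt with rfl | hx
  · simp
  · nlinarith [Real.log_le_sub_one_of_pos hx, mul_le_mul_of_nonneg_left
      (Real.log_le_sub_one_of_pos hx) hx.le]

/-- The Kullback–Leibler divergence is at most the chi-squared divergence. -/
lemma klDiv_add_one_le {α : Type*} [MeasurableSpace α] (ν : Measure α) [IsProbabilityMeasure ν]
    {r : α → ℝ≥0∞} (hr : Measurable r) [IsProbabilityMeasure (ν.withDensity r)] :
    InformationTheory.klDiv (ν.withDensity r) ν + 1 ≤ ∫⁻ x, r x ^ 2 ∂ν := by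
  have hr1 : ∫⁻ x, r x ∂ν = 1 := by
    have := measure_univ (μ := ν.withDensity r)
    rwa [withDensity_apply _ MeasurableSet.univ, Measure.restrict_univ] at this
  have hfin : ∀ᵐ x ∂ν, r x < ∞ := ae_lt_top hr (by simp [hr1])
  rw [InformationTheory.klDiv_eq_lintegral_klFun_of_ac (withDensity_absolutelyContinuous ν r)]
  -- Since `∫ r = 1`, the summand `2 * r` contributes the constant 2. Keeping it on the left avoids
  -- truncated subtraction in `ℝ≥0∞`.
  have key : ∫⁻ x, ENNReal.ofReal (InformationTheory.klFun
        (((ν.withDensity r).rnDeriv ν x).toReal)) + 2 * r x ∂ν ≤ ∫⁻ x, r x ^ 2 + 1 ∂ν := by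
    refine lintegral_mono_ae ?_
    filter_upwards [Measure.rnDeriv_withDensity ν hr, hfin] with x hx hfx
    rw [hx]
    lift r x to ℝ≥0 using hfx.ne with y
    have h := klFun_add_two_mul_le y.coe_nonneg
    have e1 : (2 : ℝ≥0∞) * y = ENNReal.ofReal (2 * y) := by
      rw [ENNReal.ofReal_mul (by norm_num)]; simp
    have e2 : (y : ℝ≥0∞) ^ 2 + 1 = ENNReal.ofReal ((y : ℝ) ^ 2 + 1) := by
      rw [ENNReal.ofReal_add (by positivity) (by norm_num), ENNReal.ofReal_pow y.coe_nonneg]; simp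
    rw [ENNReal.coe_toReal, e1, e2, ← ENNReal.ofReal_add
      (InformationTheory.klFun_nonneg y.coe_nonneg) (mul_nonneg zero_le_two y.coe_nonneg)]
    exact ENNReal.ofReal_le_ofReal h
  rw [lintegral_add_right _ (hr.const_mul 2), lintegral_const_mul _ hr, hr1,
    lintegral_add_right _ measurable_const, lintegral_one, measure_univ, mul_one] at key
  refine (ENNReal.add_le_add_iff_right ENNReal.one_ne_top).1 ?_
  rwa [add_assoc, one_add_one_eq_two]

lemma klDiv_pi_add_one_le {n : ℕ} {E : Fin n → Type*} [∀ i, MeasurableSpace (E i)]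
    (ν : (i : Fin n) → Measure (E i)) [∀ i, IsProbabilityMeasure (ν i)]
    {r : (i : Fin n) → E i → ℝ≥0∞} (hr : ∀ i, Measurable (r i))
    [∀ i, IsProbabilityMeasure ((ν i).withDensity (r i))] :
    InformationTheory.klDiv (Measure.pi fun i => (ν i).withDensity (r i)) (Measure.pi ν) + 1 ≤
      ∏ i, ∫⁻ x, r i x ^ 2 ∂(ν i) := by
  have he := pi_withDensity ν hr
  have : IsProbabilityMeasure ((Measure.pi ν).withDensity fun x => ∏ i, r i (x i)) := by
    rw [← he]; infer_instance
  have hm : Measurable fun x : (i : Fin n) → E i => ∏ i, r i (x i) :=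
    Finset.measurable_prod _ fun i _ => (hr i).comp (measurable_pi_apply i)
  rw [he]
  refine (klDiv_add_one_le (Measure.pi ν) hm).trans_eq ?_
  simp_rw [← Finset.prod_pow]
  exact lintegral_fin_prod_eq_prod ν fun i => (hr i).pow_const 2

/-- The measure with density proportional to `h`. -/
noncomputable def normalizedDensity {Θ : Type*} [MeasureSpace Θ] (h : Θ → ℝ≥0∞) : Measure Θ :=
  (∫⁻ θ, h θ)⁻¹ • (volume : Measure Θ).withDensity h

lemma isProbabilityMeasure_normalizedDensity {Θ : Type*} [MeasureSpace Θ] {h : Θ → ℝ≥0∞}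
    (h0 : ∫⁻ θ, h θ ≠ 0) (h1 : ∫⁻ θ, h θ ≠ ∞) :
    IsProbabilityMeasure (normalizedDensity h) :=
  ⟨by simp [normalizedDensity, ENNReal.inv_mul_cancel h0 h1]⟩

lemma normalizedDensity_const_mul {Θ : Type*} [MeasureSpace Θ] {h : Θ → ℝ≥0∞}
    (hh : Measurable h) {c : ℝ≥0∞} (c0 : c ≠ 0) (c1 : c ≠ ∞) :
    normalizedDensity (fun θ => c * h θ) = normalizedDensity h := by
  have : (fun θ => c * h θ) = c • h := rfl
  rw [normalizedDensity, normalizedDensity, lintegral_const_mul _ hh, this,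
    withDensity_smul _ hh, smul_smul, ENNReal.mul_inv (Or.inl c0) (Or.inl c1), mul_right_comm,
    ENNReal.inv_mul_cancel c0 c1, one_mul]

lemma map_fst_normalizedDensity {A B : Type*} [MeasureSpace A] [MeasureSpace B]
    [SFinite (volume : Measure A)] [SFinite (volume : Measure B)] {h : A × B → ℝ≥0∞}
    (hh : Measurable h) :
    (normalizedDensity h).map Prod.fst = normalizedDensity fun a => ∫⁻ b, h (a, b) := by
  have hZ : ∫⁻ θ, h θ = ∫⁻ a, ∫⁻ b, h (a, b) := by
    rw [Measure.volume_eq_prod, lintegral_prod _ hh.aemeasurable]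
  rw [normalizedDensity, normalizedDensity, Measure.map_smul, hZ]
  congr 1
  ext s hs
  rw [Measure.map_apply measurable_fst hs, withDensity_apply _ (measurable_fst hs),
    withDensity_apply _ hs, ← lintegral_indicator (measurable_fst hs), ← lintegral_indicator hs,
    Measure.volume_eq_prod, lintegral_prod _ (hh.indicator (measurable_fst hs)).aemeasurable]
  refine lintegral_congr fun a => ?_
  by_cases ha : a ∈ s
  · rw [Set.indicator_of_mem ha]
    exact lintegral_congr fun b => Set.indicator_of_mem (by exact ha) _
  · rw [Set.indicator_of_notMem ha, ← lintegral_zero (μ := (volume : Measure B))]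
    exact lintegral_congr fun b => Set.indicator_of_notMem (by exact ha) _

lemma posterior_eq_pi {n : ℕ} {E : Fin n → Type*} [∀ i, MeasureSpace (E i)]
    [∀ i, SigmaFinite (volume : Measure (E i))] {prior likelihood : ((i : Fin n) → E i) → ℝ}
    {h : (i : Fin n) → E i → ℝ≥0∞} (hh : ∀ i, Measurable (h i))
    (he : ∀ θ, ENNReal.ofReal (prior θ * likelihood θ) = ∏ i, h i (θ i))
    (h0 : ∀ i, ∫⁻ θ, h i θ ≠ 0) (h1 : ∀ i, ∫⁻ θ, h i θ ≠ ∞) :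
    posterior prior likelihood = Measure.pi fun i => normalizedDensity (h i) := by
  have hc : ∀ i, normalizedDensity (h i) =
      (volume : Measure (E i)).withDensity (fun θ => (∫⁻ θ, h i θ)⁻¹ * h i θ) := fun i => by
    rw [normalizedDensity, ← withDensity_smul _ (hh i)]; rfl
  have : ∀ i, IsProbabilityMeasure ((volume : Measure (E i)).withDensity
      (fun θ => (∫⁻ θ, h i θ)⁻¹ * h i θ)) := fun i => by
    rw [← hc i]; exact isProbabilityMeasure_normalizedDensity (h0 i) (h1 i)
  simp_rw [hc]
  rw [pi_withDensity _ fun i => (hh i).const_mul _, posterior]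
  simp_rw [he, Finset.prod_mul_distrib]
  rw [volume_pi, lintegral_fin_prod_eq_prod _ hh, ← ENNReal.prod_inv_distrib]
  · have hm : Measurable fun x : (i : Fin n) → E i => ∏ i, h i (x i) :=
      Finset.measurable_prod _ fun i _ => (hh i).comp (measurable_pi_apply i)
    rw [← withDensity_smul _ hm]
    rfl
  · intro i _ j _ _
    exact Or.inl (h0 i)

/-- The chi-squared integral of two normalised densities. -/
lemma exists_withDensity_normalizedDensity {Θ : Type*} [MeasureSpace Θ] {f g k : Θ → ℝ≥0∞}
    (hf : Measurable f) (hg : Measurable g) (hk : Measurable k)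
    (hfg : ∀ θ, g θ = 0 → f θ = 0) (hg1 : ∀ θ, g θ ≠ ∞)
    (hk' : ∀ θ, k θ * g θ = f θ ^ 2)  (hk0 : ∀ θ, g θ = 0 → k θ = 0)
    (hg0 : ∫⁻ θ, g θ ≠ 0) (hg1' : ∫⁻ θ, g θ ≠ ∞) :
    ∃ r : Θ → ℝ≥0∞, Measurable r ∧
      normalizedDensity f = (normalizedDensity g).withDensity r ∧
      ∫⁻ θ, r θ ^ 2 ∂(normalizedDensity g) =
        (∫⁻ θ, k θ) * (∫⁻ θ, g θ) * ((∫⁻ θ, f θ) ^ 2)⁻¹ := by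
  set F := ∫⁻ θ, f θ
  set Z := ∫⁻ θ, g θ
  -- The ratio of the normalised densities. Where `g` vanishes so does `f`, and the ratio is `0 * ∞
  -- = 0`. The function `k` stands for `f² / g` without a division.
  refine ⟨fun θ => (F⁻¹ * Z) * (f θ * (g θ)⁻¹), by fun_prop, ?_, ?_⟩
  · rw [normalizedDensity, normalizedDensity, withDensity_smul_measure,
      ← withDensity_mul _ hg (by fun_prop), ← withDensity_smul _ hf,
      ← withDensity_smul _ (by fun_prop)]
    congr 1
    funext θ
    simp only [Pi.smul_apply, Pi.mul_apply, smul_eq_mul]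
    change F⁻¹ * f θ = Z⁻¹ * (g θ * (F⁻¹ * Z * (f θ * (g θ)⁻¹)))
    by_cases h : g θ = 0
    · simp [h, hfg θ h]
    · calc F⁻¹ * f θ = (Z⁻¹ * Z) * (g θ * (g θ)⁻¹) * (F⁻¹ * f θ) := by
            rw [ENNReal.inv_mul_cancel hg0 hg1', ENNReal.mul_inv_cancel h (hg1 θ)]; simp
        _ = _ := by ring
  · have e : ∀ θ, g θ * (F⁻¹ * Z * (f θ * (g θ)⁻¹)) ^ 2 = (F⁻¹ * Z) ^ 2 * k θ := by
      intro θ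
      by_cases h : g θ = 0
      · simp [h, hk0 θ h]
      · calc g θ * (F⁻¹ * Z * (f θ * (g θ)⁻¹)) ^ 2
            = (F⁻¹ * Z) ^ 2 * ((f θ ^ 2) * (g θ)⁻¹) * (g θ * (g θ)⁻¹) := by ring
          _ = (F⁻¹ * Z) ^ 2 * k θ * (g θ * (g θ)⁻¹) ^ 2 := by rw [← hk']; ring
          _ = _ := by rw [ENNReal.mul_inv_cancel h (hg1 θ)]; simp
    rw [normalizedDensity, lintegral_smul_measure,
      lintegral_withDensity_eq_lintegral_mul _ hg (by fun_prop)]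
    simp only [Pi.mul_apply, e]
    rw [lintegral_const_mul _ hk]
    change Z⁻¹ * ((F⁻¹ * Z) ^ 2 * _) = _
    calc Z⁻¹ * ((F⁻¹ * Z) ^ 2 * ∫⁻ θ, k θ)
        = (Z⁻¹ * Z) * ((∫⁻ θ, k θ) * Z * (F⁻¹) ^ 2) := by ring
      _ = _ := by rw [ENNReal.inv_mul_cancel hg0 hg1', one_mul, ENNReal.inv_pow]

/-! ### Gaussian and inverse gamma integrals -/

section Gaussian

variable {ι : Type*} [Fintype ι]

/-- The integral of `exp (-(1 / 2) yᵀ A y)`. -/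
noncomputable def gaussMass (A : Matrix ι ι ℝ) : ℝ≥0∞ :=
  ∫⁻ y : ι → ℝ, ENNReal.ofReal (Real.exp (-(1 / 2 * (y ⬝ᵥ A *ᵥ y))))

lemma continuous_quadraticForm (A : Matrix ι ι ℝ) :
    Continuous fun y : ι → ℝ => y ⬝ᵥ A *ᵥ y := by
  unfold dotProduct Matrix.mulVec dotProduct
  fun_prop

lemma lintegral_comp_smul_pi {r : ℝ} (hr : 0 < r) {f : (ι → ℝ) → ℝ≥0∞} (hf : Measurable f) :
    ∫⁻ y, f y = ENNReal.ofReal (r ^ Fintype.card ι) * ∫⁻ y, f (r • y) := by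
  have h := Measure.map_addHaar_smul (volume : Measure (ι → ℝ)) hr.ne'
  have h2 : ∫⁻ y, f (r • y) = ∫⁻ y, f y ∂((volume : Measure (ι → ℝ)).map (fun x => r • x)) :=
    (lintegral_map hf (measurable_const_smul r)).symm
  have hp : 0 < r ^ Fintype.card ι := pow_pos hr _
  rw [h2, h, lintegral_smul_measure, Module.finrank_fintype_fun_eq_card, smul_eq_mul, ← mul_assoc,
    ← ENNReal.ofReal_mul hp.le, abs_of_pos (inv_pos.2 hp), mul_inv_cancel₀ hp.ne',
    ENNReal.ofReal_one, one_mul]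

/-- Translate by `g`, then rescale by `√ψ`. The mass itself is never evaluated: only its finiteness,
positivity and monotonicity in `A` are used. -/
lemma lintegral_gauss_shift_scale (A : Matrix ι ι ℝ) (g : ι → ℝ) {ψ : ℝ} (hψ : 0 < ψ) :
    ∫⁻ y : ι → ℝ, ENNReal.ofReal (Real.exp (-(1 / 2 * ((y - g) ⬝ᵥ A *ᵥ (y - g))) / ψ)) =
      ENNReal.ofReal (ψ ^ ((Fintype.card ι : ℝ) / 2)) * gaussMass A := by
  have hc : Measurable fun y : ι → ℝ =>
      ENNReal.ofReal (Real.exp (-(1 / 2 * (y ⬝ᵥ A *ᵥ y)) / ψ)) := by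
    have := (continuous_quadraticForm A).measurable
    fun_prop
  rw [lintegral_sub_right_eq_self (fun y : ι → ℝ =>
      ENNReal.ofReal (Real.exp (-(1 / 2 * (y ⬝ᵥ A *ᵥ y)) / ψ))) g,
    lintegral_comp_smul_pi (Real.sqrt_pos.2 hψ) hc, gaussMass]
  congr 2
  · rw [Real.sqrt_eq_rpow, ← Real.rpow_natCast, ← Real.rpow_mul hψ.le]
    ring_nf
  · funext y
    have : (√ψ • y) ⬝ᵥ A *ᵥ (√ψ • y) = ψ * (y ⬝ᵥ A *ᵥ y) := by
      rw [Matrix.mulVec_smul, smul_dotProduct, dotProduct_smul, smul_smul, Real.mul_self_sqrt hψ.le,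
        smul_eq_mul]
    rw [this]
    congr 2
    field_simp

lemma gaussMass_ne_zero (A : Matrix ι ι ℝ) : gaussMass A ≠ 0 := by
  have hc := (continuous_quadraticForm A).measurable
  rw [gaussMass, Ne, lintegral_eq_zero_iff (by fun_prop)]
  intro h
  have : ∀ᵐ y : ι → ℝ, False := h.mono fun y hy => by
    simpa using (ENNReal.ofReal_pos.2 (Real.exp_pos _)).ne' hy
  exact NeZero.ne (volume : Measure (ι → ℝ)) (by simpa [ae_iff] using this)

lemma gaussMass_ne_top {A : Matrix ι ι ℝ} {c : ℝ} (hc : 0 < c)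
    (hA : ∀ y : ι → ℝ, c * (y ⬝ᵥ y) ≤ y ⬝ᵥ A *ᵥ y) : gaussMass A ≠ ∞ := by
  have hi : Integrable fun y : ι → ℝ => ∏ i, Real.exp (-(c / 2) * y i ^ 2) :=
    Integrable.fintype_prod fun _ => integrable_exp_neg_mul_sq (half_pos hc)
  refine (lt_of_le_of_lt (lintegral_mono fun y => ?_) hi.lintegral_lt_top).ne
  refine ENNReal.ofReal_le_ofReal ?_
  rw [← Real.exp_sum, Real.exp_le_exp, ← Finset.mul_sum]
  have := hA y
  have e : y ⬝ᵥ y = ∑ i, y i ^ 2 := by simp [dotProduct, sq]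
  rw [e] at this
  linarith

lemma gaussMass_le_of_le {A B : Matrix ι ι ℝ}
    (h : ∀ y : ι → ℝ, y ⬝ᵥ A *ᵥ y ≤ y ⬝ᵥ B *ᵥ y) : gaussMass B ≤ gaussMass A :=
  lintegral_mono fun y => ENNReal.ofReal_le_ofReal (Real.exp_le_exp.2 (by linarith [h y]))

/-- Rescaling turns the mass of `t • A` into `t ^ (-d / 2)` times that of `A`, and the mass
decreases in the form. -/
lemma gaussMass_le_mul_of_le {A B : Matrix ι ι ℝ} {t : ℝ} (ht : 0 < t)
    (h : ∀ y : ι → ℝ, y ⬝ᵥ B *ᵥ y ≤ t * (y ⬝ᵥ A *ᵥ y)) :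
    gaussMass A ≤ ENNReal.ofReal (t ^ ((Fintype.card ι : ℝ) / 2)) * gaussMass B := by
  have h1 := lintegral_gauss_shift_scale A 0 (inv_pos.2 ht)
  have h2 : ENNReal.ofReal (t⁻¹ ^ ((Fintype.card ι : ℝ) / 2)) * gaussMass A ≤ gaussMass B := by
    rw [← h1]
    refine lintegral_mono fun y => ENNReal.ofReal_le_ofReal (Real.exp_le_exp.2 ?_)
    rw [sub_zero, div_inv_eq_mul]
    linarith [h y]
  calc gaussMass A = ENNReal.ofReal (t ^ ((Fintype.card ι : ℝ) / 2)) *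
        (ENNReal.ofReal (t⁻¹ ^ ((Fintype.card ι : ℝ) / 2)) * gaussMass A) := by
        rw [← mul_assoc, ← ENNReal.ofReal_mul (by positivity), ← Real.mul_rpow ht.le
          (inv_pos.2 ht).le, mul_inv_cancel₀ ht.ne', Real.one_rpow, ENNReal.ofReal_one, one_mul]
    _ ≤ _ := by gcongr

end Gaussian

/-- The substitution `ψ ↦ ψ⁻¹` turns this into the Gamma integral. -/
lemma lintegral_inverse_gamma {a β : ℝ} (ha : 0 < a) (hβ : 0 < β) :
    ∫⁻ ψ : ℝ, ENNReal.ofReal (if 0 < ψ then ψ ^ (-a - 1) * Real.exp (-β / ψ) else 0) =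
      ENNReal.ofReal (Real.Gamma a * β ^ (-a)) := by
  have h1 : ∫⁻ ψ : ℝ, ENNReal.ofReal (if 0 < ψ then ψ ^ (-a - 1) * Real.exp (-β / ψ) else 0) =
      ∫⁻ ψ in Set.Ioi (0 : ℝ), ENNReal.ofReal (ψ ^ (-a - 1) * Real.exp (-β / ψ)) := by
    rw [← lintegral_indicator measurableSet_Ioi]
    refine lintegral_congr fun ψ => ?_
    by_cases h : 0 < ψ <;> simp [h]
  have himg : (fun x : ℝ => x⁻¹) '' Set.Ioi 0 = Set.Ioi 0 := by
    ext x
    constructor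
    · rintro ⟨y, hy, rfl⟩
      exact inv_pos.2 (Set.mem_Ioi.1 hy)
    · intro hx
      exact ⟨x⁻¹, Set.mem_Ioi.2 (inv_pos.2 hx), inv_inv x⟩
  have h2 := lintegral_image_eq_lintegral_abs_deriv_mul (s := Set.Ioi (0 : ℝ))
    (f := fun x => x⁻¹) (f' := fun x => -(x ^ 2)⁻¹) measurableSet_Ioi
    (fun x hx => (hasDerivAt_inv (ne_of_gt hx)).hasDerivWithinAt) inv_injective.injOn
    (fun ψ => ENNReal.ofReal (ψ ^ (-a - 1) * Real.exp (-β / ψ)))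
  have hint : IntegrableOn (fun x : ℝ => x ^ (a - 1) * Real.exp (-(β * x))) (Set.Ioi 0) := by
    have := integrableOn_rpow_mul_exp_neg_mul_rpow (p := 1) (s := a - 1) (by linarith) one_pos hβ
    simpa using this
  have h3 := Real.integral_rpow_mul_exp_neg_mul_Ioi ha hβ
  rw [h1, ← himg, h2]
  have h4 : ∫⁻ x in Set.Ioi (0 : ℝ), ENNReal.ofReal |-(x ^ 2)⁻¹| *
        ENNReal.ofReal (x⁻¹ ^ (-a - 1) * Real.exp (-β / x⁻¹)) =
      ∫⁻ x in Set.Ioi (0 : ℝ), ENNReal.ofReal (x ^ (a - 1) * Real.exp (-(β * x))) := by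
    refine setLIntegral_congr_fun measurableSet_Ioi fun x hx => ?_
    have hx' : (0 : ℝ) < x := hx
    rw [← ENNReal.ofReal_mul (abs_nonneg _), abs_neg, abs_of_pos (by positivity), div_inv_eq_mul,
      Real.inv_rpow hx'.le, ← Real.rpow_neg hx'.le, ← Real.rpow_natCast, ← Real.rpow_neg hx'.le,
      ← mul_assoc, ← Real.rpow_add hx']
    congr 2
    · congr 1
      push_cast
      ring
    · ring_nf
  rw [h4, ← ofReal_integral_eq_lintegral_ofReal hint, h3]
  · rw [one_div, Real.inv_rpow hβ.le, ← Real.rpow_neg hβ.le, mul_comm]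
  · filter_upwards [self_mem_ae_restrict measurableSet_Ioi] with x hx
    have hx' : (0 : ℝ) < x := hx
    simp only [Pi.zero_apply]
    positivity

section NormalInverseGamma

/-- The unnormalised density `ψ ^ (-α - 1) exp (-H γ / ψ)` on `ψ > 0`. -/
noncomputable def nigDensity {A : Type*} (α : ℝ) (H : A → ℝ) (θ : A × ℝ) : ℝ≥0∞ :=
  ENNReal.ofReal (if 0 < θ.2 then θ.2 ^ (-α - 1) * Real.exp (-(H θ.1) / θ.2) else 0)

lemma measurable_nigDensity {A : Type*} [MeasurableSpace A] (α : ℝ) {H : A → ℝ} (hH : Measurable H) :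
    Measurable (nigDensity α H) := by
  unfold nigDensity
  refine ENNReal.measurable_ofReal.comp (Measurable.ite ?_ ?_ measurable_const)
  · exact measurableSet_lt measurable_const measurable_snd
  · exact (measurable_snd.pow_const _).mul
      (Real.measurable_exp.comp ((hH.comp measurable_fst).neg.div measurable_snd))

/-- A Gaussian coordinate with variance proportional to `ψ` contributes `ψ ^ (d / 2)`, which lowers
`α` by `d / 2`. It serves both to remove `b` and, with no coordinate left over, to normalise. -/
lemma lintegral_nigDensity_marginal {ι B : Type*} [Fintype ι] {α : ℝ} {F : B × (ι → ℝ) → ℝ}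
    {H : B → ℝ} {A : Matrix ι ι ℝ} {g : B → ι → ℝ}
    (hF : ∀ c y, F (c, y) = H c + 1 / 2 * ((y - g c) ⬝ᵥ A *ᵥ (y - g c))) (θ : B × ℝ) :
    ∫⁻ y, nigDensity α F ((θ.1, y), θ.2) =
      gaussMass A * nigDensity (α - (Fintype.card ι : ℝ) / 2) H θ := by
  obtain ⟨c, ψ⟩ := θ
  by_cases hψ : 0 < ψ
  · simp only [nigDensity, hψ, if_true]
    have e : ∀ y, ENNReal.ofReal (ψ ^ (-α - 1) * Real.exp (-(F (c, y)) / ψ)) =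
        ENNReal.ofReal (ψ ^ (-α - 1) * Real.exp (-(H c) / ψ)) *
        ENNReal.ofReal (Real.exp (-(1 / 2 * ((y - g c) ⬝ᵥ A *ᵥ (y - g c))) / ψ)) := fun y => by
      rw [← ENNReal.ofReal_mul (by positivity), mul_assoc, ← Real.exp_add, hF]
      congr 3
      ring
    simp_rw [e]
    rw [lintegral_const_mul' _ _ ENNReal.ofReal_ne_top, lintegral_gauss_shift_scale A (g c) hψ,
      ← mul_assoc, ← ENNReal.ofReal_mul (by positivity), mul_comm]
    congr 2
    rw [mul_right_comm, ← Real.rpow_add hψ]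
    congr 2
    ring
  · simp [nigDensity, hψ]

lemma lintegral_nigDensity {ι : Type*} [Fintype ι] {α β : ℝ} {H : (ι → ℝ) → ℝ} {A : Matrix ι ι ℝ} {g : ι → ℝ}
    (hH : ∀ γ, H γ = β + 1 / 2 * ((γ - g) ⬝ᵥ A *ᵥ (γ - g)))
    (ha : 0 < α - (Fintype.card ι : ℝ) / 2) (hβ : 0 < β) :
    ∫⁻ θ, nigDensity α H θ = gaussMass A *
      ENNReal.ofReal (Real.Gamma (α - (Fintype.card ι : ℝ) / 2) *
        β ^ (-(α - (Fintype.card ι : ℝ) / 2))) := by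
  have hHm : Measurable H := by
    have : H = fun γ => β + 1 / 2 * ((γ - g) ⬝ᵥ A *ᵥ (γ - g)) := funext hH
    rw [this]
    have := (continuous_quadraticForm A).comp (continuous_id.sub (continuous_const (y := g)))
    exact (continuous_const.add (continuous_const.mul this)).measurable
  rw [Measure.volume_eq_prod, lintegral_prod_symm _ (measurable_nigDensity α hHm).aemeasurable,
    ← lintegral_inverse_gamma ha hβ, ← lintegral_const_mul]
  · refine lintegral_congr fun ψ => ?_
    -- With `Unit` for the remaining coordinates, all of `γ` is integrated out at fixed `ψ`.
    exact lintegral_nigDensity_marginal (B := Unit) (F := fun z => H z.2) (H := fun _ => β)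
      (g := fun _ => g) (fun _ y => hH y) ((), ψ)
  · refine ENNReal.measurable_ofReal.comp (Measurable.ite measurableSet_Ioi ?_ measurable_const)
    exact (measurable_id.pow_const _).mul
      (Real.measurable_exp.comp (measurable_const.div measurable_id))

end NormalInverseGamma

/-! ### Quadratic forms -/

section QuadraticForm

variable {ι κ : Type*} [Fintype ι] [Fintype κ]

lemma dotProduct_mulVec_comm {A : Matrix ι ι ℝ} (hA : A.IsSymm) (u v : ι → ℝ) :
    u ⬝ᵥ A *ᵥ v = v ⬝ᵥ A *ᵥ u := by
  rw [Matrix.dotProduct_mulVec, dotProduct_comm, ← Matrix.mulVec_transpose, hA.eq]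

lemma dotProduct_transpose_mulVec (M : Matrix κ ι ℝ) (u : ι → ℝ) (v : κ → ℝ) :
    u ⬝ᵥ Mᵀ *ᵥ v = (M *ᵥ u) ⬝ᵥ v := by
  rw [Matrix.dotProduct_mulVec, Matrix.vecMul_transpose]

lemma dotProduct_self_nonneg' (u : ι → ℝ) : 0 ≤ u ⬝ᵥ u :=
  Finset.sum_nonneg fun i _ => mul_self_nonneg (u i)

lemma dotProduct_self_pos {w : ι → ℝ} (hw : w ≠ 0) : 0 < w ⬝ᵥ w :=
  lt_of_le_of_ne (dotProduct_self_nonneg' w) fun h => hw (dotProduct_self_eq_zero.1 h.symm)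

lemma quadraticForm_add {A : Matrix ι ι ℝ} (hA : A.IsSymm) (u v : ι → ℝ) :
    (u + v) ⬝ᵥ A *ᵥ (u + v) = u ⬝ᵥ A *ᵥ u + 2 * (u ⬝ᵥ A *ᵥ v) + v ⬝ᵥ A *ᵥ v := by
  rw [Matrix.mulVec_add, dotProduct_add, add_dotProduct, add_dotProduct,
    dotProduct_mulVec_comm hA v u]
  ring

lemma quadraticForm_sub {A : Matrix ι ι ℝ} (hA : A.IsSymm) (u v : ι → ℝ) :
    (u - v) ⬝ᵥ A *ᵥ (u - v) = u ⬝ᵥ A *ᵥ u - 2 * (u ⬝ᵥ A *ᵥ v) + v ⬝ᵥ A *ᵥ v := by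
  rw [Matrix.mulVec_sub, dotProduct_sub, sub_dotProduct, sub_dotProduct,
    dotProduct_mulVec_comm hA v u]
  ring

/-- The Cauchy–Schwarz inequality for a positive semidefinite quadratic form. -/
lemma quadraticForm_cauchySchwarz {A : Matrix ι ι ℝ} (hA : A.IsSymm)
    (h0 : ∀ u : ι → ℝ, 0 ≤ u ⬝ᵥ A *ᵥ u) (u v : ι → ℝ) :
    (u ⬝ᵥ A *ᵥ v) ^ 2 ≤ (u ⬝ᵥ A *ᵥ u) * (v ⬝ᵥ A *ᵥ v) := by
  have h : ∀ t : ℝ, 0 ≤ (v ⬝ᵥ A *ᵥ v) * (t * t) + (2 * (u ⬝ᵥ A *ᵥ v)) * t + u ⬝ᵥ A *ᵥ u := by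
    intro t
    have := h0 (u + t • v)
    rw [quadraticForm_add hA, Matrix.mulVec_smul, dotProduct_smul, dotProduct_smul,
      smul_dotProduct] at this
    simp only [smul_eq_mul] at this
    linarith
  have := discrim_le_zero h
  rw [discrim] at this
  nlinarith

lemma isUnit_det_of_quadraticForm_pos [DecidableEq ι] {A : Matrix ι ι ℝ}
    (h : ∀ u : ι → ℝ, u ≠ 0 → 0 < u ⬝ᵥ A *ᵥ u) : IsUnit A.det := by
  rw [isUnit_iff_ne_zero]
  intro h0
  obtain ⟨v, hv, hAv⟩ := Matrix.exists_mulVec_eq_zero_iff.2 h0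
  have := h v hv
  rw [hAv, dotProduct_zero] at this
  exact lt_irrefl _ this

lemma complete_square [DecidableEq ι] {A : Matrix ι ι ℝ} (hA : A.IsSymm) (hd : IsUnit A.det)
    (b γ : ι → ℝ) :
    γ ⬝ᵥ A *ᵥ γ - 2 * (γ ⬝ᵥ b) =
      (γ - A⁻¹ *ᵥ b) ⬝ᵥ A *ᵥ (γ - A⁻¹ *ᵥ b) - b ⬝ᵥ A⁻¹ *ᵥ b := by
  have h : A *ᵥ (A⁻¹ *ᵥ b) = b := by
    rw [Matrix.mulVec_mulVec, Matrix.mul_nonsing_inv _ hd, Matrix.one_mulVec]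
  rw [quadraticForm_sub hA, h, dotProduct_comm (A⁻¹ *ᵥ b) b]
  ring

end QuadraticForm

/-! ### The integral of the node density, as a function of the Gram matrix -/

section Energy

variable {ι κ : Type*} [Fintype κ]

/-- The exponent of the node density: `e - J γ` is the coefficient vector of the residual
and `G` the Gram matrix of the data. -/
noncomputable def energy [Fintype ι] (τ : ℝ) (e : κ → ℝ) (J : Matrix κ ι ℝ) (G : Matrix κ κ ℝ)
    (γ : ι → ℝ) : ℝ :=
  1 / 2 * (τ + τ * (γ ⬝ᵥ γ) + (e - J *ᵥ γ) ⬝ᵥ G *ᵥ (e - J *ᵥ γ))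

/-- The Hessian of `energy`. -/
def energyHessian [DecidableEq ι] (τ : ℝ) (J : Matrix κ ι ℝ) (G : Matrix κ κ ℝ) : Matrix ι ι ℝ :=
  τ • (1 : Matrix ι ι ℝ) + Jᵀ * G * J

lemma quadraticForm_energyHessian [Fintype ι] [DecidableEq ι] (τ : ℝ) (J : Matrix κ ι ℝ) (G : Matrix κ κ ℝ) (w : ι → ℝ) :
    w ⬝ᵥ energyHessian τ J G *ᵥ w = τ * (w ⬝ᵥ w) + (J *ᵥ w) ⬝ᵥ G *ᵥ (J *ᵥ w) := by
  rw [energyHessian, Matrix.add_mulVec, dotProduct_add, Matrix.smul_mulVec, dotProduct_smul,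
    Matrix.one_mulVec, ← Matrix.mulVec_mulVec, ← Matrix.mulVec_mulVec,
    dotProduct_transpose_mulVec, smul_eq_mul]

lemma isSymm_energyHessian [DecidableEq ι] (τ : ℝ) (J : Matrix κ ι ℝ) {G : Matrix κ κ ℝ} (hG : G.IsSymm) :
    (energyHessian τ J G).IsSymm := by
  unfold Matrix.IsSymm energyHessian
  rw [Matrix.transpose_add, Matrix.transpose_smul, Matrix.transpose_one, Matrix.transpose_mul,
    Matrix.transpose_mul, Matrix.transpose_transpose, hG.eq, Matrix.mul_assoc]

/-- Here `g` is the ridge estimate and `β` the minimum of the energy. Later arguments use only this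
variational meaning, never the closed formulas. -/
lemma exists_energy_eq [Fintype ι] [DecidableEq ι] {τ : ℝ} (hτ : 0 < τ) (e : κ → ℝ) (J : Matrix κ ι ℝ) {G : Matrix κ κ ℝ}
    (hG : G.IsSymm) (hG0 : ∀ u : κ → ℝ, 0 ≤ u ⬝ᵥ G *ᵥ u) :
    ∃ (β : ℝ) (g : ι → ℝ), ∀ γ, energy τ e J G γ =
      β + 1 / 2 * ((γ - g) ⬝ᵥ energyHessian τ J G *ᵥ (γ - g)) := by
  have hpos : ∀ w : ι → ℝ, w ≠ 0 → 0 < w ⬝ᵥ energyHessian τ J G *ᵥ w := fun w hw => by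
    rw [quadraticForm_energyHessian]
    have := mul_pos hτ (dotProduct_self_pos hw)
    linarith [hG0 (J *ᵥ w)]
  set b : ι → ℝ := Jᵀ *ᵥ (G *ᵥ e)
  refine ⟨1 / 2 * (τ + e ⬝ᵥ G *ᵥ e - b ⬝ᵥ (energyHessian τ J G)⁻¹ *ᵥ b),
    (energyHessian τ J G)⁻¹ *ᵥ b, fun γ => ?_⟩
  have h := complete_square (isSymm_energyHessian τ J hG) (isUnit_det_of_quadraticForm_pos hpos) b γ
  rw [quadraticForm_energyHessian] at h
  rw [energy, quadraticForm_sub hG, dotProduct_mulVec_comm hG e (J *ᵥ γ)]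
  have hb : γ ⬝ᵥ b = (J *ᵥ γ) ⬝ᵥ G *ᵥ e := dotProduct_transpose_mulVec _ _ _
  rw [hb] at h
  linarith

/-- Affine dependence on the Gram matrix is what keeps `f² / g` within the same family of densities.
-/
lemma energy_add_smul [Fintype ι] (τ : ℝ) (e : κ → ℝ) (J : Matrix κ ι ℝ) (G E : Matrix κ κ ℝ) (t : ℝ)
    (γ : ι → ℝ) :
    energy τ e J (G + t • E) γ =
      energy τ e J G γ + t / 2 * ((e - J *ᵥ γ) ⬝ᵥ E *ᵥ (e - J *ᵥ γ)) := by
  rw [energy, energy, Matrix.add_mulVec, dotProduct_add, Matrix.smul_mulVec, dotProduct_smul,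
    smul_eq_mul]
  ring

end Energy

/-! ### Scalar estimates -/

/-- By convexity of `log Γ`, its slope on `[a + s, a + 2s]` is at most that on the next unit
interval, `log (a + 2s)`, and its slope on `[a, a + s]` is at least that on `[a - 1, a]`, `log (a -
1)`. The difference of the two increments is the logarithm of the claim. -/
lemma gamma_mul_gamma_le {a s : ℝ} (ha : 1 < a) (hs : 0 ≤ s) :
    Real.Gamma (a + 2 * s) * Real.Gamma a ≤
      ((a + 2 * s) / (a - 1)) ^ s * Real.Gamma (a + s) ^ 2 := by
  rcases hs.eq_or_lt with rfl | hs
  · simp [sq]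
  have hf := Real.convexOn_log_Gamma
  have hstep : ∀ x : ℝ, 0 < x → Real.log (Real.Gamma (x + 1)) - Real.log (Real.Gamma x) =
      Real.log x := fun x hx => by
    rw [Real.Gamma_add_one hx.ne', Real.log_mul hx.ne' (Real.Gamma_pos_of_pos hx).ne']
    ring
  have h1 := hf.slope_mono_adjacent (x := a + s) (y := a + 2 * s) (z := a + 2 * s + 1)
    (Set.mem_Ioi.2 (by linarith)) (Set.mem_Ioi.2 (by linarith)) (by linarith) (by linarith)
  have h2 := hf.slope_mono_adjacent (x := a - 1) (y := a) (z := a + s)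
    (Set.mem_Ioi.2 (by linarith)) (Set.mem_Ioi.2 (by linarith)) (by linarith) (by linarith)
  simp only [Function.comp_apply] at h1 h2
  have e1 : a + 2 * s + 1 - (a + 2 * s) = 1 := by ring
  have e2 : a + 2 * s - (a + s) = s := by ring
  have e3 : a - (a - 1) = 1 := by ring
  have e4 : a + s - a = s := by ring
  rw [e1, e2, div_one, hstep _ (by linarith), div_le_iff₀ hs] at h1
  have h3 := hstep (a - 1) (by linarith)
  rw [sub_add_cancel] at h3
  rw [e3, e4, div_one, h3, le_div_iff₀ hs] at h2
  have p1 : 0 < Real.Gamma (a + 2 * s) := Real.Gamma_pos_of_pos (by linarith)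
  have p2 : 0 < Real.Gamma a := Real.Gamma_pos_of_pos (by linarith)
  have p3 : 0 < Real.Gamma (a + s) := Real.Gamma_pos_of_pos (by linarith)
  have p4 : 0 < (a + 2 * s) / (a - 1) := div_pos (by linarith) (by linarith)
  rw [← Real.log_le_log_iff (by positivity) (by positivity), Real.log_mul p1.ne' p2.ne',
    Real.log_mul (by positivity) (by positivity), Real.log_rpow p4, Real.log_pow,
    Real.log_div (by linarith) (by linarith)]
  push_cast
  linarith

/-- Meant for `x`, `y`, `z` the minimal energies at `G`, `G + E`, `G + 2E`. The logarithm of the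
quotient is `a * log (y² / (x z))` plus `2 s * log (y / z) ≤ 0`, and `log u ≤ u - 1` bounds the
first term. -/
lemma rpow_mul_rpow_le {a s x y z D D' : ℝ} (ha : 0 < a) (hs : 0 ≤ s) (hx : 0 < x) (hy : 0 < y)
    (hyz : y ≤ z) (hD : 0 ≤ D) (hy' : y ≤ x + D' / 2) (hz : x + D ≤ z) (hDD : D ≤ D') :
    z ^ (-(a + 2 * s)) * x ^ (-a) ≤
      Real.exp (a * ((D' - D) / x + D' ^ 2 / (4 * x ^ 2))) * (y ^ (-(a + s))) ^ 2 := by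
  have hz0 : 0 < z := by linarith
  have hl : Real.log y ≤ Real.log z := Real.log_le_log hy hyz
  have hmain : 2 * Real.log y - Real.log x - Real.log z ≤
      (D' - D) / x + D' ^ 2 / (4 * x ^ 2) := by
    have h1 : 2 * Real.log y - Real.log x - Real.log z = Real.log (y ^ 2 / (x * z)) := by
      rw [Real.log_div (by positivity) (by positivity), Real.log_pow,
        Real.log_mul hx.ne' hz0.ne']
      push_cast
      ring
    rw [h1]
    refine (Real.log_le_sub_one_of_pos (by positivity)).trans ?_
    have h2 : y ^ 2 ≤ (x + D' / 2) ^ 2 := pow_le_pow_left₀ hy.le hy' 2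
    have h3 : y ^ 2 / (x * z) ≤ (x + D' / 2) ^ 2 / (x * (x + D)) := by gcongr
    have h4 : (x + D' / 2) ^ 2 / (x * (x + D)) - 1 =
        (x * (D' - D) + D' ^ 2 / 4) / (x * (x + D)) := by
      field_simp
      ring
    have h5 : (x * (D' - D) + D' ^ 2 / 4) / (x * (x + D)) ≤
        (x * (D' - D) + D' ^ 2 / 4) / (x * x) := by
      have : 0 ≤ x * (D' - D) + D' ^ 2 / 4 := by
        have := mul_nonneg hx.le (sub_nonneg.2 hDD)
        positivity
      gcongr
      linarith
    have h6 : (x * (D' - D) + D' ^ 2 / 4) / (x * x) = (D' - D) / x + D' ^ 2 / (4 * x ^ 2) := by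
      field_simp
    linarith
  rw [← Real.log_le_log_iff (by positivity) (by positivity), Real.log_mul (by positivity)
    (by positivity), Real.log_mul (by positivity) (by positivity), Real.log_exp, Real.log_pow,
    Real.log_rpow hz0, Real.log_rpow hx, Real.log_rpow hy]
  push_cast
  nlinarith [mul_le_mul_of_nonneg_left hmain ha.le, mul_le_mul_of_nonneg_left hl hs]

/-! ### The chi-squared integral of a node -/

section NodeBound

variable {ι κ : Type*} [Fintype ι] [Fintype κ] [DecidableEq ι]

/-- Minimal energies are compared by inserting the minimiser of one energy into another. Here `D`
and `D'` are the values of the perturbation `q` at the minimisers for `G + 2E` and `G`. Strong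
convexity with constant `L` makes these minimisers close, so `D' - D` is of second order in `lam`.
-/
lemma node_scalars {τ : ℝ} (hτ : 0 < τ) {e : κ → ℝ} {J : Matrix κ ι ℝ}
    (hJ : ∀ γ : ι → ℝ, (e - J *ᵥ γ) ⬝ᵥ (e - J *ᵥ γ) = 1 + γ ⬝ᵥ γ)
    (hJ' : ∀ γ : ι → ℝ, (J *ᵥ γ) ⬝ᵥ (J *ᵥ γ) = γ ⬝ᵥ γ)
    {G E : Matrix κ κ ℝ} (hE : E.IsSymm) {L U lam : ℝ} (hL : 0 < L)
    (hGL : ∀ u : κ → ℝ, L * (u ⬝ᵥ u) ≤ u ⬝ᵥ G *ᵥ u) (hGU : e ⬝ᵥ G *ᵥ e ≤ U)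
    (hE0 : ∀ u : κ → ℝ, 0 ≤ u ⬝ᵥ E *ᵥ u) (hE1 : ∀ u : κ → ℝ, u ⬝ᵥ E *ᵥ u ≤ lam * (u ⬝ᵥ u))
    (hlam : 0 ≤ lam)
    {βR βB β2 : ℝ} {gR gB g2 : ι → ℝ}
    (hR : ∀ γ, energy τ e J G γ =
      βR + 1 / 2 * ((γ - gR) ⬝ᵥ energyHessian τ J G *ᵥ (γ - gR)))
    (hB : ∀ γ, energy τ e J (G + (1 : ℝ) • E) γ =
      βB + 1 / 2 * ((γ - gB) ⬝ᵥ energyHessian τ J (G + (1 : ℝ) • E) *ᵥ (γ - gB)))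
    (h2 : ∀ γ, energy τ e J (G + (2 : ℝ) • E) γ =
      β2 + 1 / 2 * ((γ - g2) ⬝ᵥ energyHessian τ J (G + (2 : ℝ) • E) *ᵥ (γ - g2))) :
    ∃ D D' : ℝ, L / 2 ≤ βR ∧ βR ≤ βB ∧ βB ≤ β2 ∧ 0 ≤ D ∧ D ≤ D' ∧ βB ≤ βR + D' / 2 ∧
      βR + D ≤ β2 ∧ D' ≤ lam * ((τ + U) / L) ∧ D' - D ≤ 8 * lam ^ 2 * ((τ + U) / L) / L := by
  have hG0 : ∀ u : κ → ℝ, 0 ≤ u ⬝ᵥ G *ᵥ u := fun u =>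
    (mul_nonneg hL.le (dotProduct_self_nonneg' u)).trans (hGL u)
  have hHR : ∀ w : ι → ℝ, L * (w ⬝ᵥ w) ≤ w ⬝ᵥ energyHessian τ J G *ᵥ w := fun w => by
    rw [quadraticForm_energyHessian]
    have := hGL (J *ᵥ w)
    rw [hJ'] at this
    linarith [mul_nonneg hτ.le (dotProduct_self_nonneg' w)]
  have hH0 : ∀ (t : ℝ), 0 ≤ t → ∀ w : ι → ℝ, 0 ≤ w ⬝ᵥ energyHessian τ J (G + t • E) *ᵥ w :=
    fun t ht w => by
    rw [quadraticForm_energyHessian, Matrix.add_mulVec, dotProduct_add, Matrix.smul_mulVec,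
      dotProduct_smul, smul_eq_mul]
    have := mul_nonneg hτ.le (dotProduct_self_nonneg' w)
    have := mul_nonneg ht (hE0 (J *ᵥ w))
    linarith [hG0 (J *ᵥ w)]
  set q : (ι → ℝ) → ℝ := fun γ => (e - J *ᵥ γ) ⬝ᵥ E *ᵥ (e - J *ᵥ γ) with hq
  have hq0 : ∀ γ, 0 ≤ q γ := fun γ => hE0 _
  have eB : ∀ γ, energy τ e J (G + (1 : ℝ) • E) γ = energy τ e J G γ + 1 / 2 * q γ :=
    fun γ => energy_add_smul _ _ _ _ _ _ _
  have e2 : ∀ γ, energy τ e J (G + (2 : ℝ) • E) γ = energy τ e J G γ + q γ :=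
    fun γ => by rw [energy_add_smul]; simp [hq]
  have hR0 : energy τ e J G gR = βR := by rw [hR]; simp
  have hB0 : energy τ e J (G + (1 : ℝ) • E) gB = βB := by rw [hB]; simp
  have h20 : energy τ e J (G + (2 : ℝ) • E) g2 = β2 := by rw [h2]; simp
  have hRle : ∀ γ, βR + L / 2 * ((γ - gR) ⬝ᵥ (γ - gR)) ≤ energy τ e J G γ := fun γ => by
    rw [hR γ]; linarith [hHR (γ - gR)]
  have hRle' : ∀ γ, βR ≤ energy τ e J G γ := fun γ => by
    have := mul_nonneg (half_pos hL).le (dotProduct_self_nonneg' (γ - gR))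
    linarith [hRle γ]
  have hBle : ∀ γ, βB ≤ energy τ e J (G + (1 : ℝ) • E) γ := fun γ => by
    rw [hB γ]; linarith [hH0 1 zero_le_one (γ - gB)]
  have h2le : ∀ γ, β2 ≤ energy τ e J (G + (2 : ℝ) • E) γ := fun γ => by
    rw [h2 γ]; linarith [hH0 2 zero_le_two (γ - g2)]
  have hlow : ∀ γ, L / 2 * (1 + γ ⬝ᵥ γ) ≤ energy τ e J G γ := fun γ => by
    have h := hGL (e - J *ᵥ γ)
    rw [hJ] at h
    rw [energy]
    linarith [mul_nonneg hτ.le (dotProduct_self_nonneg' γ)]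
  have hup : βR ≤ 1 / 2 * (τ + U) := by
    refine (hRle' 0).trans ?_
    rw [energy, Matrix.mulVec_zero, sub_zero, dotProduct_zero]
    linarith
  -- The minimiser is bounded because its energy, at least `L / 2 * (1 + |gR|²)`, is at most the
  -- energy at `γ = 0`.
  have hκ : 1 + gR ⬝ᵥ gR ≤ (τ + U) / L := by
    rw [le_div_iff₀ hL]
    linarith [hlow gR]
  have hD' : q gR ≤ lam * ((τ + U) / L) :=
    ((hE1 _).trans_eq (by rw [hJ])).trans (mul_le_mul_of_nonneg_left hκ hlam)
  have hκ0 : 0 ≤ (τ + U) / L := by linarith [dotProduct_self_nonneg' gR]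
  have hT : L / 2 * ((g2 - gR) ⬝ᵥ (g2 - gR)) ≤ q gR - q g2 := by
    have := h2le gR
    rw [e2, hR0, ← h20, e2] at this
    linarith [hRle g2]
  have hT0 : 0 ≤ q gR - q g2 :=
    (mul_nonneg (half_pos hL).le (dotProduct_self_nonneg' _)).trans hT
  refine ⟨q g2, q gR, ?_, ?_, ?_, hq0 _, by linarith, ?_, ?_, hD', ?_⟩
  · have := hlow gR
    rw [hR0] at this
    have := mul_nonneg (half_pos hL).le (dotProduct_self_nonneg' gR)
    linarith
  · rw [← hB0, eB]
    linarith [hRle' gB, hq0 gB]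
  · have := hBle g2
    rw [eB] at this
    rw [← h20, e2]
    linarith [hq0 g2]
  · have := hBle gR
    rw [eB, hR0] at this
    linarith
  · rw [← h20, e2]
    linarith [hRle' g2]
  · set T := q gR - q g2 with hTdef
    set w := g2 - gR with hw
    have hlin : T ≤ 2 * ((e - J *ᵥ gR) ⬝ᵥ E *ᵥ (J *ᵥ w)) := by
      have : e - J *ᵥ g2 = (e - J *ᵥ gR) - J *ᵥ w := by
        rw [hw, Matrix.mulVec_sub]; abel
      have h := quadraticForm_sub hE (e - J *ᵥ gR) (J *ᵥ w)
      rw [← this] at h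
      simp only [hTdef, hq]
      linarith [hE0 (J *ᵥ w)]
    have hcs := quadraticForm_cauchySchwarz hE hE0 (e - J *ᵥ gR) (J *ᵥ w)
    have hw2 : (J *ᵥ w) ⬝ᵥ E *ᵥ (J *ᵥ w) ≤ lam * (w ⬝ᵥ w) := by
      rw [← hJ' w]; exact hE1 _
    have hsq : T ^ 2 ≤ 4 * (lam * ((τ + U) / L)) * (lam * (w ⬝ᵥ w)) := by
      calc T ^ 2 ≤ (2 * ((e - J *ᵥ gR) ⬝ᵥ E *ᵥ (J *ᵥ w))) ^ 2 := pow_le_pow_left₀ hT0 hlin 2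
        _ = 4 * ((e - J *ᵥ gR) ⬝ᵥ E *ᵥ (J *ᵥ w)) ^ 2 := by ring
        _ ≤ 4 * (q gR * (lam * (w ⬝ᵥ w))) := by
          refine mul_le_mul_of_nonneg_left (hcs.trans ?_) (by norm_num)
          exact mul_le_mul_of_nonneg_left hw2 (hq0 gR)
        _ ≤ 4 * (lam * ((τ + U) / L) * (lam * (w ⬝ᵥ w))) := by
          have := mul_nonneg hlam (dotProduct_self_nonneg' w)
          gcongr
        _ = _ := by ring
    have hww : w ⬝ᵥ w ≤ 2 * T / L := by
      rw [le_div_iff₀ hL]; linarith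
    -- The bound on `|w|²` is itself linear in `T`, so `hsq` becomes `T² ≤ const * T` and one factor
    -- `T` cancels.
    rcases hT0.eq_or_lt with h0 | h0
    · rw [← h0]; positivity
    · have : T * T ≤ (8 * lam ^ 2 * ((τ + U) / L) / L) * T := by
        calc T * T = T ^ 2 := by ring
          _ ≤ 4 * (lam * ((τ + U) / L)) * (lam * (2 * T / L)) := by
            refine hsq.trans ?_
            gcongr
          _ = _ := by ring
      exact le_of_mul_le_mul_right this h0

lemma lintegral_nigDensity_energy_ne {τ : ℝ} (hτ : 0 < τ) (e : κ → ℝ) (J : Matrix κ ι ℝ)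
    {G : Matrix κ κ ℝ} (hG : G.IsSymm) (hG0 : ∀ u : κ → ℝ, 0 ≤ u ⬝ᵥ G *ᵥ u) {α : ℝ}
    (ha : 0 < α - (Fintype.card ι : ℝ) / 2) :
    ∫⁻ θ, nigDensity α (energy τ e J G) θ ≠ 0 ∧ ∫⁻ θ, nigDensity α (energy τ e J G) θ ≠ ∞ := by
  obtain ⟨β, g, h⟩ := exists_energy_eq hτ e J hG hG0
  have hβ : 0 < β := by
    have h0 : energy τ e J G g = β := by rw [h]; simp
    rw [← h0, energy]
    have := mul_nonneg hτ.le (dotProduct_self_nonneg' g)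
    linarith [hG0 (e - J *ᵥ g)]
  rw [lintegral_nigDensity h ha hβ]
  have hΓ := Real.Gamma_pos_of_pos ha
  refine ⟨mul_ne_zero (gaussMass_ne_zero _) (ENNReal.ofReal_pos.2 (by positivity)).ne',
    ENNReal.mul_ne_top (gaussMass_ne_top hτ fun y => ?_) ENNReal.ofReal_ne_top⟩
  rw [quadraticForm_energyHessian]
  linarith [hG0 (J *ᵥ y)]

/-- The Gaussian masses, the Gamma factors and the powers of the minimal energies are bounded
separately, one factor on the right for each. -/
lemma chiSq_node_le {τ : ℝ} (hτ : 0 < τ) {e : κ → ℝ} {J : Matrix κ ι ℝ}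
    (hJ : ∀ γ : ι → ℝ, (e - J *ᵥ γ) ⬝ᵥ (e - J *ᵥ γ) = 1 + γ ⬝ᵥ γ)
    (hJ' : ∀ γ : ι → ℝ, (J *ᵥ γ) ⬝ᵥ (J *ᵥ γ) = γ ⬝ᵥ γ)
    {G E : Matrix κ κ ℝ} (hG : G.IsSymm) (hE : E.IsSymm) {L U lam : ℝ} (hL : 0 < L)
    (hGL : ∀ u : κ → ℝ, L * (u ⬝ᵥ u) ≤ u ⬝ᵥ G *ᵥ u) (hGU : e ⬝ᵥ G *ᵥ e ≤ U)
    (hE0 : ∀ u : κ → ℝ, 0 ≤ u ⬝ᵥ E *ᵥ u) (hE1 : ∀ u : κ → ℝ, u ⬝ᵥ E *ᵥ u ≤ lam * (u ⬝ᵥ u))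
    (hlam : 0 ≤ lam) {a s : ℝ} (ha : 1 < a) (hs : 0 ≤ s) :
    (∫⁻ θ, nigDensity (a + 2 * s + (Fintype.card ι : ℝ) / 2)
        (energy τ e J (G + (2 : ℝ) • E)) θ) *
      (∫⁻ θ, nigDensity (a + (Fintype.card ι : ℝ) / 2) (energy τ e J G) θ) *
      ((∫⁻ θ, nigDensity (a + s + (Fintype.card ι : ℝ) / 2)
        (energy τ e J (G + (1 : ℝ) • E)) θ) ^ 2)⁻¹ ≤
    ENNReal.ofReal ((1 + lam / L) ^ ((Fintype.card ι : ℝ) / 2) *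
      ((a + 2 * s) / (a - 1)) ^ s *
      Real.exp (a * (lam ^ 2 / L ^ 2 * (16 * ((τ + U) / L) + ((τ + U) / L) ^ 2)))) := by
  set d : ℝ := (Fintype.card ι : ℝ) / 2
  have hG0 : ∀ u : κ → ℝ, 0 ≤ u ⬝ᵥ G *ᵥ u := fun u =>
    (mul_nonneg hL.le (dotProduct_self_nonneg' u)).trans (hGL u)
  have hGt : ∀ t : ℝ, (G + t • E).IsSymm := fun t => hG.add (hE.smul t)
  have hGt0 : ∀ t : ℝ, 0 ≤ t → ∀ u : κ → ℝ, 0 ≤ u ⬝ᵥ (G + t • E) *ᵥ u := fun t ht u => by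
    rw [Matrix.add_mulVec, dotProduct_add, Matrix.smul_mulVec, dotProduct_smul, smul_eq_mul]
    have := mul_nonneg ht (hE0 u)
    linarith [hG0 u]
  obtain ⟨βR, gR, hR⟩ := exists_energy_eq hτ e J hG hG0
  obtain ⟨βB, gB, hB⟩ := exists_energy_eq hτ e J (hGt 1) (hGt0 1 zero_le_one)
  obtain ⟨β2, g2, h2⟩ := exists_energy_eq hτ e J (hGt 2) (hGt0 2 zero_le_two)
  obtain ⟨D, D', hβR, hRB, hB2, hD, hDD, hBD, h2D, hD', hT⟩ :=
    node_scalars hτ hJ hJ' hE hL hGL hGU hE0 hE1 hlam hR hB h2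
  have hβR0 : 0 < βR := by linarith
  have hβB0 : 0 < βB := by linarith
  have hβ20 : 0 < β2 := by linarith
  rw [lintegral_nigDensity hR (by rw [add_sub_cancel_right]; linarith) hβR0,
    lintegral_nigDensity hB (by rw [add_sub_cancel_right]; linarith) hβB0,
    lintegral_nigDensity h2 (by rw [add_sub_cancel_right]; linarith) hβ20,
    add_sub_cancel_right, add_sub_cancel_right, add_sub_cancel_right]
  set KR := gaussMass (energyHessian τ J G)
  set KB := gaussMass (energyHessian τ J (G + (1 : ℝ) • E))
  set K2 := gaussMass (energyHessian τ J (G + (2 : ℝ) • E))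
  have hsplit : ∀ (t : ℝ) (w : ι → ℝ), w ⬝ᵥ energyHessian τ J (G + t • E) *ᵥ w =
      w ⬝ᵥ energyHessian τ J G *ᵥ w + t * ((J *ᵥ w) ⬝ᵥ E *ᵥ (J *ᵥ w)) := fun t w => by
    rw [quadraticForm_energyHessian, quadraticForm_energyHessian, Matrix.add_mulVec,
      dotProduct_add, Matrix.smul_mulVec, dotProduct_smul, smul_eq_mul]
    ring
  have hK2 : K2 ≤ KB := gaussMass_le_of_le fun w => by
    rw [hsplit, hsplit]
    linarith [hE0 (J *ᵥ w)]
  have ht : 0 < 1 + lam / L := by positivity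
  have hKR : KR ≤ ENNReal.ofReal ((1 + lam / L) ^ d) * KB :=
    gaussMass_le_mul_of_le ht fun w => by
      rw [hsplit, one_mul]
      have h1 := hE1 (J *ᵥ w)
      rw [hJ'] at h1
      have h3 : L * (w ⬝ᵥ w) ≤ w ⬝ᵥ energyHessian τ J G *ᵥ w := by
        rw [quadraticForm_energyHessian]
        have := hGL (J *ᵥ w)
        rw [hJ'] at this
        linarith [mul_nonneg hτ.le (dotProduct_self_nonneg' w)]
      have h4 := mul_le_mul_of_nonneg_left h3 (div_nonneg hlam hL.le)
      have h5 : lam / L * (L * (w ⬝ᵥ w)) = lam * (w ⬝ᵥ w) := by field_simp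
      rw [h5] at h4
      linarith
  have hKB0 : KB ≠ 0 := gaussMass_ne_zero _
  have hKB1 : KB ≠ ∞ := gaussMass_ne_top hτ fun y => by
    rw [quadraticForm_energyHessian]
    linarith [hGt0 1 zero_le_one (J *ᵥ y)]
  have pB : 0 < Real.Gamma (a + s) := Real.Gamma_pos_of_pos (by linarith)
  have p2 : 0 < Real.Gamma (a + 2 * s) := Real.Gamma_pos_of_pos (by linarith)
  have pR : 0 < Real.Gamma a := Real.Gamma_pos_of_pos (by linarith)
  set cB := Real.Gamma (a + s) * βB ^ (-(a + s))
  set c2 := Real.Gamma (a + 2 * s) * β2 ^ (-(a + 2 * s))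
  set cR := Real.Gamma a * βR ^ (-a)
  have hcB : 0 < cB := by positivity
  set M := ((a + 2 * s) / (a - 1)) ^ s *
      Real.exp (a * (lam ^ 2 / L ^ 2 * (16 * ((τ + U) / L) + ((τ + U) / L) ^ 2))) with hM
  have hM0 : 0 ≤ M := by
    have : 0 < (a + 2 * s) / (a - 1) := div_pos (by linarith) (by linarith)
    positivity
  have hscal : c2 * cR ≤ M * cB ^ 2 := by
    have h3 := gamma_mul_gamma_le ha hs
    have h4 := rpow_mul_rpow_le (a := a) (by linarith) hs hβR0 hβB0 hB2 hD hBD h2D hDD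
    -- The lower bound `βR ≥ L / 2` turns the constant 8 into 16 and the factor `1 / 4` into 1.
    have h5 : (D' - D) / βR + D' ^ 2 / (4 * βR ^ 2) ≤
        lam ^ 2 / L ^ 2 * (16 * ((τ + U) / L) + ((τ + U) / L) ^ 2) := by
      have i1 : (D' - D) / βR ≤ (8 * lam ^ 2 * ((τ + U) / L) / L) / (L / 2) := by
        have : 0 ≤ D' - D := by linarith
        gcongr
        linarith
      have i2 : D' ^ 2 / (4 * βR ^ 2) ≤ (lam * ((τ + U) / L)) ^ 2 / (4 * (L / 2) ^ 2) := by
        have : 0 ≤ D' := by linarith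
        gcongr
      refine (add_le_add i1 i2).trans_eq ?_
      field_simp
      ring
    have h6 : Real.exp (a * ((D' - D) / βR + D' ^ 2 / (4 * βR ^ 2))) ≤
        Real.exp (a * (lam ^ 2 / L ^ 2 * (16 * ((τ + U) / L) + ((τ + U) / L) ^ 2))) :=
      Real.exp_le_exp.2 (mul_le_mul_of_nonneg_left h5 (by linarith))
    calc c2 * cR = (Real.Gamma (a + 2 * s) * Real.Gamma a) *
          (β2 ^ (-(a + 2 * s)) * βR ^ (-a)) := by simp only [c2, cR]; ring
      _ ≤ (((a + 2 * s) / (a - 1)) ^ s * Real.Gamma (a + s) ^ 2) *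
          (Real.exp (a * (lam ^ 2 / L ^ 2 * (16 * ((τ + U) / L) + ((τ + U) / L) ^ 2))) *
            (βB ^ (-(a + s))) ^ 2) := by
          refine mul_le_mul h3 (h4.trans ?_) (by positivity) ?_
          · gcongr
          · exact (mul_pos p2 pR).le.trans h3
      _ = M * cB ^ 2 := by simp only [hM, cB]; ring
  have hcB0 : ENNReal.ofReal cB ≠ 0 := (ENNReal.ofReal_pos.2 hcB).ne'
  have hX0 : (KB * ENNReal.ofReal cB) ^ 2 ≠ 0 := pow_ne_zero _ (mul_ne_zero hKB0 hcB0)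
  have hX1 : (KB * ENNReal.ofReal cB) ^ 2 ≠ ∞ :=
    ENNReal.pow_ne_top (ENNReal.mul_ne_top hKB1 ENNReal.ofReal_ne_top)
  rw [← div_eq_mul_inv, ENNReal.div_le_iff hX0 hX1]
  have hc20 : 0 ≤ c2 := by positivity
  calc K2 * ENNReal.ofReal c2 * (KR * ENNReal.ofReal cR)
      = K2 * KR * ENNReal.ofReal (c2 * cR) := by
        rw [ENNReal.ofReal_mul hc20]; ring
    _ ≤ KB * (ENNReal.ofReal ((1 + lam / L) ^ d) * KB) * ENNReal.ofReal (M * cB ^ 2) := by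
        gcongr
    _ = _ := by
        rw [mul_assoc ((1 + lam / L) ^ d), ENNReal.ofReal_mul hM0, ENNReal.ofReal_mul
          (p := (1 + lam / L) ^ d) (by positivity), ENNReal.ofReal_pow hcB.le]
        ring

end NodeBound

/-! ### Least squares and residual contrasts -/

section Contrast

variable {n m k p : ℕ}

lemma isSymm_gram {ι κ : Type*} [Fintype κ] (Q : Matrix κ ι ℝ) : (Qᵀ * Q).IsSymm := by
  rw [Matrix.IsSymm, Matrix.transpose_mul, Matrix.transpose_transpose]

lemma quadraticForm_gram {ι κ : Type*} [Fintype ι] [Fintype κ] (Q : Matrix κ ι ℝ) (b : ι → ℝ) :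
    b ⬝ᵥ (Qᵀ * Q) *ᵥ b = (Q *ᵥ b) ⬝ᵥ (Q *ᵥ b) := by
  rw [← Matrix.mulVec_mulVec, dotProduct_transpose_mulVec]

/-- If `Qᵀ Q` were singular, its inverse would be 0 by convention and `P Pᵀ = 1`. Comparing traces
gives `n - m = n`, so `m = 0`, but the empty determinant is 1. -/
lemma IsResidualContrast.isUnit_det {Q : Matrix (Fin n) (Fin m) ℝ}
    {P : Matrix (Fin n) (Fin (n - m)) ℝ} (h : IsResidualContrast Q P) (hmn : m ≤ n) :
    IsUnit (Qᵀ * Q).det := by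
  by_contra hu
  have h1 := congrArg Matrix.trace h.2.2
  rw [Matrix.trace_mul_comm, h.2.1, Matrix.nonsing_inv_apply_not_isUnit _ hu, Matrix.mul_zero,
    Matrix.zero_mul, sub_zero, Matrix.trace_one, Matrix.trace_one, Fintype.card_fin,
    Fintype.card_fin] at h1
  have h2 : n - m = n := by exact_mod_cast h1
  rcases Nat.eq_zero_or_pos m with rfl | hm
  · exact hu (by simp)
  · omega

/-- The least squares coefficients of the regression of `r` on the columns of `Q`. -/
noncomputable def leastSquares (Q : Matrix (Fin n) (Fin m) ℝ) (r : Fin n → ℝ) : Fin m → ℝ :=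
  (Qᵀ * Q)⁻¹ *ᵥ (Qᵀ *ᵥ r)

lemma norm_sq_sub_mulVec (Q : Matrix (Fin n) (Fin m) ℝ) (r : Fin n → ℝ) (b : Fin m → ℝ) :
    (r - Q *ᵥ b) ⬝ᵥ (r - Q *ᵥ b) =
      r ⬝ᵥ r + (b ⬝ᵥ (Qᵀ * Q) *ᵥ b - 2 * (b ⬝ᵥ (Qᵀ *ᵥ r))) := by
  rw [quadraticForm_gram, dotProduct_transpose_mulVec, sub_dotProduct, dotProduct_sub,
    dotProduct_sub, dotProduct_comm r (Q *ᵥ b)]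
  ring

lemma IsResidualContrast.norm_sq {Q : Matrix (Fin n) (Fin m) ℝ} {P : Matrix (Fin n) (Fin k) ℝ}
    (h : IsResidualContrast Q P) (r : Fin n → ℝ) :
    (Pᵀ *ᵥ r) ⬝ᵥ (Pᵀ *ᵥ r) = r ⬝ᵥ r - (Qᵀ *ᵥ r) ⬝ᵥ (Qᵀ * Q)⁻¹ *ᵥ (Qᵀ *ᵥ r) := by
  have h1 : (Pᵀ *ᵥ r) ⬝ᵥ (Pᵀ *ᵥ r) = r ⬝ᵥ (P * Pᵀ) *ᵥ r := by
    have := quadraticForm_gram Pᵀ r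
    rw [Matrix.transpose_transpose] at this
    exact this.symm
  rw [h1, h.2.2, Matrix.sub_mulVec, Matrix.one_mulVec, dotProduct_sub, ← Matrix.mulVec_mulVec,
    ← Matrix.mulVec_mulVec]
  congr 1
  have := dotProduct_transpose_mulVec Qᵀ r ((Qᵀ * Q)⁻¹ *ᵥ (Qᵀ *ᵥ r))
  rwa [Matrix.transpose_transpose] at this

/-- Pythagoras: `Pᵀ` retains exactly the part of `r` orthogonal to the columns of `Q`, so `|Pᵀ r|²`
is the minimum of `|r - Q b|²` over `b`. -/
lemma IsResidualContrast.norm_sq_sub {Q : Matrix (Fin n) (Fin m) ℝ} {P : Matrix (Fin n) (Fin k) ℝ}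
    (h : IsResidualContrast Q P) (hu : IsUnit (Qᵀ * Q).det) (r : Fin n → ℝ) (b : Fin m → ℝ) :
    (r - Q *ᵥ b) ⬝ᵥ (r - Q *ᵥ b) = (Pᵀ *ᵥ r) ⬝ᵥ (Pᵀ *ᵥ r) +
      (Q *ᵥ (b - leastSquares Q r)) ⬝ᵥ (Q *ᵥ (b - leastSquares Q r)) := by
  rw [norm_sq_sub_mulVec, complete_square (isSymm_gram Q) hu, h.norm_sq, ← quadraticForm_gram]
  simp only [leastSquares]
  ring

lemma IsResidualContrast.norm_sq_add {Q : Matrix (Fin n) (Fin m) ℝ} {P : Matrix (Fin n) (Fin k) ℝ}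
    (h : IsResidualContrast Q P) (hu : IsUnit (Qᵀ * Q).det) (r : Fin n → ℝ) :
    (Pᵀ *ᵥ r) ⬝ᵥ (Pᵀ *ᵥ r) + (Q *ᵥ leastSquares Q r) ⬝ᵥ (Q *ᵥ leastSquares Q r) = r ⬝ᵥ r := by
  have := h.norm_sq_sub hu r 0
  rw [Matrix.mulVec_zero, sub_zero, zero_sub, Matrix.mulVec_neg, neg_dotProduct_neg] at this
  exact this.symm

/-- The inverse covariance matrix `1 - Q (V⁻¹ + Qᵀ Q)⁻¹ Qᵀ`, up to the factor `ψ`, of the data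
of a node after integrating out the effects of the exogenous variables. -/
noncomputable def marginalPrecision (V : Matrix (Fin m) (Fin m) ℝ) (Q : Matrix (Fin n) (Fin m) ℝ) :
    Matrix (Fin n) (Fin n) ℝ :=
  1 - Q * (V⁻¹ + Qᵀ * Q)⁻¹ * Qᵀ

lemma isSymm_of_posDef {V : Matrix (Fin m) (Fin m) ℝ} (hV : V.PosDef) : V.IsSymm := by
  have := hV.isHermitian.eq
  rwa [Matrix.conjTranspose_eq_transpose_of_trivial] at this

lemma quadraticForm_inv_nonneg {V : Matrix (Fin m) (Fin m) ℝ} (hV : V.PosDef) (b : Fin m → ℝ) :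
    0 ≤ b ⬝ᵥ V⁻¹ *ᵥ b := by
  simpa using hV.inv.posSemidef.dotProduct_mulVec_nonneg b

lemma isUnit_det_inv_add_gram {V : Matrix (Fin m) (Fin m) ℝ} (hV : V.PosDef)
    (Q : Matrix (Fin n) (Fin m) ℝ) : IsUnit (V⁻¹ + Qᵀ * Q).det := by
  refine isUnit_det_of_quadraticForm_pos fun b hb => ?_
  rw [Matrix.add_mulVec, dotProduct_add, quadraticForm_gram]
  have h : 0 < b ⬝ᵥ V⁻¹ *ᵥ b := by simpa using hV.inv.dotProduct_mulVec_pos hb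
  linarith [dotProduct_self_nonneg' (Q *ᵥ b)]

lemma isSymm_marginalPrecision {V : Matrix (Fin m) (Fin m) ℝ} (hV : V.PosDef)
    (Q : Matrix (Fin n) (Fin m) ℝ) : (marginalPrecision V Q).IsSymm := by
  have h : ((V⁻¹ + Qᵀ * Q)⁻¹)ᵀ = (V⁻¹ + Qᵀ * Q)⁻¹ := by
    rw [Matrix.transpose_nonsing_inv, ((isSymm_of_posDef hV.inv).add (isSymm_gram Q)).eq]
  unfold Matrix.IsSymm marginalPrecision
  rw [Matrix.transpose_sub, Matrix.transpose_one, Matrix.transpose_mul, Matrix.transpose_mul,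
    Matrix.transpose_transpose, h, Matrix.mul_assoc]

/-- This exhibits the marginal quadratic form as the minimum over `b` of the ridge criterion. It
serves to integrate `b` out, and to bound the form on both sides. -/
lemma marginalPrecision_complete_square {V : Matrix (Fin m) (Fin m) ℝ} (hV : V.PosDef)
    (Q : Matrix (Fin n) (Fin m) ℝ) (r : Fin n → ℝ) (b : Fin m → ℝ) :
    b ⬝ᵥ V⁻¹ *ᵥ b + (r - Q *ᵥ b) ⬝ᵥ (r - Q *ᵥ b) = r ⬝ᵥ marginalPrecision V Q *ᵥ r +
      (b - (V⁻¹ + Qᵀ * Q)⁻¹ *ᵥ (Qᵀ *ᵥ r)) ⬝ᵥ (V⁻¹ + Qᵀ * Q) *ᵥ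
        (b - (V⁻¹ + Qᵀ * Q)⁻¹ *ᵥ (Qᵀ *ᵥ r)) := by
  have h := complete_square ((isSymm_of_posDef hV.inv).add (isSymm_gram Q))
    (isUnit_det_inv_add_gram hV Q) (Qᵀ *ᵥ r) b
  have h1 : r ⬝ᵥ marginalPrecision V Q *ᵥ r =
      r ⬝ᵥ r - (Qᵀ *ᵥ r) ⬝ᵥ (V⁻¹ + Qᵀ * Q)⁻¹ *ᵥ (Qᵀ *ᵥ r) := by
    rw [marginalPrecision, Matrix.sub_mulVec, Matrix.one_mulVec, dotProduct_sub,
      ← Matrix.mulVec_mulVec, ← Matrix.mulVec_mulVec]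
    congr 1
    have := dotProduct_transpose_mulVec Qᵀ r ((V⁻¹ + Qᵀ * Q)⁻¹ *ᵥ (Qᵀ *ᵥ r))
    rwa [Matrix.transpose_transpose] at this
  have h2 : b ⬝ᵥ (V⁻¹ + Qᵀ * Q) *ᵥ b = b ⬝ᵥ V⁻¹ *ᵥ b + b ⬝ᵥ (Qᵀ * Q) *ᵥ b := by
    rw [Matrix.add_mulVec, dotProduct_add]
  rw [norm_sq_sub_mulVec, h1]
  linarith

/-- At the ridge minimiser, dropping the penalty leaves at least the least squares minimum. -/
lemma IsResidualContrast.norm_sq_le_marginalPrecision {V : Matrix (Fin m) (Fin m) ℝ}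
    (hV : V.PosDef) {Q : Matrix (Fin n) (Fin m) ℝ} {P : Matrix (Fin n) (Fin k) ℝ}
    (h : IsResidualContrast Q P) (hu : IsUnit (Qᵀ * Q).det) (r : Fin n → ℝ) :
    (Pᵀ *ᵥ r) ⬝ᵥ (Pᵀ *ᵥ r) ≤ r ⬝ᵥ marginalPrecision V Q *ᵥ r := by
  set b := (V⁻¹ + Qᵀ * Q)⁻¹ *ᵥ (Qᵀ *ᵥ r) with hb
  have h1 := marginalPrecision_complete_square hV Q r b
  rw [← hb, sub_self, zero_dotProduct, add_zero, h.norm_sq_sub hu] at h1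
  linarith [quadraticForm_inv_nonneg hV b,
    dotProduct_self_nonneg' (Q *ᵥ (b - leastSquares Q r))]

/-- The ridge criterion is evaluated at the least squares coefficients, where the fit term is
already minimal. -/
lemma IsResidualContrast.marginalPrecision_le {V : Matrix (Fin m) (Fin m) ℝ}
    (hV : V.PosDef) {Q : Matrix (Fin n) (Fin m) ℝ} {P : Matrix (Fin n) (Fin k) ℝ}
    (h : IsResidualContrast Q P) (hu : IsUnit (Qᵀ * Q).det) (r : Fin n → ℝ) :
    r ⬝ᵥ marginalPrecision V Q *ᵥ r ≤ (Pᵀ *ᵥ r) ⬝ᵥ (Pᵀ *ᵥ r) +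
      leastSquares Q r ⬝ᵥ V⁻¹ *ᵥ leastSquares Q r := by
  have h1 := marginalPrecision_complete_square hV Q r (leastSquares Q r)
  rw [h.norm_sq_sub hu, sub_self, Matrix.mulVec_zero, zero_dotProduct, add_zero] at h1
  have h2 : ∀ y : Fin m → ℝ, 0 ≤ y ⬝ᵥ (V⁻¹ + Qᵀ * Q) *ᵥ y := fun y => by
    rw [Matrix.add_mulVec, dotProduct_add, quadraticForm_gram]
    linarith [quadraticForm_inv_nonneg hV y, dotProduct_self_nonneg' (Q *ᵥ y)]
  linarith [h2 (leastSquares Q r - (V⁻¹ + Qᵀ * Q)⁻¹ *ᵥ (Qᵀ *ᵥ r))]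

lemma norm_sq_mulVec_le {ι κ : Type*} [Fintype ι] [Fintype κ] (B : Matrix κ ι ℝ) (u : ι → ℝ) :
    (B *ᵥ u) ⬝ᵥ (B *ᵥ u) ≤ (∑ j, B.col j ⬝ᵥ B.col j) * (u ⬝ᵥ u) := by
  have h : ∀ l, (B *ᵥ u) l * (B *ᵥ u) l ≤ (∑ j, B l j * B l j) * (u ⬝ᵥ u) := fun l => by
    have := Finset.sum_mul_sq_le_sq_mul_sq Finset.univ (fun j => B l j) u
    simpa only [Matrix.mulVec, dotProduct, sq] using this
  calc (B *ᵥ u) ⬝ᵥ (B *ᵥ u) ≤ ∑ l, (∑ j, B l j * B l j) * (u ⬝ᵥ u) :=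
        Finset.sum_le_sum fun l _ => h l
    _ = _ := by
        rw [← Finset.sum_mul, Finset.sum_comm]
        simp [dotProduct, Matrix.col]

/-- Expanding `|b - W b|² ≥ 0` and using the Frobenius bound for `|W b|²` gives the constant. -/
lemma exists_quadraticForm_le {ι : Type*} [Fintype ι] (W : Matrix ι ι ℝ) :
    ∃ w : ℝ, 0 ≤ w ∧ ∀ b : ι → ℝ, b ⬝ᵥ W *ᵥ b ≤ w * (b ⬝ᵥ b) := by
  refine ⟨1 / 2 * (1 + ∑ j, W.col j ⬝ᵥ W.col j), ?_, fun b => ?_⟩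
  · have : 0 ≤ ∑ j, W.col j ⬝ᵥ W.col j := Finset.sum_nonneg fun j _ => dotProduct_self_nonneg' _
    linarith
  · have h1 := dotProduct_self_nonneg' (b - W *ᵥ b)
    have h2 := norm_sq_mulVec_le W b
    rw [sub_dotProduct, dotProduct_sub, dotProduct_sub, dotProduct_comm (W *ᵥ b) b] at h1
    linarith

/-- Cauchy–Schwarz for the form `A` at `y` and `A⁻¹ y` gives `(y · y)² ≤ (yᵀ A y) (yᵀ A⁻¹ y)`, so an
upper bound for `A⁻¹` is a lower bound for `A`. Using `1 + w` keeps the constant invertible. -/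
lemma exists_le_quadraticForm {ι : Type*} [Fintype ι] [DecidableEq ι] {A : Matrix ι ι ℝ}
    (hA : A.IsSymm) (hpos : ∀ u : ι → ℝ, u ≠ 0 → 0 < u ⬝ᵥ A *ᵥ u) :
    ∃ c : ℝ, 0 < c ∧ ∀ b : ι → ℝ, c * (b ⬝ᵥ b) ≤ b ⬝ᵥ A *ᵥ b := by
  obtain ⟨w, hw0, hw⟩ := exists_quadraticForm_le A⁻¹
  have h0 : ∀ u : ι → ℝ, 0 ≤ u ⬝ᵥ A *ᵥ u := fun u => by
    rcases eq_or_ne u 0 with rfl | hu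
    · simp
    · exact (hpos u hu).le
  refine ⟨(1 + w)⁻¹, by positivity, fun y => ?_⟩
  have hcs := quadraticForm_cauchySchwarz hA h0 y (A⁻¹ *ᵥ y)
  rw [Matrix.mulVec_mulVec, Matrix.mul_nonsing_inv _ (isUnit_det_of_quadraticForm_pos hpos),
    Matrix.one_mulVec, dotProduct_comm (A⁻¹ *ᵥ y) y] at hcs
  have hb := hw y
  have hy := dotProduct_self_nonneg' y
  have h1 := h0 y
  rw [inv_mul_le_iff₀ (by positivity)]
  rcases hy.eq_or_lt with h3 | h3
  · rw [← h3]
    positivity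
  · refine le_of_mul_le_mul_right ?_ h3
    nlinarith [mul_le_mul_of_nonneg_left hb h1, mul_nonneg h1 hy]

/-- The difference of the two Gram matrices of the data. -/
noncomputable def gramDiff (V : Matrix (Fin m) (Fin m) ℝ) (Q : Matrix (Fin n) (Fin m) ℝ)
    (P : Matrix (Fin n) (Fin k) ℝ) (X : Matrix (Fin n) (Fin p) ℝ) : Matrix (Fin p) (Fin p) ℝ :=
  Xᵀ * (marginalPrecision V Q - P * Pᵀ) * X

/-- The Gram matrix of the residuals. -/
def residualGram (P : Matrix (Fin n) (Fin k) ℝ) (X : Matrix (Fin n) (Fin p) ℝ) :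
    Matrix (Fin p) (Fin p) ℝ :=
  (Pᵀ * X)ᵀ * (Pᵀ * X)

lemma quadraticForm_residualGram (P : Matrix (Fin n) (Fin k) ℝ) (X : Matrix (Fin n) (Fin p) ℝ)
    (u : Fin p → ℝ) :
    u ⬝ᵥ residualGram P X *ᵥ u = (Pᵀ *ᵥ (X *ᵥ u)) ⬝ᵥ (Pᵀ *ᵥ (X *ᵥ u)) := by
  rw [residualGram, quadraticForm_gram, Matrix.mulVec_mulVec]

lemma quadraticForm_gramDiff (V : Matrix (Fin m) (Fin m) ℝ) (Q : Matrix (Fin n) (Fin m) ℝ)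
    (P : Matrix (Fin n) (Fin k) ℝ) (X : Matrix (Fin n) (Fin p) ℝ) (u : Fin p → ℝ) :
    u ⬝ᵥ gramDiff V Q P X *ᵥ u = (X *ᵥ u) ⬝ᵥ marginalPrecision V Q *ᵥ (X *ᵥ u) -
      (Pᵀ *ᵥ (X *ᵥ u)) ⬝ᵥ (Pᵀ *ᵥ (X *ᵥ u)) := by
  have h := quadraticForm_gram Pᵀ (X *ᵥ u)
  rw [Matrix.transpose_transpose] at h
  rw [gramDiff, ← Matrix.mulVec_mulVec, ← Matrix.mulVec_mulVec, dotProduct_transpose_mulVec,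
    Matrix.sub_mulVec, dotProduct_sub, h]

lemma isSymm_gramDiff {V : Matrix (Fin m) (Fin m) ℝ} (hV : V.PosDef)
    (Q : Matrix (Fin n) (Fin m) ℝ) (P : Matrix (Fin n) (Fin k) ℝ)
    (X : Matrix (Fin n) (Fin p) ℝ) : (gramDiff V Q P X).IsSymm := by
  unfold Matrix.IsSymm gramDiff
  rw [Matrix.transpose_mul, Matrix.transpose_mul, Matrix.transpose_transpose,
    Matrix.transpose_sub, (isSymm_marginalPrecision hV Q).eq, Matrix.transpose_mul,
    Matrix.transpose_transpose, Matrix.mul_assoc]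

lemma IsResidualContrast.quadraticForm_gramDiff_le {V : Matrix (Fin m) (Fin m) ℝ}
    (hV : V.PosDef) {Q : Matrix (Fin n) (Fin m) ℝ} {P : Matrix (Fin n) (Fin k) ℝ}
    (h : IsResidualContrast Q P) (hu : IsUnit (Qᵀ * Q).det) {w : ℝ} (hw0 : 0 ≤ w)
    (hw : ∀ b : Fin m → ℝ, b ⬝ᵥ V⁻¹ *ᵥ b ≤ w * (b ⬝ᵥ b)) (X : Matrix (Fin n) (Fin p) ℝ)
    (u : Fin p → ℝ) :
    u ⬝ᵥ gramDiff V Q P X *ᵥ u ≤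
      w * (∑ j, leastSquares Q (X.col j) ⬝ᵥ leastSquares Q (X.col j)) * (u ⬝ᵥ u) := by
  have h1 := h.marginalPrecision_le hV hu (X *ᵥ u)
  rw [quadraticForm_gramDiff]
  set B : Matrix (Fin m) (Fin p) ℝ := (Qᵀ * Q)⁻¹ * (Qᵀ * X) with hB
  have h2 : leastSquares Q (X *ᵥ u) = B *ᵥ u := by
    rw [leastSquares, hB, ← Matrix.mulVec_mulVec, ← Matrix.mulVec_mulVec]
  have h3 : ∀ j, B.col j = leastSquares Q (X.col j) := fun j => by
    rw [leastSquares, ← Matrix.mulVec_single_one, ← Matrix.mulVec_single_one, hB,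
      ← Matrix.mulVec_mulVec, ← Matrix.mulVec_mulVec]
  have h4 := norm_sq_mulVec_le B u
  simp_rw [h3] at h4
  rw [h2] at h1
  have h5 := (hw (B *ᵥ u)).trans (mul_le_mul_of_nonneg_left h4 hw0)
  rw [mul_assoc]
  linarith

end Contrast

/-! ### The two posterior distributions -/

section Posterior

variable {p m n k : ℕ} (G : Digraph (Fin p))

/-- The inclusion of the coordinates of the parents of `i`. -/
def parentEmb (i : Fin p) : Matrix (Fin p) (Parents G i) ℝ :=
  (1 : Matrix (Fin p) (Fin p) ℝ).submatrix id Subtype.val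

lemma parentData_eq_mul (X : Matrix (Fin n) (Fin p) ℝ) (i : Fin p) :
    parentData G X i = X * parentEmb G i := by
  ext t j
  simp [parentData, parentEmb, Matrix.mul_apply, Matrix.one_apply]

variable [DecidableRel G.Adj]

lemma parentEmb_norm_sq (i : Fin p) (γ : Parents G i → ℝ) :
    (parentEmb G i *ᵥ γ) ⬝ᵥ (parentEmb G i *ᵥ γ) = γ ⬝ᵥ γ := by
  have h : (parentEmb G i)ᵀ * parentEmb G i = 1 := by
    ext j l
    simp [parentEmb, Matrix.mul_apply, Matrix.one_apply, Subtype.ext_iff]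
  rw [← quadraticForm_gram, h, Matrix.one_mulVec]

/-- A node is not its own parent, so the two vectors have disjoint supports. Thus the coefficient
vector of the residual never has length below 1, which keeps the minimal energy of order `L`. -/
lemma single_sub_parentEmb_norm_sq (hG : IsAcyclic G) (i : Fin p) (γ : Parents G i → ℝ) :
    (Pi.single i 1 - parentEmb G i *ᵥ γ) ⬝ᵥ (Pi.single i 1 - parentEmb G i *ᵥ γ) =
      1 + γ ⬝ᵥ γ := by
  have h : (parentEmb G i *ᵥ γ) i = 0 := by
    simp only [Matrix.mulVec, dotProduct]
    refine Finset.sum_eq_zero fun j _ => ?_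
    have : i ≠ (j : Fin p) := fun hij => hG i (Relation.TransGen.single (by
      have := j.2
      rwa [← hij] at this))
    simp [parentEmb, this]
  rw [sub_dotProduct, dotProduct_sub, dotProduct_sub, parentEmb_norm_sq, single_one_dotProduct,
    single_one_dotProduct, dotProduct_single_one, h]
  simp

lemma normalDensity_smul {ι : Type*} [Fintype ι] [DecidableEq ι] {S : Matrix ι ι ℝ}
    (hS : 0 < S.det) : ∃ c : ℝ, 0 < c ∧ ∀ (t : ℝ), 0 < t → ∀ μ x : ι → ℝ,
      normalDensity μ (t • S) x = c * t ^ (-((Fintype.card ι : ℝ) / 2)) *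
        Real.exp (-(1 / 2 * ((x - μ) ⬝ᵥ S⁻¹ *ᵥ (x - μ))) / t) := by
  refine ⟨(√((2 * Real.pi) ^ Fintype.card ι * S.det))⁻¹, by positivity, fun t ht μ x => ?_⟩
  rw [normalDensity, Matrix.det_smul, mul_left_comm, Real.sqrt_mul (by positivity), mul_inv,
    mul_comm (√(t ^ _))⁻¹]
  congr 1
  · congr 1
    rw [Real.sqrt_eq_rpow, ← Real.rpow_natCast, ← Real.rpow_mul ht.le, ← Real.rpow_neg ht.le]
    ring_nf
  · have : (t • S)⁻¹ = t⁻¹ • S⁻¹ := by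
      have h := Matrix.inv_smul' (A := S) (k := Units.mk0 t ht.ne') hS.ne'.isUnit
      exact h
    rw [this, Matrix.smul_mulVec, dotProduct_smul, smul_eq_mul]
    congr 1
    field_simp

/-- The normal factor contributes `ψ ^ (-d / 2)`, which raises `(δ + d) / 2` to `(δ + 2 d) / 2`.
Constants free of the parameters cancel in the posterior and stay unspecified. -/
lemma nodePrior_eq {δ τ : ℝ} (hδ : 0 < δ) (hτ : 0 < τ) (i : Fin p) :
    ∃ c : ℝ, 0 < c ∧ ∀ θ : (Parents G i → ℝ) × ℝ, nodePrior G δ τ i θ =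
      if 0 < θ.2 then c * θ.2 ^ (-((δ + 2 * Fintype.card (Parents G i)) / 2) - 1) *
        Real.exp (-(1 / 2 * (τ + τ * (θ.1 ⬝ᵥ θ.1))) / θ.2) else 0 := by
  obtain ⟨c, hc, h⟩ := normalDensity_smul (ι := Parents G i) (S := 1) (by simp)
  set d : ℝ := (Fintype.card (Parents G i) : ℝ) with hd
  have hd0 : 0 ≤ d := Nat.cast_nonneg _
  have hΓ : 0 < Real.Gamma ((δ + d) / 2) := Real.Gamma_pos_of_pos (by positivity)
  refine ⟨c * τ⁻¹ ^ (-(d / 2)) * ((τ / 2) ^ ((δ + d) / 2) / Real.Gamma ((δ + d) / 2)),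
    by positivity, fun θ => ?_⟩
  by_cases hψ : 0 < θ.2
  · rw [if_pos hψ, nodePrior, invGammaDensity, if_pos hψ, h _ (by positivity), sub_zero, inv_one,
      Matrix.one_mulVec, Real.mul_rpow (by positivity) hψ.le]
    have e1 : θ.2 ^ (-((δ + 2 * d) / 2) - 1) = θ.2 ^ (-(d / 2)) * θ.2 ^ (-((δ + d) / 2) - 1) := by
      rw [← Real.rpow_add hψ]
      ring_nf
    have e2 : Real.exp (-(1 / 2 * (τ + τ * (θ.1 ⬝ᵥ θ.1))) / θ.2) =
        Real.exp (-(1 / 2 * (θ.1 ⬝ᵥ θ.1)) / (τ⁻¹ * θ.2)) * Real.exp (-(τ / 2) / θ.2) := by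
      rw [← Real.exp_add]
      congr 1
      field_simp
      ring
    rw [e1, e2]
    ring
  · rw [if_neg hψ, nodePrior, invGammaDensity, if_neg hψ, mul_zero]

lemma measurable_energy {ι κ : Type*} [Fintype ι] [Fintype κ] (τ : ℝ) (e : κ → ℝ)
    (J : Matrix κ ι ℝ) (A : Matrix κ κ ℝ) : Measurable (energy τ e J A) := by
  refine Continuous.measurable ?_
  unfold energy
  have h : Continuous fun γ : ι → ℝ => e - J *ᵥ γ :=
    continuous_const.sub (continuous_const.matrix_mulVec continuous_id)
  exact continuous_const.mul ((continuous_const.add (continuous_const.mul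
    (continuous_id.dotProduct continuous_id))).add ((continuous_quadraticForm A).comp h))

lemma residual_node_eq {δ τ : ℝ} (hδ : 0 < δ) (hτ : 0 < τ) (P : Matrix (Fin n) (Fin k) ℝ)
    (X : Matrix (Fin n) (Fin p) ℝ) (i : Fin p) :
    ∃ c : ℝ≥0∞, c ≠ 0 ∧ c ≠ ∞ ∧ ∀ θ : (Parents G i → ℝ) × ℝ,
      ENNReal.ofReal (nodePrior G δ τ i θ *
        normalDensity ((Pᵀ * parentData G X i) *ᵥ θ.1) (θ.2 • (1 : Matrix (Fin k) (Fin k) ℝ))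
          (Pᵀ *ᵥ X.col i)) =
      c * nigDensity ((δ + 2 * Fintype.card (Parents G i) + k) / 2)
        (energy τ (Pi.single i 1) (parentEmb G i) (residualGram P X)) θ := by
  obtain ⟨c, hc, h⟩ := nodePrior_eq G hδ hτ i
  obtain ⟨c', hc', h'⟩ := normalDensity_smul (ι := Fin k) (S := 1) (by simp)
  refine ⟨ENNReal.ofReal (c * c'), (ENNReal.ofReal_pos.2 (by positivity)).ne',
    ENNReal.ofReal_ne_top, fun θ => ?_⟩
  rw [h, nigDensity, ← ENNReal.ofReal_mul (by positivity)]
  by_cases hψ : 0 < θ.2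
  · rw [if_pos hψ, if_pos hψ, h' _ hψ, inv_one, Matrix.one_mulVec, Fintype.card_fin]
    have e1 : Pᵀ *ᵥ X.col i - (Pᵀ * parentData G X i) *ᵥ θ.1 =
        Pᵀ *ᵥ (X *ᵥ (Pi.single i 1 - parentEmb G i *ᵥ θ.1)) := by
      rw [parentData_eq_mul, ← Matrix.mulVec_mulVec, ← Matrix.mulVec_mulVec, ← Matrix.mulVec_sub,
        ← Matrix.mulVec_single_one, ← Matrix.mulVec_sub]
    rw [e1, energy, quadraticForm_residualGram]
    set d : ℝ := (Fintype.card (Parents G i) : ℝ)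
    set r := Pᵀ *ᵥ (X *ᵥ (Pi.single i 1 - parentEmb G i *ᵥ θ.1))
    have e2 : θ.2 ^ (-((δ + 2 * d + k) / 2) - 1) =
        θ.2 ^ (-((δ + 2 * d) / 2) - 1) * θ.2 ^ (-((k : ℝ) / 2)) := by
      rw [← Real.rpow_add hψ]
      ring_nf
    have e3 : Real.exp (-(1 / 2 * (τ + τ * (θ.1 ⬝ᵥ θ.1) + r ⬝ᵥ r)) / θ.2) =
        Real.exp (-(1 / 2 * (τ + τ * (θ.1 ⬝ᵥ θ.1))) / θ.2) *
          Real.exp (-(1 / 2 * (r ⬝ᵥ r)) / θ.2) := by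
      rw [← Real.exp_add]
      congr 1
      ring
    rw [e2, e3]
    congr 1
    ring
  · rw [if_neg hψ, if_neg hψ, zero_mul, mul_zero]

/-- The exponent of the joint density of the parameters of a node in the Bayesian approach. -/
noncomputable def jointEnergy (τ : ℝ) (V : Matrix (Fin m) (Fin m) ℝ) (Q : Matrix (Fin n) (Fin m) ℝ)
    (X : Matrix (Fin n) (Fin p) ℝ) (i : Fin p) (z : (Parents G i → ℝ) × (Fin m → ℝ)) : ℝ :=
  1 / 2 * (τ + τ * (z.1 ⬝ᵥ z.1) + (z.2 ⬝ᵥ V⁻¹ *ᵥ z.2 +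
    (X *ᵥ (Pi.single i 1 - parentEmb G i *ᵥ z.1) - Q *ᵥ z.2) ⬝ᵥ
      (X *ᵥ (Pi.single i 1 - parentEmb G i *ᵥ z.1) - Q *ᵥ z.2)))

lemma measurable_jointEnergy (τ : ℝ) (V : Matrix (Fin m) (Fin m) ℝ) (Q : Matrix (Fin n) (Fin m) ℝ)
    (X : Matrix (Fin n) (Fin p) ℝ) (i : Fin p) : Measurable (jointEnergy G τ V Q X i) := by
  refine Continuous.measurable ?_
  unfold jointEnergy
  have h : Continuous fun z : (Parents G i → ℝ) × (Fin m → ℝ) =>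
      X *ᵥ (Pi.single i 1 - parentEmb G i *ᵥ z.1) - Q *ᵥ z.2 :=
    (continuous_const.matrix_mulVec (continuous_const.sub
      (continuous_const.matrix_mulVec continuous_fst))).sub
      (continuous_const.matrix_mulVec continuous_snd)
  exact continuous_const.mul ((continuous_const.add (continuous_const.mul
    (continuous_fst.dotProduct continuous_fst))).add
    (((continuous_quadraticForm V⁻¹).comp continuous_snd).add (h.dotProduct h)))

lemma jointEnergy_eq {V : Matrix (Fin m) (Fin m) ℝ} (hV : V.PosDef) (τ : ℝ)
    (Q : Matrix (Fin n) (Fin m) ℝ) (P : Matrix (Fin n) (Fin k) ℝ) (X : Matrix (Fin n) (Fin p) ℝ)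
    (i : Fin p) (γ : Parents G i → ℝ) (b : Fin m → ℝ) :
    jointEnergy G τ V Q X i (γ, b) =
      energy τ (Pi.single i 1) (parentEmb G i)
        (residualGram P X + (1 : ℝ) • gramDiff V Q P X) γ +
      1 / 2 * ((b - (V⁻¹ + Qᵀ * Q)⁻¹ *ᵥ
          (Qᵀ *ᵥ (X *ᵥ (Pi.single i 1 - parentEmb G i *ᵥ γ)))) ⬝ᵥ
        (V⁻¹ + Qᵀ * Q) *ᵥ (b - (V⁻¹ + Qᵀ * Q)⁻¹ *ᵥ
          (Qᵀ *ᵥ (X *ᵥ (Pi.single i 1 - parentEmb G i *ᵥ γ))))) := by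
  rw [jointEnergy, marginalPrecision_complete_square hV, energy, one_smul,
    Matrix.add_mulVec (residualGram P X), dotProduct_add, quadraticForm_gramDiff, quadraticForm_residualGram]
  ring

/-- The coordinates are regrouped as `((γ, b), ψ)`, so that `b` can be integrated out by
`lintegral_nigDensity_marginal`. The prior of `b` accounts for the extra `m / 2`. -/
lemma bayes_node_eq {δ τ : ℝ} (hδ : 0 < δ) (hτ : 0 < τ) {V : Matrix (Fin m) (Fin m) ℝ}
    (hV : V.PosDef) (Q : Matrix (Fin n) (Fin m) ℝ) (X : Matrix (Fin n) (Fin p) ℝ) (i : Fin p) :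
    ∃ c : ℝ≥0∞, c ≠ 0 ∧ c ≠ ∞ ∧ ∀ θ : ((Parents G i → ℝ) × ℝ) × (Fin m → ℝ),
      ENNReal.ofReal (nodePrior G δ τ i θ.1 * normalDensity 0 (θ.1.2 • V) θ.2 *
        normalDensity (parentData G X i *ᵥ θ.1.1 + Q *ᵥ θ.2)
          (θ.1.2 • (1 : Matrix (Fin n) (Fin n) ℝ)) (X.col i)) =
      c * nigDensity ((δ + 2 * Fintype.card (Parents G i) + n) / 2 + (m : ℝ) / 2)
        (jointEnergy G τ V Q X i) ((θ.1.1, θ.2), θ.1.2) := by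
  obtain ⟨c, hc, h⟩ := nodePrior_eq G hδ hτ i
  obtain ⟨c', hc', h'⟩ := normalDensity_smul (ι := Fin n) (S := 1) (by simp)
  obtain ⟨c₂, hc₂, h₂⟩ := normalDensity_smul hV.det_pos
  refine ⟨ENNReal.ofReal (c * c₂ * c'), (ENNReal.ofReal_pos.2 (by positivity)).ne',
    ENNReal.ofReal_ne_top, ?_⟩
  rintro ⟨⟨γ, ψ⟩, b⟩
  rw [h, nigDensity, ← ENNReal.ofReal_mul (by positivity)]
  by_cases hψ : 0 < ψ
  · simp only [hψ, if_true]
    rw [h' _ hψ, h₂ _ hψ, inv_one, Matrix.one_mulVec, Fintype.card_fin, Fintype.card_fin, sub_zero]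
    have e1 : X.col i - (parentData G X i *ᵥ γ + Q *ᵥ b) =
        X *ᵥ (Pi.single i 1 - parentEmb G i *ᵥ γ) - Q *ᵥ b := by
      rw [parentData_eq_mul, ← Matrix.mulVec_mulVec, ← Matrix.mulVec_single_one,
        Matrix.mulVec_sub, sub_sub]
    rw [e1, jointEnergy]
    simp only
    set d : ℝ := (Fintype.card (Parents G i) : ℝ)
    set r := X *ᵥ (Pi.single i 1 - parentEmb G i *ᵥ γ) - Q *ᵥ b
    have e2 : ψ ^ (-((δ + 2 * d + n) / 2 + (m : ℝ) / 2) - 1) =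
        ψ ^ (-((δ + 2 * d) / 2) - 1) * ψ ^ (-((m : ℝ) / 2)) * ψ ^ (-((n : ℝ) / 2)) := by
      rw [← Real.rpow_add hψ, ← Real.rpow_add hψ]
      ring_nf
    have e3 : Real.exp (-(1 / 2 * (τ + τ * (γ ⬝ᵥ γ) + (b ⬝ᵥ V⁻¹ *ᵥ b + r ⬝ᵥ r))) / ψ) =
        Real.exp (-(1 / 2 * (τ + τ * (γ ⬝ᵥ γ))) / ψ) *
          Real.exp (-(1 / 2 * (b ⬝ᵥ V⁻¹ *ᵥ b)) / ψ) * Real.exp (-(1 / 2 * (r ⬝ᵥ r)) / ψ) := by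
      rw [← Real.exp_add, ← Real.exp_add]
      congr 1
      ring
    rw [e2, e3]
    congr 1
    ring
  · simp [hψ]

lemma measurable_covMatrix : Measurable (covMatrix G) := by
  have hentry : ∀ i j, Measurable fun θ : Params G => (1 - coefMatrix G θ) i j := fun i j => by
    simp only [Matrix.sub_apply, coefMatrix, Matrix.of_apply]
    by_cases h : G.Adj j i
    · simp only [h, dif_pos]
      exact measurable_const.sub
        ((measurable_pi_apply _).comp (measurable_fst.comp (measurable_pi_apply i)))
    · simp [h]
  have hdet : ∀ M : Params G → Matrix (Fin p) (Fin p) ℝ, (∀ i j, Measurable fun θ => M θ i j) →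
      Measurable fun θ => (M θ).det := fun M hM => by
    simp only [Matrix.det_apply']
    exact Finset.measurable_sum _ fun σ _ => measurable_const.mul
      (Finset.measurable_prod _ fun i _ => hM _ _)
  have hinv : ∀ i j, Measurable fun θ : Params G => (1 - coefMatrix G θ)⁻¹ i j := fun i j => by
    simp only [Matrix.inv_def, Ring.inverse_eq_inv', Matrix.smul_apply, smul_eq_mul,
      Matrix.adjugate_apply]
    refine (hdet _ hentry).inv.mul (hdet _ fun a b => ?_)
    by_cases h : a = j
    · subst h
      simp
    · simpa [Matrix.updateRow_apply, h] using hentry a b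
  refine measurable_pi_iff.2 fun i => measurable_pi_iff.2 fun j => ?_
  simp only [covMatrix, Matrix.mul_apply, Matrix.diagonal_apply, Matrix.transpose_apply]
  refine Finset.measurable_sum _ fun l _ => (Finset.measurable_sum _ fun l' _ =>
    (hinv _ _).mul ?_).mul (hinv _ _)
  by_cases h : l' = l
  · simp only [h, if_true]
    exact measurable_snd.comp (measurable_pi_apply _)
  · simp [h]

end Posterior

/-! ### Convergence for a given sequence of data matrices -/

section Deterministic

variable {p m n k : ℕ} (G : Digraph (Fin p)) [DecidableRel G.Adj]

lemma residualGram_nonneg (P : Matrix (Fin n) (Fin k) ℝ) (X : Matrix (Fin n) (Fin p) ℝ)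
    (u : Fin p → ℝ) : 0 ≤ u ⬝ᵥ residualGram P X *ᵥ u := by
  rw [quadraticForm_residualGram]
  exact dotProduct_self_nonneg' _

lemma residualPosteriorCov_eq {δ τ : ℝ} (hδ : 0 < δ) (hτ : 0 < τ) (P : Matrix (Fin n) (Fin k) ℝ)
    (X : Matrix (Fin n) (Fin p) ℝ) :
    residualPosteriorCov G δ τ P X =
      (Measure.pi fun i => normalizedDensity
        (nigDensity ((δ + 2 * Fintype.card (Parents G i) + k) / 2)
          (energy τ (Pi.single i 1) (parentEmb G i) (residualGram P X)))).map (covMatrix G) := by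
  choose c c0 c1 hc using residual_node_eq G hδ hτ P X
  have hm : ∀ i, Measurable (nigDensity ((δ + 2 * Fintype.card (Parents G i) + k) / 2)
      (energy τ (Pi.single i 1) (parentEmb G i) (residualGram P X))) := fun i =>
    measurable_nigDensity _ (measurable_energy _ _ _ _)
  have hne : ∀ i, _ := fun i => lintegral_nigDensity_energy_ne hτ (Pi.single i 1) (parentEmb G i)
    (isSymm_gram (Pᵀ * X)) (residualGram_nonneg P X)
    (α := (δ + 2 * Fintype.card (Parents G i) + k) / 2) (by
      have h1 : (0 : ℝ) ≤ k := Nat.cast_nonneg _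
      have h2 : (0 : ℝ) ≤ Fintype.card (Parents G i) := Nat.cast_nonneg _
      linarith)
  rw [residualPosteriorCov, posterior_eq_pi (h := fun i θ => c i *
    nigDensity ((δ + 2 * Fintype.card (Parents G i) + k) / 2)
      (energy τ (Pi.single i 1) (parentEmb G i) (residualGram P X)) θ)
    (fun i => (hm i).const_mul _)]
  · congr 2
    funext i
    exact normalizedDensity_const_mul (hm i) (c0 i) (c1 i)
  · intro θ
    rw [residualPrior, residualLikelihood, ← Finset.prod_mul_distrib, ENNReal.ofReal_prod_of_nonneg]
    · exact Finset.prod_congr rfl fun i _ => hc i (θ i)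
    · intro i _
      obtain ⟨c, hc0, hcθ⟩ := nodePrior_eq G hδ hτ i
      refine mul_nonneg ?_ (by unfold normalDensity; positivity)
      rw [hcθ]
      split_ifs <;> positivity
  · intro i
    rw [lintegral_const_mul _ (hm i)]
    exact mul_ne_zero (c0 i) (hne i).1
  · intro i
    rw [lintegral_const_mul _ (hm i)]
    exact ENNReal.mul_ne_top (c1 i) (hne i).2

lemma gramDiff_nonneg {V : Matrix (Fin m) (Fin m) ℝ} (hV : V.PosDef)
    {Q : Matrix (Fin n) (Fin m) ℝ} {P : Matrix (Fin n) (Fin k) ℝ} (h : IsResidualContrast Q P)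
    (hu : IsUnit (Qᵀ * Q).det) (X : Matrix (Fin n) (Fin p) ℝ) (u : Fin p → ℝ) :
    0 ≤ u ⬝ᵥ gramDiff V Q P X *ᵥ u := by
  rw [quadraticForm_gramDiff]
  linarith [h.norm_sq_le_marginalPrecision hV hu (X *ᵥ u)]

/-- `Σ` ignores `b`, so the push-forward factors through the projection that forgets it. In each
node this projection only multiplies the density by the constant mass of `V⁻¹ + Qᵀ Q`. -/
lemma bayesPosteriorCov_eq {δ τ : ℝ} (hδ : 0 < δ) (hτ : 0 < τ) {V : Matrix (Fin m) (Fin m) ℝ}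
    (hV : V.PosDef) {Q : Matrix (Fin n) (Fin m) ℝ} {P : Matrix (Fin n) (Fin k) ℝ}
    (h : IsResidualContrast Q P) (hu : IsUnit (Qᵀ * Q).det) (X : Matrix (Fin n) (Fin p) ℝ) :
    bayesPosteriorCov G δ τ V Q X =
      (Measure.pi fun i => normalizedDensity
        (nigDensity ((δ + 2 * Fintype.card (Parents G i) + n) / 2)
          (energy τ (Pi.single i 1) (parentEmb G i)
            (residualGram P X + (1 : ℝ) • gramDiff V Q P X)))).map (covMatrix G) := by
  choose c c0 c1 hc using bayes_node_eq G hδ hτ hV Q X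
  set J : (i : Fin p) → ((Parents G i → ℝ) × ℝ) × (Fin m → ℝ) → ℝ≥0∞ := fun i θ =>
    nigDensity ((δ + 2 * Fintype.card (Parents G i) + n) / 2 + (m : ℝ) / 2)
        (jointEnergy G τ V Q X i) ((θ.1.1, θ.2), θ.1.2) with hJ
  set N : (i : Fin p) → (Parents G i → ℝ) × ℝ → ℝ≥0∞ := fun i =>
    nigDensity ((δ + 2 * Fintype.card (Parents G i) + n) / 2)
      (energy τ (Pi.single i 1) (parentEmb G i)
        (residualGram P X + (1 : ℝ) • gramDiff V Q P X)) with hN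
  set K := gaussMass (V⁻¹ + Qᵀ * Q) with hK
  have hK0 : K ≠ 0 := gaussMass_ne_zero _
  have hmJ : ∀ i, Measurable (J i) := fun i =>
    (measurable_nigDensity _ (measurable_jointEnergy G τ V Q X i)).comp (by fun_prop)
  have hmN : ∀ i, Measurable (N i) := fun i =>
    measurable_nigDensity _ (measurable_energy _ _ _ _)
  have hne : ∀ i, _ := fun i => lintegral_nigDensity_energy_ne hτ (Pi.single i 1) (parentEmb G i)
    (G := residualGram P X + (1 : ℝ) • gramDiff V Q P X)
    ((isSymm_gram (Pᵀ * X)).add ((isSymm_gramDiff hV Q P X).smul 1)) (fun u => by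
      rw [one_smul, Matrix.add_mulVec, dotProduct_add]
      exact add_nonneg (residualGram_nonneg P X u) (gramDiff_nonneg hV h hu X u))
    (α := (δ + 2 * Fintype.card (Parents G i) + n) / 2) (by
      have h1 : (0 : ℝ) ≤ n := Nat.cast_nonneg _
      have h2 : (0 : ℝ) ≤ Fintype.card (Parents G i) := Nat.cast_nonneg _
      linarith)
  have hmarg : ∀ i (θ : (Parents G i → ℝ) × ℝ), ∫⁻ b, J i (θ, b) = K * N i θ := fun i θ => by
    have := lintegral_nigDensity_marginal
      (α := (δ + 2 * Fintype.card (Parents G i) + n) / 2 + (m : ℝ) / 2)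
      (fun γ b => jointEnergy_eq G hV τ Q P X i γ b) θ
    rw [Fintype.card_fin, add_sub_cancel_right] at this
    exact this
  have hK1 : K ≠ ∞ := by
    obtain ⟨c, hc, hcV⟩ := exists_le_quadraticForm (isSymm_of_posDef hV.inv) fun u hu => by
      simpa using hV.inv.dotProduct_mulVec_pos hu
    refine gaussMass_ne_top hc fun y => ?_
    rw [Matrix.add_mulVec, dotProduct_add, quadraticForm_gram]
    linarith [hcV y, dotProduct_self_nonneg' (Q *ᵥ y)]
  have hJint : ∀ i, ∫⁻ θ, J i θ = K * ∫⁻ θ, N i θ := fun i => by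
    rw [Measure.volume_eq_prod, lintegral_prod _ (hmJ i).aemeasurable]
    simp_rw [hmarg]
    rw [lintegral_const_mul _ (hmN i)]
  have hpost : posterior (bayesPrior G δ τ V) (bayesLikelihood G Q X) =
      Measure.pi fun i => normalizedDensity (J i) := by
    rw [posterior_eq_pi (h := fun i θ => c i * J i θ) (fun i => (hmJ i).const_mul _)]
    · congr 1
      funext i
      exact normalizedDensity_const_mul (hmJ i) (c0 i) (c1 i)
    · intro θ
      rw [bayesPrior, bayesLikelihood, ← Finset.prod_mul_distrib, ENNReal.ofReal_prod_of_nonneg]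
      · exact Finset.prod_congr rfl fun i _ => hc i (θ i)
      · intro i _
        obtain ⟨c, hc0, hcθ⟩ := nodePrior_eq G hδ hτ i
        refine mul_nonneg (mul_nonneg ?_ (by unfold normalDensity; positivity))
          (by unfold normalDensity; positivity)
        rw [hcθ]
        split_ifs <;> positivity
    · intro i
      rw [lintegral_const_mul _ (hmJ i), hJint]
      exact mul_ne_zero (c0 i) (mul_ne_zero hK0 (hne i).1)
    · intro i
      rw [lintegral_const_mul _ (hmJ i), hJint]
      exact ENNReal.mul_ne_top (c1 i) (ENNReal.mul_ne_top hK1 (hne i).2)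
  have hmap : ∀ i, (normalizedDensity (J i)).map Prod.fst = normalizedDensity (N i) := fun i => by
    rw [map_fst_normalizedDensity (hmJ i)]
    simp_rw [hmarg]
    exact normalizedDensity_const_mul (hmN i) hK0 hK1
  have hprob : ∀ i, IsProbabilityMeasure ((normalizedDensity (J i)).map Prod.fst) := fun i => by
    rw [hmap]
    exact isProbabilityMeasure_normalizedDensity (hne i).1 (hne i).2
  have hfst : Measurable fun (θ : FullParams G m) i => (θ i).1 := by fun_prop
  have : (fun θ : FullParams G m => covMatrix G fun i => (θ i).1) =
      covMatrix G ∘ fun θ i => (θ i).1 := rfl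
  rw [bayesPosteriorCov, this, ← Measure.map_map (measurable_covMatrix G) hfst, hpost,
    Measure.pi_map_pi fun i => measurable_fst.aemeasurable]
  simp_rw [hmap, hN]

/-- The bound for the chi-squared integral of a node. -/
noncomputable def nodeBound (τ L U lam a s d : ℝ) : ℝ :=
  (1 + lam / L) ^ (d / 2) * ((a + 2 * s) / (a - 1)) ^ s *
    Real.exp (a * (lam ^ 2 / L ^ 2 * (16 * ((τ + U) / L) + ((τ + U) / L) ^ 2)))

lemma covDivergence_add_one_le (hG : IsAcyclic G) {δ τ : ℝ} (hδ : 0 < δ) (hτ : 0 < τ)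
    {V : Matrix (Fin m) (Fin m) ℝ} (hV : V.PosDef) {Q : Matrix (Fin n) (Fin m) ℝ}
    {P : Matrix (Fin n) (Fin (n - m)) ℝ} (h : IsResidualContrast Q P) (hmn : m ≤ n)
    (hn : 2 ≤ n - m) {X : Matrix (Fin n) (Fin p) ℝ} {L U lam w : ℝ} (hL : 0 < L)
    (hGL : ∀ u : Fin p → ℝ, L * (u ⬝ᵥ u) ≤ (Pᵀ *ᵥ (X *ᵥ u)) ⬝ᵥ (Pᵀ *ᵥ (X *ᵥ u)))
    (hGU : ∀ i, (Pᵀ *ᵥ X.col i) ⬝ᵥ (Pᵀ *ᵥ X.col i) ≤ U) (hw0 : 0 ≤ w)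
    (hw : ∀ b : Fin m → ℝ, b ⬝ᵥ V⁻¹ *ᵥ b ≤ w * (b ⬝ᵥ b))
    (hlam : ∑ j, leastSquares Q (X.col j) ⬝ᵥ leastSquares Q (X.col j) ≤ lam) :
    covDivergence G δ τ V Q P X + 1 ≤ ∏ i, ENNReal.ofReal (nodeBound τ L U (w * lam)
      ((δ + Fintype.card (Parents G i) + (n - m : ℕ)) / 2) (m / 2)
      (Fintype.card (Parents G i))) := by
  have hu := h.isUnit_det hmn
  have hlam0 : 0 ≤ lam := (Finset.sum_nonneg fun j _ => dotProduct_self_nonneg' _).trans hlam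
  have hE := isSymm_gramDiff hV Q P X
  have hGs : (residualGram P X).IsSymm := isSymm_gram (Pᵀ * X)
  have hE0 := gramDiff_nonneg hV h hu X
  have hE1 : ∀ u : Fin p → ℝ, u ⬝ᵥ gramDiff V Q P X *ᵥ u ≤ w * lam * (u ⬝ᵥ u) := fun u =>
    (h.quadraticForm_gramDiff_le hV hu hw0 hw X u).trans <|
      mul_le_mul_of_nonneg_right (mul_le_mul_of_nonneg_left hlam hw0) (dotProduct_self_nonneg' u)
  have hGL' : ∀ u : Fin p → ℝ, L * (u ⬝ᵥ u) ≤ u ⬝ᵥ residualGram P X *ᵥ u := fun u => by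
    rw [quadraticForm_residualGram]; exact hGL u
  have hGt0 : ∀ u : Fin p → ℝ, 0 ≤ u ⬝ᵥ (residualGram P X + (1 : ℝ) • gramDiff V Q P X) *ᵥ u :=
    fun u => by
      rw [one_smul, Matrix.add_mulVec, dotProduct_add]
      exact add_nonneg (residualGram_nonneg P X u) (hE0 u)
  have hnm : (2 : ℝ) ≤ (n - m : ℕ) := by exact_mod_cast hn
  have hcast : ((n - m : ℕ) : ℝ) = n - m := by push_cast [hmn]; ring
  set d : Fin p → ℝ := fun i => (Fintype.card (Parents G i) : ℝ) with hd
  have hd0 : ∀ i, 0 ≤ d i := fun i => Nat.cast_nonneg _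
  set a : Fin p → ℝ := fun i => (δ + d i + (n - m : ℕ)) / 2 with ha
  -- At least two residual degrees of freedom and `δ > 0` give `a > 1`, as the Gamma estimate needs
  -- `a - 1 > 0`.
  have ha1 : ∀ i, 1 < a i := fun i => by simp only [ha]; linarith [hd0 i]
  have hs : (0 : ℝ) ≤ m / 2 := by positivity
  set e : Fin p → Fin p → ℝ := fun i => Pi.single i 1
  set HR := fun i => energy τ (e i) (parentEmb G i) (residualGram P X) with hHR
  set HB := fun i => energy τ (e i) (parentEmb G i)
    (residualGram P X + (1 : ℝ) • gramDiff V Q P X) with hHB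
  set H2 := fun i => energy τ (e i) (parentEmb G i)
    (residualGram P X + (2 : ℝ) • gramDiff V Q P X) with hH2
  set f := fun i => nigDensity (a i + m / 2 + d i / 2) (HB i) with hf
  set g := fun i => nigDensity (a i + d i / 2) (HR i) with hg
  set κ := fun i => nigDensity (a i + 2 * (m / 2) + d i / 2) (H2 i) with hκ
  have hgne : ∀ i, _ := fun i => lintegral_nigDensity_energy_ne hτ (e i) (parentEmb G i)
    hGs (residualGram_nonneg P X) (α := a i + d i / 2) (by
      rw [add_sub_cancel_right]; linarith [ha1 i])
  have hfne : ∀ i, _ := fun i => lintegral_nigDensity_energy_ne hτ (e i) (parentEmb G i)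
    (hGs.add (hE.smul 1)) hGt0 (α := a i + m / 2 + d i / 2) (by
      rw [add_sub_cancel_right]; linarith [ha1 i])
  have hfm : ∀ i, Measurable (f i) := fun i => measurable_nigDensity _ (measurable_energy _ _ _ _)
  have hgm : ∀ i, Measurable (g i) := fun i => measurable_nigDensity _ (measurable_energy _ _ _ _)
  have hκm : ∀ i, Measurable (κ i) := fun i => measurable_nigDensity _ (measurable_energy _ _ _ _)
  have hg0 : ∀ i θ, g i θ = 0 → ¬ 0 < θ.2 := fun i θ h0 hψ => by
    simp only [hg, nigDensity, hψ, if_true] at h0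
    exact (ENNReal.ofReal_pos.2 (by positivity)).ne' h0
  -- The Gram matrices `G`, `G + E`, `G + 2E` are equally spaced, so the energies are too. The
  -- exponents `α`, `α + m / 2`, `α + m` match in the same way, whence `κ * g = f²`.
  have hH : ∀ i γ, H2 i γ + HR i γ = HB i γ + HB i γ := fun i γ => by
    simp only [hH2, hHR, hHB, energy_add_smul]
    ring
  have hex := fun i => exists_withDensity_normalizedDensity (hfm i) (hgm i) (hκm i)
    (fun θ h0 => by simp [hf, nigDensity, hg0 i θ h0])
    (fun θ => ENNReal.ofReal_ne_top)
    (fun θ => by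
      simp only [hκ, hg, hf, nigDensity]
      by_cases hψ : 0 < θ.2
      · simp only [hψ, if_true]
        rw [← ENNReal.ofReal_mul (by positivity), ← ENNReal.ofReal_pow (by positivity)]
        congr 1
        rw [mul_mul_mul_comm, ← Real.rpow_add hψ, ← Real.exp_add, mul_pow, sq, sq,
          ← Real.rpow_add hψ, ← Real.exp_add, ← add_div, ← add_div, ← neg_add, hH]
        congr 2
        · ring
        · ring
      · simp [hψ])
    (fun θ h0 => by simp [hκ, nigDensity, hg0 i θ h0]) (hgne i).1 (hgne i).2
  choose r hrm hr hr2 using hex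
  have hν : ∀ i, IsProbabilityMeasure (normalizedDensity (g i)) := fun i =>
    isProbabilityMeasure_normalizedDensity (hgne i).1 (hgne i).2
  have hμ : ∀ i, IsProbabilityMeasure ((normalizedDensity (g i)).withDensity (r i)) := fun i => by
    rw [← hr i]
    exact isProbabilityMeasure_normalizedDensity (hfne i).1 (hfne i).2
  have hBeq : bayesPosteriorCov G δ τ V Q X =
      (Measure.pi fun i => (normalizedDensity (g i)).withDensity (r i)).map (covMatrix G) := by
    rw [bayesPosteriorCov_eq G hδ hτ hV h hu X]
    simp_rw [← hr]
    congr 3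
    funext i
    simp only [hf, hHB, e]
    congr 2
    simp only [ha, hd, hcast]
    ring
  have hReq : residualPosteriorCov G δ τ P X =
      (Measure.pi fun i => normalizedDensity (g i)).map (covMatrix G) := by
    rw [residualPosteriorCov_eq G hδ hτ P X]
    congr 3
    funext i
    simp only [hg, hHR, e]
    congr 2
    simp only [ha, hd]
    ring
  rw [covDivergence, hBeq, hReq]
  -- Data processing needs only that the map to `Σ` is measurable.
  refine (add_le_add_left (InformationTheory.klDiv_map_le _ _ (measurable_covMatrix G)) 1).trans ?_
  refine (klDiv_pi_add_one_le (fun i => normalizedDensity (g i)) hrm).trans ?_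
  refine Finset.prod_le_prod' fun i _ => ?_
  rw [hr2]
  exact chiSq_node_le hτ (single_sub_parentEmb_norm_sq G hG i) (parentEmb_norm_sq G i) hGs hE hL
    hGL' (by
      rw [quadraticForm_residualGram, Matrix.mulVec_single_one]
      exact hGU i) hE0 hE1 (mul_nonneg hw0 hlam0) (ha1 i) hs

/-- With `L` and `U` of order `n` and `a ~ n / 2`, the exponent is of order `n * (lam / n)² = (lam /
√n)²`. The other two factors have bases tending to 1 and fixed powers. -/
lemma tendsto_nodeBound {τ c C w : ℝ} (hc : 0 < c) (δ : ℝ) (m : ℕ) (d : ℝ) {lam : ℕ → ℝ}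
    (hlam : Tendsto (fun n : ℕ => lam n / √n) atTop (𝓝 0)) :
    Tendsto (fun n : ℕ => nodeBound τ (c * n) (C * n) (w * lam n)
      ((δ + d + (n - m : ℕ)) / 2) (m / 2) d) atTop (𝓝 1) := by
  have hn : Tendsto (fun n : ℕ => (n : ℝ)) atTop atTop := tendsto_natCast_atTop_atTop
  have hinv : Tendsto (fun n : ℕ => (n : ℝ)⁻¹) atTop (𝓝 0) := tendsto_inv_atTop_zero.comp hn
  have hsq : Tendsto (fun n : ℕ => (√(n : ℝ))⁻¹) atTop (𝓝 0) :=
    tendsto_inv_atTop_zero.comp (Real.tendsto_sqrt_atTop.comp hn)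
  have hev : ∀ᶠ n : ℕ in atTop, 0 < (n : ℝ) := hn.eventually_gt_atTop 0
  have h1 : Tendsto (fun n : ℕ => w * lam n / (c * n)) atTop (𝓝 0) := by
    have : Tendsto (fun n : ℕ => w / c * (lam n / √n * (√(n : ℝ))⁻¹)) atTop (𝓝 0) := by
      simpa using (hlam.mul hsq).const_mul (w / c)
    refine this.congr' ?_
    filter_upwards [hev] with n hn
    have h2 : √(n : ℝ) * √(n : ℝ) = n := Real.mul_self_sqrt hn.le
    have h3 : 0 < √(n : ℝ) := Real.sqrt_pos.2 hn
    conv_rhs => rw [← h2]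
    field_simp
  have hκ : Tendsto (fun n : ℕ => (τ + C * n) / (c * n)) atTop (𝓝 (C / c)) := by
    have : Tendsto (fun n : ℕ => τ / c * (n : ℝ)⁻¹ + C / c) atTop (𝓝 (τ / c * 0 + C / c)) :=
      (hinv.const_mul _).add_const _
    rw [mul_zero, zero_add] at this
    refine this.congr' ?_
    filter_upwards [hev] with n hn
    field_simp
  have ha : Tendsto (fun n : ℕ => (δ + d + (n - m : ℕ)) / 2 * (n : ℝ)⁻¹) atTop (𝓝 (1 / 2)) := by
    have : Tendsto (fun n : ℕ => (δ + d - m) / 2 * (n : ℝ)⁻¹ + 1 / 2) atTop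
        (𝓝 ((δ + d - m) / 2 * 0 + 1 / 2)) := (hinv.const_mul _).add_const _
    rw [mul_zero, zero_add] at this
    refine this.congr' ?_
    filter_upwards [hev, eventually_ge_atTop m] with n hn hm
    rw [Nat.cast_sub hm]
    field_simp
    ring
  have hatop : Tendsto (fun n : ℕ => (δ + d + (n - m : ℕ)) / 2) atTop atTop := by
    have : Tendsto (fun n : ℕ => ((n - m : ℕ) : ℝ)) atTop atTop :=
      hn.comp (tendsto_sub_atTop_nat m)
    exact (tendsto_atTop_add_const_left _ _ this).atTop_div_const two_pos
  have hA : Tendsto (fun n : ℕ => (1 + w * lam n / (c * n)) ^ (d / 2)) atTop (𝓝 1) := by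
    have := (h1.const_add 1).rpow_const (p := d / 2) (Or.inl (by norm_num))
    simpa using this
  have hB : Tendsto (fun n : ℕ => (((δ + d + (n - m : ℕ)) / 2 + 2 * ((m : ℝ) / 2)) /
      ((δ + d + (n - m : ℕ)) / 2 - 1)) ^ ((m : ℝ) / 2)) atTop (𝓝 1) := by
    have hr : Tendsto (fun x : ℝ => (x + 2 * ((m : ℝ) / 2)) / (x - 1)) atTop (𝓝 1) := by
      have h2 : Tendsto (fun x : ℝ => 1 + (2 * ((m : ℝ) / 2) + 1) * (x - 1)⁻¹) atTop
          (𝓝 (1 + (2 * ((m : ℝ) / 2) + 1) * 0)) :=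
        ((tendsto_inv_atTop_zero.comp
          (tendsto_atTop_add_const_right _ (-1) tendsto_id)).const_mul _).const_add _
      rw [mul_zero, add_zero] at h2
      refine h2.congr' ?_
      filter_upwards [eventually_gt_atTop 1] with x hx
      have : x - 1 ≠ 0 := by linarith
      field_simp
      ring
    have := (hr.comp hatop).rpow_const (p := (m : ℝ) / 2) (Or.inl one_ne_zero)
    simpa using this
  have hE : Tendsto (fun n : ℕ => (δ + d + (n - m : ℕ)) / 2 * ((w * lam n) ^ 2 / (c * n) ^ 2 *
      (16 * ((τ + C * n) / (c * n)) + ((τ + C * n) / (c * n)) ^ 2))) atTop (𝓝 0) := by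
    have h2 : Tendsto (fun n : ℕ => ((δ + d + (n - m : ℕ)) / 2 * (n : ℝ)⁻¹) *
        ((w / c) ^ 2 * (lam n / √n) ^ 2 *
        (16 * ((τ + C * n) / (c * n)) + ((τ + C * n) / (c * n)) ^ 2))) atTop
        (𝓝 (1 / 2 * ((w / c) ^ 2 * 0 ^ 2 * (16 * (C / c) + (C / c) ^ 2)))) :=
      ha.mul (((hlam.pow 2).const_mul _).mul ((hκ.const_mul 16).add (hκ.pow 2)))
    have h3 : 1 / 2 * ((w / c) ^ 2 * 0 ^ 2 * (16 * (C / c) + (C / c) ^ 2)) = 0 := by ring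
    rw [h3] at h2
    refine h2.congr' ?_
    filter_upwards [hev] with n hn
    rw [div_pow (lam n), Real.sq_sqrt hn.le]
    field_simp
  have hE' := (Real.continuous_exp.tendsto 0).comp hE
  rw [Real.exp_zero] at hE'
  have := (hA.mul hB).mul hE'
  simpa only [mul_one, nodeBound, Function.comp_apply] using this

theorem tendsto_covDivergence (hG : IsAcyclic G) {δ τ : ℝ} (hδ : 0 < δ) (hτ : 0 < τ)
    {V : Matrix (Fin m) (Fin m) ℝ} (hV : V.PosDef) {Q : (n : ℕ) → Matrix (Fin n) (Fin m) ℝ}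
    {X : (n : ℕ) → Matrix (Fin n) (Fin p) ℝ} {P : (n : ℕ) → Matrix (Fin n) (Fin (n - m)) ℝ}
    {c C : ℝ} {lam : ℕ → ℝ} (hc : 0 < c)
    (hP : ∀ᶠ n in atTop, IsResidualContrast (Q n) (P n))
    (hlow : ∀ᶠ n : ℕ in atTop, ∀ u : Fin p → ℝ,
      c * n * (u ⬝ᵥ u) ≤ ((P n)ᵀ *ᵥ (X n *ᵥ u)) ⬝ᵥ ((P n)ᵀ *ᵥ (X n *ᵥ u)))
    (hup : ∀ᶠ n : ℕ in atTop, ∀ i,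
      ((P n)ᵀ *ᵥ (X n).col i) ⬝ᵥ ((P n)ᵀ *ᵥ (X n).col i) ≤ C * n)
    (hls : ∀ᶠ n : ℕ in atTop,
      ∑ j, leastSquares (Q n) ((X n).col j) ⬝ᵥ leastSquares (Q n) ((X n).col j) ≤ lam n)
    (hlam : Tendsto (fun n : ℕ => lam n / √n) atTop (𝓝 0)) :
    Tendsto (fun n => covDivergence G δ τ V (Q n) (P n) (X n)) atTop (𝓝 0) := by
  obtain ⟨w, hw0, hw⟩ := exists_quadraticForm_le V⁻¹
  have hbound : Tendsto (fun n : ℕ => (∏ i, ENNReal.ofReal (nodeBound τ (c * n) (C * n)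
      (w * lam n) ((δ + Fintype.card (Parents G i) + (n - m : ℕ)) / 2) (m / 2)
      (Fintype.card (Parents G i)))) - 1) atTop (𝓝 0) := by
    have h1 : Tendsto (fun n : ℕ => ∏ i, ENNReal.ofReal (nodeBound τ (c * n) (C * n)
        (w * lam n) ((δ + Fintype.card (Parents G i) + (n - m : ℕ)) / 2) (m / 2)
        (Fintype.card (Parents G i)))) atTop (𝓝 (∏ _i : Fin p, ENNReal.ofReal 1)) := by
      -- The limit of the product is taken in `ℝ`. Truncating at 0 makes the factors nonnegative and
      -- is invisible to `ENNReal.ofReal`.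
      have h4 := fun n : ℕ => ENNReal.ofReal_prod_of_nonneg (s := Finset.univ)
        (f := fun i => max 0 (nodeBound τ (c * n) (C * n)
          (w * lam n) ((δ + Fintype.card (Parents G i) + (n - m : ℕ)) / 2) (m / 2)
          (Fintype.card (Parents G i)))) fun i _ => le_max_left _ _
      have h5 : Tendsto (fun n : ℕ => ENNReal.ofReal (∏ i, max 0 (nodeBound τ (c * n) (C * n)
          (w * lam n) ((δ + Fintype.card (Parents G i) + (n - m : ℕ)) / 2) (m / 2)
          (Fintype.card (Parents G i))))) atTop
          (𝓝 (ENNReal.ofReal (∏ _i : Fin p, max 0 1))) :=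
        ENNReal.tendsto_ofReal (tendsto_finsetProd _ fun i _ =>
          tendsto_const_nhds.max (tendsto_nodeBound hc δ m _ hlam))
      simp only [h4] at h5
      simpa using h5
    have h2 := ENNReal.Tendsto.sub h1 (tendsto_const_nhds (x := (1 : ℝ≥0∞)))
      (Or.inr ENNReal.one_ne_top)
    simpa using h2
  refine tendsto_of_tendsto_of_tendsto_of_le_of_le' tendsto_const_nhds hbound
    (Eventually.of_forall fun _ => zero_le) ?_
  filter_upwards [hP, hlow, hup, hls, eventually_ge_atTop (m + 2), eventually_gt_atTop 0]
    with n hP hlow hup hls hn hn0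
  refine ENNReal.le_sub_of_add_le_right ENNReal.one_ne_top ?_
  exact covDivergence_add_one_le G hG hδ hτ hV hP (by omega) (by omega)
    (mul_pos hc (Nat.cast_pos.2 hn0)) hlow hup hw0 hw hls

end Deterministic

/-! ### Data that are asymptotically not collinear -/

section GivenData

variable {p m : ℕ} (G : Digraph (Fin p)) [DecidableRel G.Adj]

theorem tendsto_covDivergence_of_not_collinear (hG : IsAcyclic G) {δ τ : ℝ} (hδ : 0 < δ)
    (hτ : 0 < τ) {V : Matrix (Fin m) (Fin m) ℝ} (hV : V.PosDef)
    {Q : (n : ℕ) → Matrix (Fin n) (Fin m) ℝ} {X : (n : ℕ) → Matrix (Fin n) (Fin p) ℝ}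
    {P : (n : ℕ) → Matrix (Fin n) (Fin (n - m)) ℝ} {c C : ℝ} (hc : 0 < c)
    (hP : ∀ᶠ n in atTop, IsResidualContrast (Q n) (P n))
    (hC : ∀ᶠ n : ℕ in atTop, ∀ i, (X n).col i ⬝ᵥ (X n).col i ≤ C * n)
    (hcol : ∀ᶠ n : ℕ in atTop, ∀ (u : Fin p → ℝ) (v : Fin m → ℝ),
      c * n * (u ⬝ᵥ u + v ⬝ᵥ v) ≤ (X n *ᵥ u + Q n *ᵥ v) ⬝ᵥ (X n *ᵥ u + Q n *ᵥ v)) :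
    Tendsto (fun n => covDivergence G δ τ V (Q n) (P n) (X n)) atTop (𝓝 0) := by
  have hlam : Tendsto (fun n : ℕ => (∑ _j : Fin p, C / c) / √n) atTop (𝓝 0) :=
    tendsto_const_nhds.div_atTop (Real.tendsto_sqrt_atTop.comp tendsto_natCast_atTop_atTop)
  refine tendsto_covDivergence G hG hδ hτ hV (C := C) hc hP ?_ ?_ ?_ hlam
  · filter_upwards [hP, hcol, eventually_ge_atTop m] with n hP hcol hmn u
    have hu := hP.isUnit_det hmn
    have h1 := hP.norm_sq_sub hu (X n *ᵥ u) (leastSquares (Q n) (X n *ᵥ u))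
    rw [sub_self, Matrix.mulVec_zero, zero_dotProduct, add_zero] at h1
    -- With minus the least squares coefficients for `v`, the combination `X u + Q v` is the
    -- residual of `X u`.
    have h2 := hcol u (-leastSquares (Q n) (X n *ᵥ u))
    rw [Matrix.mulVec_neg, ← sub_eq_add_neg, h1, neg_dotProduct_neg] at h2
    refine le_trans ?_ h2
    refine mul_le_mul_of_nonneg_left ?_ (by positivity)
    linarith [dotProduct_self_nonneg' (leastSquares (Q n) (X n *ᵥ u))]
  · filter_upwards [hP, hC, eventually_ge_atTop m] with n hP hC hmn i
    have h1 := hP.norm_sq_add (hP.isUnit_det hmn) ((X n).col i)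
    linarith [hC i, dotProduct_self_nonneg' (Q n *ᵥ leastSquares (Q n) ((X n).col i))]
  · filter_upwards [hP, hC, hcol, eventually_ge_atTop m, eventually_gt_atTop 0]
      with n hP hC hcol hmn hn
    refine Finset.sum_le_sum fun j _ => ?_
    have h1 := hP.norm_sq_add (hP.isUnit_det hmn) ((X n).col j)
    -- With `u = 0` the condition bounds `Qᵀ Q` below by `c n`, and the fitted vector is no longer
    -- than the data column. The factors `n` cancel, so the coefficients stay bounded.
    have h2 := hcol 0 (leastSquares (Q n) ((X n).col j))
    rw [Matrix.mulVec_zero, zero_add, zero_dotProduct, zero_add] at h2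
    have hn' : (0 : ℝ) < n := Nat.cast_pos.2 hn
    rw [le_div_iff₀ hc]
    refine le_of_mul_le_mul_right ?_ hn'
    linarith [hC j, dotProduct_self_nonneg' ((P n)ᵀ *ᵥ (X n).col j)]

end GivenData

/-! ### Data from the model, for a given realisation of the errors -/

section Model

variable {p m : ℕ} (G : Digraph (Fin p)) [DecidableRel G.Adj]

/-- A kernel vector satisfies `v = Γ v`, so each entry is determined by the entries at the parents.
Well-founded induction along ancestry makes all entries vanish. -/
lemma isUnit_det_one_sub_coefMatrix (hG : IsAcyclic G) (θ : Params G) :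
    IsUnit (1 - coefMatrix G θ).det := by
  rw [isUnit_iff_ne_zero]
  intro h0
  obtain ⟨v, hv, hv0⟩ := Matrix.exists_mulVec_eq_zero_iff.2 h0
  have hirr : Std.Irrefl (Relation.TransGen G.Adj) := ⟨hG⟩
  have hwf : WellFounded (Relation.TransGen G.Adj) := Finite.wellFounded_of_trans_of_irrefl _
  refine hv (funext fun i => ?_)
  induction i using hwf.induction with
  | _ i ih =>
    have h1 := congrFun hv0 i
    rw [Matrix.sub_mulVec, Matrix.one_mulVec, Pi.sub_apply, Pi.zero_apply, sub_eq_zero] at h1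
    rw [h1]
    simp only [Matrix.mulVec, dotProduct]
    refine Finset.sum_eq_zero fun j _ => ?_
    by_cases hji : G.Adj j i
    · rw [ih j (Relation.TransGen.single hji)]
      simp
    · simp [coefMatrix, hji]

lemma firstRows_mul_transpose {γ : (i : Fin p) → Parents G i → ℝ} {b : Fin p → Fin m → ℝ}
    {q : ℕ → Fin m → ℝ} {x ε : ℕ → Fin p → ℝ} {θ : Params G} (hθ : ∀ i, (θ i).1 = γ i)
    (hx : ∀ t i, x t i = ∑ j : Parents G i, γ i j * x t j + q t ⬝ᵥ b i + ε t i) (n : ℕ) :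
    firstRows x n * (1 - coefMatrix G θ)ᵀ =
      firstRows q n * (Matrix.of b)ᵀ + firstRows ε n := by
  ext t i
  have h1 : ∑ j : Parents G i, γ i j * x t j = ∑ j, coefMatrix G θ i j * x t j := by
    refine Fintype.sum_of_injective Subtype.val Subtype.val_injective _ _ (fun j hj => ?_)
      fun j => ?_
    · have : ¬ G.Adj j i := fun h => hj ⟨⟨j, h⟩, rfl⟩
      simp [coefMatrix, this]
    · simp [coefMatrix, j.2, hθ]
  have h2 := hx t i
  rw [h1] at h2
  rw [Matrix.transpose_sub, Matrix.transpose_one, Matrix.mul_sub, Matrix.mul_one]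
  simp only [Matrix.sub_apply, Matrix.add_apply, Matrix.mul_apply, firstRows, Matrix.of_apply,
    Matrix.transpose_apply, dotProduct] at h2 ⊢
  rw [h2]
  have h3 : ∑ j, x t j * coefMatrix G θ i j = ∑ j, coefMatrix G θ i j * x t j :=
    Finset.sum_congr rfl fun j _ => mul_comm _ _
  rw [h3]
  ring

lemma norm_sq_firstRows_mulVec (q : ℕ → Fin m → ℝ) (b : Fin m → ℝ) (n : ℕ) :
    (firstRows q n *ᵥ b) ⬝ᵥ (firstRows q n *ᵥ b) =
      ∑ t ∈ Finset.range n, (q t ⬝ᵥ b) ^ 2 := by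
  rw [Finset.sum_range]
  exact Finset.sum_congr rfl fun t _ => (sq _).symm

lemma norm_sq_leastSquares_mulVec_le {n : ℕ} (Q : Matrix (Fin n) (Fin m) ℝ)
    (E : Matrix (Fin n) (Fin p) ℝ) (v : Fin p → ℝ) :
    (Q *ᵥ leastSquares Q (E *ᵥ v)) ⬝ᵥ (Q *ᵥ leastSquares Q (E *ᵥ v)) ≤
      (∑ j, (Q *ᵥ leastSquares Q (E.col j)) ⬝ᵥ (Q *ᵥ leastSquares Q (E.col j))) *
        (v ⬝ᵥ v) := by
  set B : Matrix (Fin n) (Fin p) ℝ := Q * ((Qᵀ * Q)⁻¹ * (Qᵀ * E)) with hB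
  have h1 : Q *ᵥ leastSquares Q (E *ᵥ v) = B *ᵥ v := by
    rw [leastSquares, hB, ← Matrix.mulVec_mulVec, ← Matrix.mulVec_mulVec, ← Matrix.mulVec_mulVec]
  have h2 : ∀ j, B.col j = Q *ᵥ leastSquares Q (E.col j) := fun j => by
    rw [leastSquares, ← Matrix.mulVec_single_one, ← Matrix.mulVec_single_one, hB,
      ← Matrix.mulVec_mulVec, ← Matrix.mulVec_mulVec, ← Matrix.mulVec_mulVec]
  have h3 := norm_sq_mulVec_le B v
  simp_rw [h2] at h3
  rwa [h1]

lemma quadraticForm_sq_le {ι : Type*} [Fintype ι] (W : Matrix ι ι ℝ) (b : ι → ℝ) :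
    (b ⬝ᵥ W *ᵥ b) ^ 2 ≤ (∑ j, W.col j ⬝ᵥ W.col j) * (b ⬝ᵥ b) ^ 2 := by
  have h1 : (b ⬝ᵥ W *ᵥ b) ^ 2 ≤ (b ⬝ᵥ b) * ((W *ᵥ b) ⬝ᵥ (W *ᵥ b)) := by
    have := Finset.sum_mul_sq_le_sq_mul_sq Finset.univ b (W *ᵥ b)
    simpa only [dotProduct, sq] using this
  have h2 := mul_le_mul_of_nonneg_left (norm_sq_mulVec_le W b) (dotProduct_self_nonneg' b)
  linarith

lemma tendsto_log_div_sqrt :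
    Tendsto (fun n : ℕ => Real.log (n + 1) / √n) atTop (𝓝 0) := by
  have h1 : Tendsto (fun x : ℝ => Real.log x / x ^ (1 / 2 : ℝ)) atTop (𝓝 0) :=
    (isLittleO_log_rpow_atTop (by norm_num)).tendsto_div_nhds_zero
  have h2 : Tendsto (fun n : ℕ => (n : ℝ) + 1) atTop atTop :=
    tendsto_atTop_add_const_right _ _ tendsto_natCast_atTop_atTop
  have h3 := (h1.comp h2).const_mul 2
  rw [mul_zero] at h3
  refine tendsto_of_tendsto_of_tendsto_of_le_of_le' tendsto_const_nhds h3 ?_ ?_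
  · refine Eventually.of_forall fun n => div_nonneg (Real.log_nonneg ?_) (Real.sqrt_nonneg _)
    linarith [Nat.cast_nonneg (α := ℝ) n]
  · filter_upwards [eventually_gt_atTop 0] with n hn
    have hn1 : (1 : ℝ) ≤ n := by exact_mod_cast hn
    simp only [Function.comp_apply]
    rw [← Real.sqrt_eq_rpow, ← mul_div_assoc, div_le_div_iff₀ (by positivity) (by positivity)]
    have h4 : √((n : ℝ) + 1) ≤ 2 * √n := by
      rw [Real.sqrt_le_left (by positivity), mul_pow, Real.sq_sqrt (by positivity)]
      linarith
    have h5 : 0 ≤ Real.log ((n : ℝ) + 1) := Real.log_nonneg (by linarith)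
    nlinarith [mul_le_mul_of_nonneg_left h4 h5]

/-- Entrywise convergence of the normalised Gram matrix is convergence in Frobenius norm, which
makes the bound uniform in `v`. -/
lemma eventually_le_gram_errors {ε : ℕ → Fin p → ℝ} {ψ : Fin p → ℝ}
    (hlln : ∀ j k, Tendsto (fun n : ℕ => (∑ t ∈ Finset.range n, ε t j * ε t k) / n) atTop
      (𝓝 (if j = k then ψ j else 0))) {η : ℝ} (hη : 0 < η) :
    ∀ᶠ n : ℕ in atTop, ∀ v : Fin p → ℝ,
      n * (v ⬝ᵥ Matrix.diagonal ψ *ᵥ v - η * (v ⬝ᵥ v)) ≤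
        (firstRows ε n *ᵥ v) ⬝ᵥ (firstRows ε n *ᵥ v) := by
  set W : ℕ → Matrix (Fin p) (Fin p) ℝ := fun n =>
    (n : ℝ)⁻¹ • ((firstRows ε n)ᵀ * firstRows ε n) - Matrix.diagonal ψ with hW
  have hentry : ∀ j k, Tendsto (fun n => W n j k) atTop (𝓝 0) := fun j k => by
    have h1 := (hlln j k).sub_const (if j = k then ψ j else 0)
    rw [sub_self] at h1
    refine h1.congr fun n => ?_
    simp only [hW, Matrix.sub_apply, Matrix.smul_apply, Matrix.mul_apply, Matrix.transpose_apply,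
      firstRows, Matrix.of_apply, Matrix.diagonal_apply, smul_eq_mul]
    rw [Finset.sum_range]
    ring
  have hsum : Tendsto (fun n => ∑ k, (W n).col k ⬝ᵥ (W n).col k) atTop (𝓝 0) := by
    have : Tendsto (fun n => ∑ k, ∑ j, W n j k * W n j k) atTop
        (𝓝 (∑ _k : Fin p, ∑ _j : Fin p, 0 * 0)) :=
      tendsto_finsetSum _ fun k _ => tendsto_finsetSum _ fun j _ =>
        (hentry j k).mul (hentry j k)
    simpa [dotProduct, Matrix.col] using this
  filter_upwards [hsum.eventually_le_const (show (0 : ℝ) < η ^ 2 by positivity),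
    eventually_gt_atTop 0] with n hn hn0 v
  have hn' : (0 : ℝ) < n := Nat.cast_pos.2 hn0
  have h1 : (v ⬝ᵥ W n *ᵥ v) ^ 2 ≤ (η * (v ⬝ᵥ v)) ^ 2 := by
    rw [mul_pow]
    exact (quadraticForm_sq_le _ v).trans (mul_le_mul_of_nonneg_right hn (sq_nonneg _))
  have h2 := (abs_le.1 (abs_le_of_sq_le_sq h1
    (mul_nonneg hη.le (dotProduct_self_nonneg' v)))).1
  have h3 : v ⬝ᵥ W n *ᵥ v = (n : ℝ)⁻¹ * ((firstRows ε n *ᵥ v) ⬝ᵥ (firstRows ε n *ᵥ v)) -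
      v ⬝ᵥ Matrix.diagonal ψ *ᵥ v := by
    simp only [hW]
    rw [Matrix.sub_mulVec, dotProduct_sub, Matrix.smul_mulVec, dotProduct_smul, smul_eq_mul,
      quadraticForm_gram]
  rw [h3] at h2
  have h4 : v ⬝ᵥ Matrix.diagonal ψ *ᵥ v - η * (v ⬝ᵥ v) ≤
      (n : ℝ)⁻¹ * ((firstRows ε n *ᵥ v) ⬝ᵥ (firstRows ε n *ᵥ v)) := by linarith
  rwa [le_inv_mul_iff₀ hn'] at h4

/-- Solving the model gives `X u = Q (bᵀ N u) + ε (N u)`, with `b` read as a matrix and `N` the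
inverse of `(I - Γ)ᵀ`. `Pᵀ` kills the first term, so the residual Gram matrix is that of the errors
less a projection of size `O(log n)`. -/
theorem tendsto_covDivergence_of_errors (hG : IsAcyclic G) {δ τ : ℝ} (hδ : 0 < δ)
    (hτ : 0 < τ) {V : Matrix (Fin m) (Fin m) ℝ} (hV : V.PosDef)
    {γ : (i : Fin p) → Parents G i → ℝ} {ψ : Fin p → ℝ} (hψ : ∀ i, 0 < ψ i)
    {b : Fin p → Fin m → ℝ} {q : ℕ → Fin m → ℝ} {x ε : ℕ → Fin p → ℝ}
    {P : (n : ℕ) → Matrix (Fin n) (Fin (n - m)) ℝ}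
    (hx : ∀ t i, x t i = ∑ j : Parents G i, γ i j * x t j + q t ⬝ᵥ b i + ε t i)
    (hP : ∀ᶠ n in atTop, IsResidualContrast (firstRows q n) (P n))
    (hlln : ∀ j k, Tendsto (fun n : ℕ => (∑ t ∈ Finset.range n, ε t j * ε t k) / n) atTop
      (𝓝 (if j = k then ψ j else 0)))
    {K : ℝ} (hproj : ∀ᶠ n : ℕ in atTop, ∑ k,
      (firstRows q n *ᵥ leastSquares (firstRows q n) ((firstRows ε n).col k)) ⬝ᵥ
        (firstRows q n *ᵥ leastSquares (firstRows q n) ((firstRows ε n).col k)) ≤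
      K * Real.log (n + 1)) :
    Tendsto (fun n => covDivergence G δ τ V (firstRows q n) (P n) (firstRows x n))
      atTop (𝓝 0) := by
  -- The variances play no part in the coefficient matrix, so 0 fills their place.
  set θ : Params G := fun i => (γ i, 0)
  set A : Matrix (Fin p) (Fin p) ℝ := (1 - coefMatrix G θ)ᵀ with hA
  have hAu : IsUnit A.det := by
    rw [hA, Matrix.det_transpose]
    exact isUnit_det_one_sub_coefMatrix G hG θ
  set N : (Fin p → ℝ) → Fin p → ℝ := fun u => A⁻¹ *ᵥ u with hN
  have hAN : ∀ u, A *ᵥ N u = u := fun u => by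
    rw [hN, Matrix.mulVec_mulVec, Matrix.mul_nonsing_inv _ hAu, Matrix.one_mulVec]
  have hXu : ∀ n u, firstRows x n *ᵥ u =
      firstRows q n *ᵥ ((Matrix.of b)ᵀ *ᵥ N u) + firstRows ε n *ᵥ N u := fun n u => by
    conv_lhs => rw [← hAN u]
    rw [Matrix.mulVec_mulVec, hA, firstRows_mul_transpose G (θ := θ) (fun _ => rfl) hx n,
      Matrix.add_mulVec, ← Matrix.mulVec_mulVec]
  have hPX : ∀ n u, IsResidualContrast (firstRows q n) (P n) →
      (P n)ᵀ *ᵥ (firstRows x n *ᵥ u) = (P n)ᵀ *ᵥ (firstRows ε n *ᵥ N u) := fun n u h => by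
    rw [hXu, Matrix.mulVec_add, Matrix.mulVec_mulVec, h.1, Matrix.zero_mulVec, zero_add]
  set F : ℝ := ∑ j, A.col j ⬝ᵥ A.col j with hF
  have hF0 : 0 ≤ F := Finset.sum_nonneg fun j _ => dotProduct_self_nonneg' _
  have hNlow : ∀ u, u ⬝ᵥ u ≤ (1 + F) * (N u ⬝ᵥ N u) := fun u => by
    have := norm_sq_mulVec_le A (N u)
    rw [hAN] at this
    linarith [dotProduct_self_nonneg' (N u)]
  obtain ⟨ρ, hρ, hρψ⟩ := exists_le_quadraticForm (Matrix.isSymm_diagonal ψ) fun u hu => by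
    simpa using (Matrix.PosDef.diagonal hψ).dotProduct_mulVec_pos hu
  have hlog : Tendsto (fun n : ℕ => K * (Real.log (n + 1) / √n * (√(n : ℝ))⁻¹)) atTop (𝓝 0) := by
    have := (tendsto_log_div_sqrt.mul (tendsto_inv_atTop_zero.comp
      (Real.tendsto_sqrt_atTop.comp tendsto_natCast_atTop_atTop))).const_mul K
    simpa using this
  have hlogev : ∀ᶠ n : ℕ in atTop, K * Real.log (n + 1) ≤ ρ / 4 * n := by
    filter_upwards [hlog.eventually_le_const (show (0 : ℝ) < ρ / 4 by positivity),
      eventually_gt_atTop 0] with n hn hn0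
    have hn' : (0 : ℝ) < n := Nat.cast_pos.2 hn0
    have h2 : √(n : ℝ) * √(n : ℝ) = n := Real.mul_self_sqrt hn'.le
    have h3 : 0 < √(n : ℝ) := Real.sqrt_pos.2 hn'
    have h4 : K * (Real.log (n + 1) / √n * (√(n : ℝ))⁻¹) = K * Real.log (n + 1) / n := by
      rw [← div_eq_mul_inv, div_div, h2, mul_div_assoc]
    rw [h4, div_le_iff₀ hn'] at hn
    exact hn
  obtain ⟨n₀, hn₀, hmn₀⟩ := (hP.and (eventually_ge_atTop m)).exists
  obtain ⟨σ, hσ, hσq⟩ : ∃ σ : ℝ, 0 < σ ∧ ∀ y : Fin m → ℝ,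
      σ * (y ⬝ᵥ y) ≤ (firstRows q n₀ *ᵥ y) ⬝ᵥ (firstRows q n₀ *ᵥ y) := by
    obtain ⟨σ, hσ, h⟩ := exists_le_quadraticForm (isSymm_gram (firstRows q n₀)) fun u hu => by
      rw [quadraticForm_gram]
      refine dotProduct_self_pos fun h0 => hu ?_
      have h1 : ((firstRows q n₀)ᵀ * firstRows q n₀) *ᵥ u = 0 := by
        rw [← Matrix.mulVec_mulVec, h0, Matrix.mulVec_zero]
      have h2 := congrArg (fun z => ((firstRows q n₀)ᵀ * firstRows q n₀)⁻¹ *ᵥ z) h1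
      simpa [Matrix.mulVec_mulVec, Matrix.nonsing_inv_mul _ (hn₀.isUnit_det hmn₀)] using h2
    exact ⟨σ, hσ, fun y => by rw [← quadraticForm_gram]; exact h y⟩
  -- New rows only add squares to `|Q y|²`, so the bound at one index persists. No growth of `Qᵀ Q`
  -- is needed.
  have hσn : ∀ n, n₀ ≤ n → ∀ y : Fin m → ℝ,
      σ * (y ⬝ᵥ y) ≤ (firstRows q n *ᵥ y) ⬝ᵥ (firstRows q n *ᵥ y) := fun n hn y => by
    refine (hσq y).trans ?_
    rw [norm_sq_firstRows_mulVec, norm_sq_firstRows_mulVec]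
    exact Finset.sum_le_sum_of_subset_of_nonneg (Finset.range_mono hn) fun _ _ _ => sq_nonneg _
  set e : Fin p → Fin p → ℝ := fun i => Pi.single i 1
  set R : ℝ := ∑ i, N (e i) ⬝ᵥ N (e i) with hR
  have hRi : ∀ i, N (e i) ⬝ᵥ N (e i) ≤ R := fun i =>
    Finset.single_le_sum (f := fun i => N (e i) ⬝ᵥ N (e i))
      (fun i _ => dotProduct_self_nonneg' _) (Finset.mem_univ i)
  set T : ℝ := ∑ i, ((Matrix.of b)ᵀ *ᵥ N (e i)) ⬝ᵥ ((Matrix.of b)ᵀ *ᵥ N (e i)) with hT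
  have hlam : Tendsto (fun n : ℕ => (2 * T + 2 * R * K / σ * Real.log (n + 1)) / √n)
      atTop (𝓝 0) := by
    have h1 : Tendsto (fun n : ℕ => 2 * T / √n) atTop (𝓝 0) :=
      tendsto_const_nhds.div_atTop (Real.tendsto_sqrt_atTop.comp tendsto_natCast_atTop_atTop)
    have h2 := h1.add (tendsto_log_div_sqrt.const_mul (2 * R * K / σ))
    rw [mul_zero, add_zero] at h2
    refine h2.congr fun n => ?_
    ring
  refine tendsto_covDivergence G hG hδ hτ hV (c := ρ / 2 / (1 + F)) (C := (∑ k, (ψ k + 1)) * R)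
    (by positivity) hP ?_ ?_ ?_ hlam
  · filter_upwards [hP, hproj, hlogev, eventually_ge_atTop m,
      eventually_le_gram_errors hlln (show 0 < ρ / 4 by positivity)] with n hP hproj hlogev hmn hgram u
    rw [hPX n u hP]
    have h1 := hP.norm_sq_add (hP.isUnit_det hmn) (firstRows ε n *ᵥ N u)
    have h2 := norm_sq_leastSquares_mulVec_le (firstRows q n) (firstRows ε n) (N u)
    have h3 := hgram (N u)
    have hNN := dotProduct_self_nonneg' (N u)
    have h4 := mul_le_mul_of_nonneg_right (hproj.trans hlogev) hNN
    have h5 := mul_le_mul_of_nonneg_left (hρψ (N u)) (Nat.cast_nonneg (α := ℝ) n)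
    have h6 : ρ / 2 / (1 + F) * n * (u ⬝ᵥ u) ≤ ρ / 2 * n * (N u ⬝ᵥ N u) := by
      calc ρ / 2 / (1 + F) * n * (u ⬝ᵥ u) ≤ ρ / 2 / (1 + F) * n * ((1 + F) * (N u ⬝ᵥ N u)) :=
            mul_le_mul_of_nonneg_left (hNlow u) (by positivity)
        _ = _ := by field_simp
    -- The errors give `ρ n`. The fluctuation of their Gram matrix and the projection onto `Q` each
    -- cost at most `ρ / 4 * n`, which leaves `ρ / 2 * n`.
    linarith
  · have hsq : ∀ᶠ n : ℕ in atTop, ∀ k,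
        (firstRows ε n).col k ⬝ᵥ (firstRows ε n).col k ≤ (ψ k + 1) * n := by
      rw [eventually_all]
      intro k
      have h1 := hlln k k
      rw [if_pos rfl] at h1
      filter_upwards [h1.eventually_le_const (lt_add_one (ψ k)), eventually_gt_atTop 0]
        with n hn hn0
      rw [div_le_iff₀ (Nat.cast_pos.2 hn0), Finset.sum_range] at hn
      exact hn
    filter_upwards [hP, hsq, eventually_ge_atTop m] with n hP hsq hmn i
    have h0 : (firstRows x n).col i = firstRows x n *ᵥ e i := (Matrix.mulVec_single_one _ _).symm
    rw [h0, hPX n _ hP]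
    have h1 := hP.norm_sq_add (hP.isUnit_det hmn) (firstRows ε n *ᵥ N (e i))
    have h2 := norm_sq_mulVec_le (firstRows ε n) (N (e i))
    have h3 : (∑ k, (firstRows ε n).col k ⬝ᵥ (firstRows ε n).col k) ≤ (∑ k, (ψ k + 1)) * n := by
      rw [Finset.sum_mul]
      exact Finset.sum_le_sum fun k _ => hsq k
    have h4 : 0 ≤ (∑ k, (ψ k + 1)) * (n : ℝ) :=
      mul_nonneg (Finset.sum_nonneg fun k _ => by linarith [hψ k]) (Nat.cast_nonneg _)
    have h5 := h2.trans (mul_le_mul h3 (hRi i) (dotProduct_self_nonneg' _) h4)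
    linarith [dotProduct_self_nonneg'
      (firstRows q n *ᵥ leastSquares (firstRows q n) (firstRows ε n *ᵥ N (e i)))]
  · filter_upwards [hP, hproj, eventually_ge_atTop m, eventually_ge_atTop n₀]
      with n hP hproj hmn hn
    have hu := hP.isUnit_det hmn
    have hj : ∀ j, leastSquares (firstRows q n) ((firstRows x n).col j) ⬝ᵥ
        leastSquares (firstRows q n) ((firstRows x n).col j) ≤
        2 * (((Matrix.of b)ᵀ *ᵥ N (e j)) ⬝ᵥ ((Matrix.of b)ᵀ *ᵥ N (e j))) +
        2 * (N (e j) ⬝ᵥ N (e j)) * (K / σ * Real.log (n + 1)) := fun j => by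
      have h0 : leastSquares (firstRows q n) ((firstRows x n).col j) =
          (Matrix.of b)ᵀ *ᵥ N (e j) +
            leastSquares (firstRows q n) (firstRows ε n *ᵥ N (e j)) := by
        rw [← Matrix.mulVec_single_one, hXu, leastSquares, leastSquares, Matrix.mulVec_add,
          Matrix.mulVec_add, Matrix.mulVec_mulVec _ (firstRows q n)ᵀ, Matrix.mulVec_mulVec _ _⁻¹,
          Matrix.nonsing_inv_mul _ hu, Matrix.one_mulVec]
      rw [h0]
      set y := (Matrix.of b)ᵀ *ᵥ N (e j)
      set z := leastSquares (firstRows q n) (firstRows ε n *ᵥ N (e j)) with hz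
      have h1 := dotProduct_self_nonneg' (y - z)
      rw [sub_dotProduct, dotProduct_sub, dotProduct_sub] at h1
      have h2 : z ⬝ᵥ z ≤ N (e j) ⬝ᵥ N (e j) * (K / σ * Real.log (n + 1)) := by
        have h3 := hσn n hn z
        have h4 := norm_sq_leastSquares_mulVec_le (firstRows q n) (firstRows ε n) (N (e j))
        have h5 := h4.trans (mul_le_mul_of_nonneg_right hproj (dotProduct_self_nonneg' _))
        have h6 : N (e j) ⬝ᵥ N (e j) * (K / σ * Real.log (n + 1)) =
            K * Real.log (n + 1) * (N (e j) ⬝ᵥ N (e j)) / σ := by ring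
        rw [h6, le_div_iff₀ hσ]
        linarith
      rw [add_dotProduct, dotProduct_add, dotProduct_add]
      linarith
    refine (Finset.sum_le_sum fun j _ => hj j).trans_eq ?_
    rw [Finset.sum_add_distrib, ← Finset.mul_sum, ← Finset.sum_mul, ← Finset.mul_sum, ← hT, ← hR]
    ring

end Model

/-! ### Almost sure behaviour of the errors -/

section Errors

lemma hasSubgaussianMGF_of_hasLaw {Ω : Type*} [MeasurableSpace Ω] {μ : Measure Ω}
    {X : Ω → ℝ} {v : ℝ≥0} (h : HasLaw X (gaussianReal 0 v) μ) :
    HasSubgaussianMGF X v μ := by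
  refine HasSubgaussianMGF.of_map (X := id) h.aemeasurable ?_
  rw [h.map_eq]
  refine ⟨fun t => integrable_exp_mul_gaussianReal t, fun t => ?_⟩
  rw [mgf_id_gaussianReal]
  simp

variable {Ω : Type*} [MeasurableSpace Ω] {μ : Measure Ω} [IsProbabilityMeasure μ] {p m : ℕ}
  {ε : ℕ × Fin p → Ω → ℝ} {ψ : Fin p → ℝ≥0}

/-- The strong law applies to the products over `t`. Their mean is the variance when `j = k`, and
zero otherwise by independence. -/
lemma ae_tendsto_error_products (hind : iIndepFun ε μ)
    (hlaw : ∀ t i, HasLaw (ε (t, i)) (gaussianReal 0 (ψ i)) μ) (j k : Fin p) :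
    ∀ᵐ ω ∂μ, Tendsto (fun n : ℕ => (∑ t ∈ Finset.range n, ε (t, j) ω * ε (t, k) ω) / n) atTop
      (𝓝 (if j = k then (ψ j : ℝ) else 0)) := by
  have hmem : ∀ t i, MemLp (ε (t, i)) 2 μ := fun t i => by
    have h1 : MemLp id 2 (μ.map (ε (t, i))) := by
      rw [(hlaw t i).map_eq]
      exact memLp_id_gaussianReal 2
    exact (memLp_map_measure_iff aestronglyMeasurable_id (hlaw t i).aemeasurable).1 h1
  have hmeas : ∀ z : ℕ × Fin p, AEMeasurable (ε z) μ := fun z => (hlaw z.1 z.2).aemeasurable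
  have hid : ∀ t i, IdentDistrib (ε (t, i)) (ε (0, i)) μ μ := fun t i =>
    ⟨hmeas _, hmeas _, by rw [(hlaw t i).map_eq, (hlaw 0 i).map_eq]⟩
  have hmean : ∀ t i, ∫ ω, ε (t, i) ω ∂μ = 0 := fun t i => by
    rw [(hlaw t i).integral_eq]
    simp
  have hmul : Measurable fun z : ℝ × ℝ => z.1 * z.2 := by fun_prop
  have h := strong_law_ae_real (μ := μ) (fun t ω => ε (t, j) ω * ε (t, k) ω)
    ((hmem 0 j).integrable_mul (hmem 0 k))
    (fun s t hst => by
      have hne : ∀ a b : Fin p, ((s, a) : ℕ × Fin p) ≠ (t, b) := fun a b hab =>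
        hst (Prod.ext_iff.1 hab).1
      exact (hind.indepFun_prodMk_prodMk₀ hmeas (s, j) (s, k) (t, j) (t, k) (hne _ _) (hne _ _)
        (hne _ _) (hne _ _)).comp hmul hmul)
    (fun t => by
      by_cases hjk : j = k
      · subst hjk
        exact (hid t j).comp (u := fun y => y * y) (by fun_prop)
      · have hne : ∀ s : ℕ, ((s, j) : ℕ × Fin p) ≠ (s, k) := fun s h => hjk (Prod.ext_iff.1 h).2
        exact ((hid t j).prodMk (hid t k) (hind.indepFun (hne t)) (hind.indepFun (hne 0))).comp
          hmul)
  convert h using 4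
  split_ifs with hjk
  · subst hjk
    have h1 : Var[ε (0, j); μ] = ψ j := by
      rw [(hlaw 0 j).variance_eq]
      simp
    rw [variance_eq_sub (hmem 0 j), hmean] at h1
    rw [← h1]
    simp [sq]
  · have hne : ((0, j) : ℕ × Fin p) ≠ (0, k) := fun h => hjk (Prod.ext_iff.1 h).2
    have h1 := (hind.indepFun hne).integral_fun_mul_eq_mul_integral
      (hmeas (0, j)).aestronglyMeasurable (hmeas (0, k)).aestronglyMeasurable
    rw [h1, hmean, zero_mul]

lemma measureReal_abs_ge_le {X : Ω → ℝ} {v : ℝ≥0} (h : HasSubgaussianMGF X v μ) {r : ℝ}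
    (hr : 0 ≤ r) : μ.real {ω | r ≤ |X ω|} ≤ 2 * Real.exp (-r ^ 2 / (2 * v)) := by
  have h1 : {ω | r ≤ |X ω|} ⊆ {ω | r ≤ X ω} ∪ {ω | r ≤ (-X) ω} := fun ω hω => by
    rcases le_abs.1 (show r ≤ |X ω| from hω) with h | h
    · exact Or.inl h
    · exact Or.inr h
  calc μ.real {ω | r ≤ |X ω|} ≤ μ.real ({ω | r ≤ X ω} ∪ {ω | r ≤ (-X) ω}) := measureReal_mono h1
    _ ≤ μ.real {ω | r ≤ X ω} + μ.real {ω | r ≤ (-X) ω} := measureReal_union_le _ _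
    _ ≤ _ := by linarith [h.measure_ge_le hr, h.neg.measure_ge_le hr]

/-- A combination with coefficient vector of length at most 1 is sub-Gaussian with proxy `ψ k`. The
threshold `4 ψ log (n + 1)` makes the tail `2 / (n + 1)²`, and Borel–Cantelli applies. No
independence across `n` is needed, so `u n` may change freely with `n`. -/
lemma ae_eventually_contrast_le (hind : iIndepFun ε μ)
    (hlaw : ∀ t i, HasLaw (ε (t, i)) (gaussianReal 0 (ψ i)) μ) (hψ : ∀ i, 0 < ψ i) (k : Fin p)
    (u : (n : ℕ) → Fin n → ℝ) (hu : ∀ n, u n ⬝ᵥ u n ≤ 1) :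
    ∀ᵐ ω ∂μ, ∀ᶠ n : ℕ in atTop,
      (∑ t : Fin n, u n t * ε (t, k) ω) ^ 2 ≤ 4 * ψ k * Real.log (n + 1) := by
  have hsub : ∀ n, HasSubgaussianMGF (fun ω => ∑ t : Fin n, u n t * ε (t, k) ω) (ψ k) μ := by
    intro n
    have hi : iIndepFun (fun (t : Fin n) ω => u n t * ε (t, k) ω) μ := by
      have h1 : iIndepFun (fun t : Fin n => ε ((t : ℕ), k)) μ :=
        hind.precomp (g := fun t : Fin n => ((t : ℕ), k)) fun s t hst =>
          Fin.ext (Prod.ext_iff.1 hst).1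
      exact h1.comp (fun t y => u n t * y) fun t => by fun_prop
    have hc : ∀ t : Fin n, HasSubgaussianMGF (fun ω => u n t * ε (t, k) ω)
        (‖u n t‖₊ ^ 2 * ψ k) μ := fun t => by
      convert (hasSubgaussianMGF_of_hasLaw (hlaw t k)).const_mul (u n t)
      exact congrArg (· * ψ k) (NNReal.eq (sq_abs (u n t)))
    have h2 := HasSubgaussianMGF.sum_of_iIndepFun hi (s := Finset.univ) fun t _ => hc t
    refine ⟨h2.integrable_exp_mul, fun r => (h2.mgf_le r).trans (Real.exp_le_exp.2 ?_)⟩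
    gcongr
    rw [← Finset.sum_mul]
    refine mul_le_of_le_one_left zero_le (NNReal.coe_le_coe.1 ?_)
    simpa [dotProduct, sq] using hu n
  set r : ℕ → ℝ := fun n => √(4 * ψ k * Real.log (n + 1)) with hr
  have hlog : ∀ n : ℕ, 0 ≤ 4 * (ψ k : ℝ) * Real.log (n + 1) := fun n =>
    mul_nonneg (by positivity) (Real.log_nonneg (by linarith [Nat.cast_nonneg (α := ℝ) n]))
  have hψk : (0 : ℝ) < ψ k := hψ k
  have hbound : ∀ n, μ.real {ω | r n ≤ |∑ t : Fin n, u n t * ε (t, k) ω|} ≤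
      2 * (1 / ((n + 1 : ℕ) : ℝ) ^ 2) := fun n => by
    refine (measureReal_abs_ge_le (hsub n) (Real.sqrt_nonneg _)).trans_eq ?_
    congr 1
    have h1 : -r n ^ 2 / (2 * (ψ k : ℝ)) = -(2 * Real.log (n + 1)) := by
      rw [hr, Real.sq_sqrt (hlog n)]
      field_simp
      ring
    have h2 : (0 : ℝ) < n + 1 := by positivity
    rw [h1, Real.exp_neg, mul_comm 2, Real.exp_mul, Real.exp_log h2]
    push_cast
    rw [one_div]
    norm_num
  have hsumm : Summable fun n : ℕ => 2 * (1 / ((n + 1 : ℕ) : ℝ) ^ 2) :=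
    ((summable_nat_add_iff 1).2 (Real.summable_one_div_nat_pow.2 one_lt_two)).mul_left 2
  have htsum : ∑' n, μ {ω | r n ≤ |∑ t : Fin n, u n t * ε (t, k) ω|} ≠ ∞ := by
    refine ne_top_of_le_ne_top hsumm.tsum_ofReal_ne_top (ENNReal.tsum_le_tsum fun n => ?_)
    rw [← ofReal_measureReal]
    exact ENNReal.ofReal_le_ofReal (hbound n)
  filter_upwards [ae_eventually_notMem htsum] with ω hω
  filter_upwards [hω] with n hn
  have h1 : |∑ t : Fin n, u n t * ε (t, k) ω| ≤ r n := (not_le.1 hn).le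
  have h2 := pow_le_pow_left₀ (abs_nonneg _) h1 2
  rwa [sq_abs, hr, Real.sq_sqrt (hlog n)] at h2

end Errors

-- Take `U = Q Bᵀ` with `Bᵀ B = (Qᵀ Q)⁻¹`. The squared length of the projection onto the columns of
-- `Q` then becomes a sum of `m` squared unit contrasts, to which the tail bound applies.
open scoped MatrixOrder in
lemma exists_orthonormal_columns {n m : ℕ} {Q : Matrix (Fin n) (Fin m) ℝ}
    (hu : IsUnit (Qᵀ * Q).det) :
    ∃ U : Matrix (Fin n) (Fin m) ℝ, (∀ l, U.col l ⬝ᵥ U.col l = 1) ∧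
      ∀ r, (Q *ᵥ leastSquares Q r) ⬝ᵥ (Q *ᵥ leastSquares Q r) = (Uᵀ *ᵥ r) ⬝ᵥ (Uᵀ *ᵥ r) := by
  have hpsd : ((Qᵀ * Q)⁻¹).PosSemidef := by
    have := Matrix.posSemidef_conjTranspose_mul_self Q
    rw [Matrix.conjTranspose_eq_transpose_of_trivial] at this
    exact this.inv
  obtain ⟨B, hB⟩ := CStarAlgebra.nonneg_iff_eq_star_mul_self.mp hpsd.nonneg
  rw [Matrix.star_eq_conjTranspose, Matrix.conjTranspose_eq_transpose_of_trivial] at hB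
  refine ⟨Q * Bᵀ, fun l => ?_, fun r => ?_⟩
  · have h1 : Bᵀ * (B * (Qᵀ * Q)) = 1 := by
      rw [← Matrix.mul_assoc, ← hB, Matrix.nonsing_inv_mul _ hu]
    have h2 : (Q * Bᵀ)ᵀ * (Q * Bᵀ) = 1 := by
      rw [Matrix.transpose_mul, Matrix.transpose_transpose, Matrix.mul_assoc,
        ← Matrix.mul_assoc Qᵀ, ← Matrix.mul_assoc]
      exact mul_eq_one_comm.1 h1
    have h3 := congrFun (congrFun h2 l) l
    rw [Matrix.one_apply_eq, Matrix.mul_apply] at h3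
    exact h3
  · rw [← quadraticForm_gram, leastSquares, Matrix.mulVec_mulVec _ (Qᵀ * Q),
      Matrix.mul_nonsing_inv _ hu, Matrix.one_mulVec, Matrix.transpose_mul,
      Matrix.transpose_transpose, ← Matrix.mulVec_mulVec, ← quadraticForm_gram B, ← hB,
      dotProduct_comm]

end ExoNetwork

/-! ### The two situations of the theorem. -/

theorem theorem1 {p m : ℕ} (G : Digraph (Fin p)) [DecidableRel G.Adj]
    (hG : ExoNetwork.IsAcyclic G) (δ τ : ℝ) (hδ : 0 < δ) (hτ : 0 < τ)
    (V : Matrix (Fin m) (Fin m) ℝ) (hV : V.PosDef) :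
    -- random data that follow the model
    (∀ {Ω : Type*} [MeasurableSpace Ω] (μ : Measure Ω) [IsProbabilityMeasure μ]
        (γ : (i : Fin p) → ExoNetwork.Parents G i → ℝ) (ψ : Fin p → ℝ≥0)
        (b : Fin p → Fin m → ℝ) (q : ℕ → Fin m → ℝ) (x : ℕ → Fin p → Ω → ℝ)
        (P : (n : ℕ) → Matrix (Fin n) (Fin (n - m)) ℝ),
        (∀ i, 0 < ψ i) →
        ExoNetwork.FollowsModel G μ γ ψ b q x →
        (∃ n, (ExoNetwork.firstRows q n).rank = m) →
        (∀ᶠ n in atTop, ExoNetwork.IsResidualContrast (ExoNetwork.firstRows q n) (P n)) →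
        ∀ᵐ ω ∂μ, Tendsto
          (fun n => ExoNetwork.covDivergence G δ τ V (ExoNetwork.firstRows q n) (P n)
            (ExoNetwork.firstRows (fun t i => x t i ω) n)) atTop (𝓝 0)) ∧
    -- given (for example centred and scaled) data, asymptotically not collinear
    (∀ (Q : (n : ℕ) → Matrix (Fin n) (Fin m) ℝ) (X : (n : ℕ) → Matrix (Fin n) (Fin p) ℝ)
        (P : (n : ℕ) → Matrix (Fin n) (Fin (n - m)) ℝ) (c C : ℝ),
        0 < c →
        (∀ᶠ n in atTop, ExoNetwork.IsResidualContrast (Q n) (P n)) →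
        (∀ᶠ n : ℕ in atTop, ∀ i, (X n).col i ⬝ᵥ (X n).col i ≤ C * n) →
        (∀ᶠ n : ℕ in atTop, ∀ (u : Fin p → ℝ) (v : Fin m → ℝ),
          c * n * (u ⬝ᵥ u + v ⬝ᵥ v) ≤
            (X n *ᵥ u + Q n *ᵥ v) ⬝ᵥ (X n *ᵥ u + Q n *ᵥ v)) →
        Tendsto (fun n => ExoNetwork.covDivergence G δ τ V (Q n) (P n) (X n))
          atTop (𝓝 0)) := by
  refine ⟨?_, fun Q X P c C hc hP hC hcol =>
    ExoNetwork.tendsto_covDivergence_of_not_collinear G hG hδ hτ hV hc hP hC hcol⟩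
  rintro Ω _ μ _ γ ψ b q x P hψ ⟨ε, hind, hlaw, hx⟩ - hP
  have hU : ∀ n, ∃ U : Matrix (Fin n) (Fin m) ℝ, (∀ l, U.col l ⬝ᵥ U.col l ≤ 1) ∧
      (IsUnit ((ExoNetwork.firstRows q n)ᵀ * ExoNetwork.firstRows q n).det → ∀ r,
        (ExoNetwork.firstRows q n *ᵥ ExoNetwork.leastSquares (ExoNetwork.firstRows q n) r) ⬝ᵥ
          (ExoNetwork.firstRows q n *ᵥ ExoNetwork.leastSquares (ExoNetwork.firstRows q n) r) =
        (Uᵀ *ᵥ r) ⬝ᵥ (Uᵀ *ᵥ r)) := fun n => by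
    by_cases hu : IsUnit ((ExoNetwork.firstRows q n)ᵀ * ExoNetwork.firstRows q n).det
    · obtain ⟨U, h1, h2⟩ := ExoNetwork.exists_orthonormal_columns hu
      exact ⟨U, fun l => (h1 l).le, fun _ => h2⟩
    -- For the indices with singular `Qᵀ Q` any contrast of length at most 1 will do, so that `U n`
    -- is defined for all `n`.
    · exact ⟨0, fun l => by simp [dotProduct], fun h => absurd h hu⟩
  choose U hU1 hU2 using hU
  have hlln : ∀ᵐ ω ∂μ, ∀ j k, Tendsto (fun n : ℕ =>
      (∑ t ∈ Finset.range n, ε (t, j) ω * ε (t, k) ω) / n) atTop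
      (𝓝 (if j = k then (ψ j : ℝ) else 0)) := by
    simp only [ae_all_iff]
    exact fun j k => ExoNetwork.ae_tendsto_error_products hind hlaw j k
  have htail : ∀ᵐ ω ∂μ, ∀ k l, ∀ᶠ n : ℕ in atTop,
      (∑ t : Fin n, (U n).col l t * ε (t, k) ω) ^ 2 ≤ 4 * ψ k * Real.log (n + 1) := by
    simp only [ae_all_iff]
    exact fun k l => ExoNetwork.ae_eventually_contrast_le hind hlaw hψ k
      (fun n => (U n).col l) fun n => hU1 n l
  filter_upwards [hlln, htail] with ω hlln htail
  refine ExoNetwork.tendsto_covDivergence_of_errors G hG hδ hτ hV (ψ := fun i => (ψ i : ℝ)) hψ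
    (ε := fun t i => ε (t, i) ω) (fun t i => hx t i ω) hP hlln
    (K := ∑ k, ∑ _l : Fin m, 4 * (ψ k : ℝ)) ?_
  have htail' : ∀ᶠ n : ℕ in atTop, ∀ k l,
      (∑ t : Fin n, (U n).col l t * ε (t, k) ω) ^ 2 ≤ 4 * ψ k * Real.log (n + 1) := by
    simp only [eventually_all]
    exact htail
  filter_upwards [hP, htail', eventually_ge_atTop m] with n hP htail hmn
  rw [Finset.sum_mul]
  refine Finset.sum_le_sum fun k _ => ?_
  rw [hU2 n (hP.isUnit_det hmn), Finset.sum_mul]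
  refine Finset.sum_le_sum fun l _ => ?_
  rw [← sq]
  exact htail k l
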